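/- A **$\mathbb Z$-algebra** is an abelian group $R^+$ with a $\mathbb Z$-bilinear multiplication (not necessarily associative, commutative or unital); it is **finite** if $R^+$ is finitely generated. Let $\mathrm{Ann}_\lambda(R)=\{a\mid aR=0\}$, $\mathrm{Ann}_\rho(R)=\{a\mid Ra=0\}$, $\mathrm{Ann}(R)=\mathrm{Ann}_\lambda(R)\cap \mathrm{Ann}_\rho(R)$, let $R^2$ be the subgroup of $R^+$ generated by all products, let $f_R: R^+/\mathrm{Ann}_\lambda(R)\times R^+/\mathrm{Ann}_\rho(R)\to R^2$ be the map induced by the multiplication, and let $\eta:R\to R^+/\mathrm{Ann}_\lambda(R)\times R^+/\mathrm{Ann}_\rho(R)$ be the canonical diagonal homomorphism. For a bilinear map $f:N_1\times N_2\to M$ let $\mathrm{Sym}(f)=\{(\phi_1,\phi_2)\in \mathrm{End}(N_1)\times\mathrm{End}(N_2)\mid f(\phi_1(a),b)=f(a,\phi_2(b)) \text{ for all } a,b\}$, let $Z(\mathrm{Sym}(f))$ be the set of elements of $\mathrm{Sym}(f)$ commuting with all of $\mathrm{Sym}(f)$, and let $\mathfrak S(f)$ be the ring of all $\phi\in Z(\mathrm{Sym}(f))$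 for which $\sum_i f(a_i,b_i)\mapsto\sum_i f(\phi_1(a_i),b_i)$ is well defined. Let $\mathfrak S(R)$ be the largest subring $S$ of $\mathfrak S(f_R)$ such that the canonical maps from $R^2$ to $R^+/\mathrm{Ann}_\lambda(R)$ and to $R^+/\mathrm{Ann}_\rho(R)$ are $S$-linear and $\eta(R)$ is an $S$-submodule. It is a commutative ring, and it is the maximal ring of scalars of $R$: with the action on $R/\mathrm{Ann}(R)\cong\eta(R)$ and on $R^2$, it is a commutative ring $S$ such that $R/\mathrm{Ann}(R)$ and $R^2$ are faithful $S$-modules, the multiplication $R/\mathrm{Ann}(R)\times R/\mathrm{Ann}(R)\to R^2$ is $S$-bilinear and the canonical map $R^2\to R/\mathrm{Ann}(R)$ is $S$-linear; and every other such ring embeds into it compatibly with the actions. **Corollary.** Let a finite $\mathbb Z$-algebra $R$ be given by a finite presentation of $R^+$ with generators $a_1,\dots,a_n$ and by integers $s_{ijk}$ with $a_ia_j=\sum_k s_{ijk}a_k$. Let $b_i$ and $c_i$ be the residue classes of $a_i$ in $R^+/\mathrm{Ann}_\lambda(R)$ and $R^+/\mathrm{Ann}_\rho(R)$. The following steps define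 an algorithm (each of the Steps (1) to (3) is carried out by a partial computable function which, uniformly in the input, takes the input and the results of the earlier steps and halts with a correct result, whichever correct results the earlier steps returned), and for all correct results of these steps the $\mathbb Z$-algebras returned in Step (4) form a direct decomposition $R/\mathrm{Ann}(R)=R_1\times\cdots\times R_\ell$ into $\mathbb Z$-subalgebras, i.e. $(r_1,\dots,r_\ell)\mapsto r_1+\dots+r_\ell$ is an isomorphism of $\mathbb Z$-algebras from $R_1\times\cdots\times R_\ell$ onto $R/\mathrm{Ann}(R)$. 1. Compute tuples $(d^{(1)}_{ij}),\dots,(d^{(t)}_{ij})\in(\mathbb Z^{2n})^{2n}$ representing elements $\phi_1,\dots,\phi_t$ which generate the additive group of $\mathfrak S(R)$, where $\phi_k=(\phi_{k1},\phi_{k2})$ with $\phi_{k1}(b_i)=\sum_{j=1}^n d^{(k)}_{ij}b_j$ and $\phi_{k2}(c_i)=\sum_{j=1}^n d^{(k)}_{n+i,n+j}c_j$ for $i=1,\dots,n$, together with generators of an ideal $I\subseteq\mathbb Z[x_1,\dots,x_t]$ such that $\mathfrak S(R)=\mathbb Z[x_1,\dots,x_t]/I$ via $x_k\mapsto\phi_k$.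 Let $A_k=(d^{(k)}_{ij})_{i,j=1,\dots,n}$ and $A'_k=(d^{(k)}_{ij})_{i,j=n+1,\dots,2n}$. 2. Compute polynomials representing the complete set $\{e_1,\dots,e_\ell\}$ of primitive idempotents of $\mathbb Z[x_1,\dots,x_t]/I$ (non-zero idempotents that are not a sum of two non-zero orthogonal idempotents), each exactly once. 3. For $i=1,\dots,\ell$ let $E_i=e_i(A_1,\dots,A_t)$ and $E'_i=e_i(A'_1,\dots,A'_t)$, where a term $x_1^{\alpha_1}\cdots x_t^{\alpha_t}$ is evaluated as the product of the matrix powers in this order. For $j=1,\dots,n$ compute an element $r_{ij}\in R$ (as an integer combination of $a_1,\dots,a_n$) with $\eta(r_{ij})=(u_{ij},u'_{ij})$, where $u_{ij}$ is the $j$-th entry of $E_i\cdot(b_1,\dots,b_n)^{tr}$ and $u'_{ij}$ is the $j$-th entry of $E'_i\cdot(c_1,\dots,c_n)^{tr}$. 4. Return $R_1,\dots,R_\ell$, where $R_i$ is the subalgebra of $R/\mathrm{Ann}(R)$ generated by the residue classes of $r_{i1},\dots,r_{in}$. -/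

import Mathlib

universe u

namespace ZAlg

/-! ## Bilinear maps and their maximal ring of scalars -/

section Bilinear

variable {N₁ N₂ M : Type u} [AddCommGroup N₁] [AddCommGroup N₂] [AddCommGroup M]

/-- `S` is a ring of scalars of the bilinear map `f`: the three groups are faithful `S`-modules and
`f (s a) b = f a (s b) = s f (a, b)`. -/
structure IsRingOfScalars (f : N₁ →+ N₂ →+ M) (S : Type u) [CommRing S]
    [Module S N₁] [Module S N₂] [Module S M] : Prop where
  faithful_fst : FaithfulSMul S N₁
  faithful_snd : FaithfulSMul S N₂
  faithful_target : FaithfulSMul S M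
  map_smul_fst : ∀ (s : S) (a : N₁) (b : N₂), f (s • a) b = s • f a b
  map_smul_snd : ∀ (s : S) (a : N₁) (b : N₂), f a (s • b) = s • f a b

/-- The symmetric endomorphisms `Sym(f)`. -/
def Sym (f : N₁ →+ N₂ →+ M) : Set (AddMonoid.End N₁ × AddMonoid.End N₂) :=
  {φ | ∀ a b, f (φ.1 a) b = f a (φ.2 b)}

/-- The central symmetric endomorphisms `Z(Sym(f))`. -/
def CenSym (f : N₁ →+ N₂ →+ M) : Set (AddMonoid.End N₁ × AddMonoid.End N₂) :=
  {φ | φ ∈ Sym f ∧ ∀ ψ ∈ Sym f, φ * ψ = ψ * φ}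

/-- The condition that `∑ f(aᵢ, bᵢ) ↦ ∑ f(φ₁(aᵢ), bᵢ)` is well defined. -/
def ActsOnTarget (f : N₁ →+ N₂ →+ M) (φ : AddMonoid.End N₁ × AddMonoid.End N₂) : Prop :=
  ∀ l l' : List (N₁ × N₂),
    (l.map fun p => f p.1 p.2).sum = (l'.map fun p => f p.1 p.2).sum →
    (l.map fun p => f (φ.1 p.1) p.2).sum = (l'.map fun p => f (φ.1 p.1) p.2).sum

theorem actsOnTarget_mul {f : N₁ →+ N₂ →+ M} {φ ψ : AddMonoid.End N₁ × AddMonoid.End N₂}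
    (hφ : ActsOnTarget f φ) (hψ : ActsOnTarget f ψ) : ActsOnTarget f (φ * ψ) := by
  intro l l' h
  have h1 := hφ (l.map fun p => (ψ.1 p.1, p.2)) (l'.map fun p => (ψ.1 p.1, p.2))
    (by simpa only [List.map_map, Function.comp_def] using hψ l l' h)
  simp only [List.map_map, Function.comp_def] at h1
  exact h1

/-- The maximal ring of scalars `𝔖(f)` of a full non-degenerate bilinear map `f`, as a subring
of `End(N₁) × End(N₂)`. -/
def bilinScalars (f : N₁ →+ N₂ →+ M) : Subring (AddMonoid.End N₁ × AddMonoid.End N₂) where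
  carrier := {φ | φ ∈ CenSym f ∧ ActsOnTarget f φ}
  mul_mem' := by
    rintro φ ψ ⟨⟨hφ, cφ⟩, aφ⟩ ⟨⟨hψ, cψ⟩, aψ⟩
    refine ⟨⟨fun a b => ?_, fun χ hχ => ?_⟩, actsOnTarget_mul aφ aψ⟩
    · have h : φ.2 * ψ.2 = ψ.2 * φ.2 := congrArg Prod.snd (cφ ψ hψ)
      calc f ((φ * ψ).1 a) b = f (φ.1 (ψ.1 a)) b := rfl
        _ = f a ((ψ.2 * φ.2) b) := by rw [hφ, hψ]; rfl
        _ = f a ((φ * ψ).2 b) := by rw [← h]; rfl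
    · rw [mul_assoc, cψ χ hχ, ← mul_assoc, cφ χ hχ, mul_assoc]
  one_mem' := ⟨⟨fun _ _ => rfl, fun ψ _ => by rw [one_mul, mul_one]⟩, fun _ _ h => h⟩
  add_mem' := by
    rintro φ ψ ⟨⟨hφ, cφ⟩, aφ⟩ ⟨⟨hψ, cψ⟩, aψ⟩
    refine ⟨⟨fun a b => ?_, fun χ hχ => ?_⟩, fun l l' h => ?_⟩
    · change f (φ.1 a + ψ.1 a) b = f a (φ.2 b + ψ.2 b)
      rw [map_add, map_add, AddMonoidHom.add_apply, hφ, hψ]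
    · rw [add_mul, mul_add, cφ χ hχ, cψ χ hχ]
    · have key : ∀ l : List (N₁ × N₂), (l.map fun p => f ((φ + ψ).1 p.1) p.2).sum =
          (l.map fun p => f (φ.1 p.1) p.2).sum + (l.map fun p => f (ψ.1 p.1) p.2).sum := by
        intro l
        rw [← List.sum_map_add]
        congr 1
        refine List.map_congr_left fun p _ => ?_
        change f (φ.1 p.1 + ψ.1 p.1) p.2 = _
        rw [map_add, AddMonoidHom.add_apply]
      rw [key, key, aφ l l' h, aψ l l' h]
  zero_mem' := by
    refine ⟨⟨fun a b => ?_, fun ψ _ => by rw [zero_mul, mul_zero]⟩, fun l l' _ => ?_⟩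
    · change f 0 b = f a 0
      simp
    · have key : ∀ l : List (N₁ × N₂),
          (l.map fun p => f ((0 : AddMonoid.End N₁ × AddMonoid.End N₂).1 p.1) p.2).sum = 0 := by
        intro l
        have : (fun p : N₁ × N₂ => f ((0 : AddMonoid.End N₁ × AddMonoid.End N₂).1 p.1) p.2) =
            fun _ => 0 := by
          funext p
          change f 0 p.2 = 0
          simp
        rw [this]
        simp
      rw [key, key]
  neg_mem' := by
    rintro φ ⟨⟨hφ, cφ⟩, aφ⟩
    refine ⟨⟨fun a b => ?_, fun χ hχ => by rw [neg_mul, mul_neg, cφ χ hχ]⟩, fun l l' h => ?_⟩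
    · change f (-φ.1 a) b = f a (-φ.2 b)
      rw [map_neg, map_neg, AddMonoidHom.neg_apply, hφ]
    · have key : ∀ l : List (N₁ × N₂), (l.map fun p => f ((-φ).1 p.1) p.2).sum =
          -(l.map fun p => f (φ.1 p.1) p.2).sum := by
        intro l
        induction l with
        | nil => simp
        | cons p l ih =>
          rw [List.map_cons, List.sum_cons, ih, List.map_cons, List.sum_cons, neg_add]
          congr 1
          change f (-φ.1 p.1) p.2 = _
          rw [map_neg, AddMonoidHom.neg_apply]
      rw [key, key, aφ l l' h]

end Bilinear

/-! ## `ℤ`-algebras, annihilators, and the maximal ring of scalars of a `ℤ`-algebra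

A `ℤ`-algebra is an abelian group with a bilinear multiplication: a `NonUnitalNonAssocRing`. -/

section Algebra

variable (R : Type u) [NonUnitalNonAssocRing R]

/-- The left annihilator `{a | a b = 0 for all b}`. -/
def annL : AddSubgroup R where
  carrier := {a | ∀ b, a * b = 0}
  add_mem' := fun ha hb c => by rw [add_mul, ha c, hb c, add_zero]
  zero_mem' := fun c => zero_mul c
  neg_mem' := fun ha c => by rw [neg_mul, ha c, neg_zero]

/-- The right annihilator `{a | b a = 0 for all b}`. -/
def annR : AddSubgroup R where
  carrier := {a | ∀ b, b * a = 0}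
  add_mem' := fun ha hb c => by rw [mul_add, ha c, hb c, add_zero]
  zero_mem' := fun c => mul_zero c
  neg_mem' := fun ha c => by rw [mul_neg, ha c, neg_zero]

/-- The two-sided annihilator `Ann(R)`, a two-sided ideal. -/
def ann : TwoSidedIdeal R :=
  TwoSidedIdeal.mk' {a | a ∈ annL R ∧ a ∈ annR R}
    ⟨zero_mem _, zero_mem _⟩
    (fun ha hb => ⟨add_mem ha.1 hb.1, add_mem ha.2 hb.2⟩)
    (fun ha => ⟨neg_mem ha.1, neg_mem ha.2⟩)
    (fun {x y} hy => by
      have h : x * y = 0 := hy.2 x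
      rw [h]; exact ⟨zero_mem _, zero_mem _⟩)
    (fun {x y} hx => by
      have h : x * y = 0 := hx.1 y
      rw [h]; exact ⟨zero_mem _, zero_mem _⟩)

theorem mem_ann {x : R} : x ∈ ann R ↔ (∀ b, x * b = 0) ∧ ∀ b, b * x = 0 :=
  TwoSidedIdeal.mem_mk' _ _ _ _ _ _ _

/-- The `ℤ`-algebra `R/Ann(R)`. -/
abbrev AnnQuot : Type u := (ann R).ringCon.Quotient

/-- The residue class map `R → R/Ann(R)`. -/
def annMk : R →+ AnnQuot R where
  toFun x := (x : (ann R).ringCon.Quotient)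
  map_zero' := rfl
  map_add' _ _ := rfl

/-- The subgroup `R²` of `R⁺` generated by all products. -/
def sq : AddSubgroup R := AddSubgroup.closure {x | ∃ a b : R, x = a * b}

/-- The bilinear map `R × R → R²` given by the multiplication. -/
def mulSq : R →+ R →+ sq R :=
  AddMonoidHom.mk' (fun a => AddMonoidHom.mk'
      (fun b => ⟨a * b, AddSubgroup.subset_closure ⟨a, b, rfl⟩⟩)
      (fun b c => Subtype.ext (mul_add a b c)))
    (fun a b => AddMonoidHom.ext fun c => Subtype.ext (add_mul a b c))

/-- The non-degenerate full bilinear map `f_R : R⁺/Ann_λ(R) × R⁺/Ann_ρ(R) → R²`. -/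
def fR : (R ⧸ annL R) →+ (R ⧸ annR R) →+ sq R :=
  QuotientAddGroup.lift (annL R)
    (AddMonoidHom.mk' (fun a => QuotientAddGroup.lift (annR R) (mulSq R a)
        (fun b hb => Subtype.ext (hb a)))
      (fun a b => by
        refine AddMonoidHom.ext fun c => ?_
        induction c using QuotientAddGroup.induction_on with
        | H c => exact Subtype.ext (add_mul a b c)))
    (fun a ha => by
      refine AddMonoidHom.ext fun c => ?_
      induction c using QuotientAddGroup.induction_on with
      | H c => exact Subtype.ext (ha c))

/-- The canonical map `R/Ann(R) → R⁺/Ann_λ(R)`. -/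
def toL : AnnQuot R →+ R ⧸ annL R where
  toFun := Quotient.lift (fun x : R => (x : R ⧸ annL R)) (fun x y h => by
    have h' : x - y ∈ ann R := ((ann R).rel_iff x y).1 h
    have : x - y ∈ annL R := ((mem_ann R).1 h').1
    exact (QuotientAddGroup.eq_iff_sub_mem).2 this)
  map_zero' := rfl
  map_add' x y := by
    induction x using Quotient.inductionOn
    induction y using Quotient.inductionOn
    rfl

/-- The canonical map `R/Ann(R) → R⁺/Ann_ρ(R)`. -/
def toR : AnnQuot R →+ R ⧸ annR R where
  toFun := Quotient.lift (fun x : R => (x : R ⧸ annR R)) (fun x y h => by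
    have h' : x - y ∈ ann R := ((ann R).rel_iff x y).1 h
    have : x - y ∈ annR R := ((mem_ann R).1 h').2
    exact (QuotientAddGroup.eq_iff_sub_mem).2 this)
  map_zero' := rfl
  map_add' x y := by
    induction x using Quotient.inductionOn
    induction y using Quotient.inductionOn
    rfl

/-- The bilinear map `f_R^* : R⁺/Ann(R) × R⁺/Ann(R) → R²`. -/
def fStar : AnnQuot R →+ AnnQuot R →+ sq R :=
  ((fR R).comp (toL R)).compl₂ (toR R)

theorem fStar_mk (x y : R) : (fStar R (annMk R x) (annMk R y) : R) = x * y := rfl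

/-- The canonical diagonal homomorphism `η : R → R⁺/Ann_λ(R) × R⁺/Ann_ρ(R)`. -/
def eta : R →+ (R ⧸ annL R) × (R ⧸ annR R) :=
  (QuotientAddGroup.mk' (annL R)).prod (QuotientAddGroup.mk' (annR R))

/-- `S` is a ring of scalars of the `ℤ`-algebra `R`: it is a ring of scalars of `f_R^*` and the
canonical map `R² → R/Ann(R)` is `S`-linear. -/
structure IsAlgRingOfScalars (S : Type u) [CommRing S] [Module S (AnnQuot R)] [Module S (sq R)] :
    Prop where
  scalars : IsRingOfScalars (fStar R) S
  map_smul : ∀ (s : S) (m : sq R), annMk R ((s • m : sq R) : R) = s • annMk R (m : R)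

/-- The maximal ring of scalars `𝔖(R)` of the `ℤ`-algebra `R`: the largest subring of `𝔖(f_R)`
for which (1) the canonical maps `R² → R⁺/Ann_λ(R)` and `R² → R⁺/Ann_ρ(R)` are linear, and (2) the
image `η(R)` is a submodule.  An element `φ` of `𝔖(f_R)` acts on `R²` by
`φ f(a, b) = f(φ₁ a, b)`; as the values of `f_R` generate `R²`, linearity is tested on them. -/
def algScalars : Subring (AddMonoid.End (R ⧸ annL R) × AddMonoid.End (R ⧸ annR R)) where
  carrier := {φ | φ ∈ bilinScalars (fR R) ∧
    (∀ a b, ((fR R (φ.1 a) b : R) : R ⧸ annL R) = φ.1 ((fR R a b : R) : R ⧸ annL R)) ∧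
    (∀ a b, ((fR R (φ.1 a) b : R) : R ⧸ annR R) = φ.2 ((fR R a b : R) : R ⧸ annR R)) ∧
    ∀ r : R, ∃ r' : R, (φ.1 (eta R r).1, φ.2 (eta R r).2) = eta R r'}
  mul_mem' := by
    rintro φ ψ ⟨hφ, lφ, rφ, eφ⟩ ⟨hψ, lψ, rψ, eψ⟩
    refine ⟨mul_mem hφ hψ, fun a b => ?_, fun a b => ?_, fun r => ?_⟩
    · exact (lφ (ψ.1 a) b).trans (congrArg φ.1 (lψ a b))
    · exact (rφ (ψ.1 a) b).trans (congrArg φ.2 (rψ a b))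
    · obtain ⟨r', h'⟩ := eψ r
      obtain ⟨r'', h''⟩ := eφ r'
      refine ⟨r'', ?_⟩
      rw [← h'', ← h']
      rfl
  one_mem' := ⟨one_mem _, fun _ _ => rfl, fun _ _ => rfl, fun r => ⟨r, rfl⟩⟩
  add_mem' := by
    rintro φ ψ ⟨hφ, lφ, rφ, eφ⟩ ⟨hψ, lψ, rψ, eψ⟩
    refine ⟨add_mem hφ hψ, fun a b => ?_, fun a b => ?_, fun r => ?_⟩
    · change ((fR R (φ.1 a + ψ.1 a) b : R) : R ⧸ annL R) = φ.1 _ + ψ.1 _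
      rw [map_add, AddMonoidHom.add_apply, ← lφ, ← lψ]
      rfl
    · change ((fR R (φ.1 a + ψ.1 a) b : R) : R ⧸ annR R) = φ.2 _ + ψ.2 _
      rw [map_add, AddMonoidHom.add_apply, ← rφ, ← rψ]
      rfl
    · obtain ⟨r₁, h₁⟩ := eφ r
      obtain ⟨r₂, h₂⟩ := eψ r
      refine ⟨r₁ + r₂, ?_⟩
      rw [map_add, ← h₁, ← h₂]
      rfl
  zero_mem' := by
    refine ⟨zero_mem _, fun a b => ?_, fun a b => ?_, fun r => ⟨0, ?_⟩⟩
    · change ((fR R 0 b : R) : R ⧸ annL R) = 0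
      rw [map_zero]
      rfl
    · change ((fR R 0 b : R) : R ⧸ annR R) = 0
      rw [map_zero]
      rfl
    · rw [map_zero]
      rfl
  neg_mem' := by
    rintro φ ⟨hφ, lφ, rφ, eφ⟩
    refine ⟨neg_mem hφ, fun a b => ?_, fun a b => ?_, fun r => ?_⟩
    · change ((fR R (-φ.1 a) b : R) : R ⧸ annL R) = -φ.1 _
      rw [map_neg, AddMonoidHom.neg_apply, ← lφ]
      rfl
    · change ((fR R (-φ.1 a) b : R) : R ⧸ annR R) = -φ.2 _
      rw [map_neg, AddMonoidHom.neg_apply, ← rφ]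
      rfl
    · obtain ⟨r', h'⟩ := eφ r
      refine ⟨-r', ?_⟩
      rw [map_neg, ← h']
      rfl

instance : CommRing (algScalars R) :=
  { (inferInstance : Ring (algScalars R)) with
    mul_comm := fun φ ψ => Subtype.ext (φ.2.1.1.2 ψ.1 ψ.2.1.1.1) }

/-- `𝔖(R)` is the maximal ring of scalars of `R`: acting on `R/Ann(R)` through `η`, it is a ring of
scalars of `R`, and every ring of scalars of `R` embeds into it, compatibly with the actions. -/
def AlgScalarsIsMaximal : Prop :=
  ∃ (_ : Module (algScalars R) (AnnQuot R)) (_ : Module (algScalars R) (sq R)),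
    (∀ (φ : algScalars R) (x : AnnQuot R),
      toL R (φ • x) = φ.1.1 (toL R x) ∧ toR R (φ • x) = φ.1.2 (toR R x)) ∧
    IsAlgRingOfScalars R (algScalars R) ∧
    ∀ (S : Type u) [CommRing S] [Module S (AnnQuot R)] [Module S (sq R)],
      IsAlgRingOfScalars R S →
      ∃ ι : S →+* algScalars R, Function.Injective ι ∧
        (∀ (s : S) (x : AnnQuot R), ι s • x = s • x) ∧
        ∀ (s : S) (m : sq R), ι s • m = s • m

/-- `R` is the direct product of the `ℤ`-subalgebras `B i`: the map `(r_i) ↦ ∑ r_i` is an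
isomorphism of `ℤ`-algebras from their direct product onto `R`. -/
def IsDirectProduct {ℓ : ℕ} (B : Fin ℓ → NonUnitalSubring R) : Prop :=
  ∃ Φ : (∀ i, B i) ≃+* R, ∀ x, Φ x = ∑ i, (x i : R)

end Algebra

/-- A primitive idempotent: a non-zero idempotent which is not the sum of two non-zero orthogonal
idempotents. -/
def IsPrimitiveIdempotent {S : Type*} [CommRing S] (e : S) : Prop :=
  IsIdempotentElem e ∧ e ≠ 0 ∧
    ∀ e' e'' : S, IsIdempotentElem e' → IsIdempotentElem e'' → e' * e'' = 0 → e = e' + e'' →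
      e' = 0 ∨ e'' = 0

/-! ## The data on which the algorithm works

All data are nested lists of numbers; entries that are not present are read as zero. -/

/-- A finite presentation with structure constants: the number `n` of generators, the list of
relations (coefficient vectors), and the array `s_{ijk}` of structure constants. -/
abbrev AlgCode : Type := ℕ × List (List ℤ) × List (List (List ℤ))

/-- The `j`-th relation as a vector in `ℤⁿ`. -/
def AlgCode.rel (C : AlgCode) (j : Fin C.2.1.length) (i : Fin C.1) : ℤ := (C.2.1.get j).getD i 0

/-- The structure constant `s_{ijk}`. -/
def AlgCode.sc (C : AlgCode) (i j k : Fin C.1) : ℤ := ((C.2.2.getD i []).getD j []).getD k 0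

/-- The `ℤ`-algebra `R` with the family `a` of elements is given by `C`: the group `R⁺` is generated
by the `a i`, with the listed relations as defining relations, and
`a i * a j = ∑ k, s_{ijk} a k`. -/
structure AlgCode.Presents (C : AlgCode) (R : Type u) [NonUnitalNonAssocRing R]
    (a : Fin C.1 → R) : Prop where
  generates : AddSubgroup.closure (Set.range a) = ⊤
  relations : ∀ x : Fin C.1 → ℤ,
    ∑ i, x i • a i = 0 ↔ x ∈ AddSubgroup.closure (Set.range C.rel)
  mul_eq : ∀ i j, a i * a j = ∑ k, C.sc i j k • a k

/-- A polynomial over `ℤ`: a list of coefficients, each with the list of exponents of its term. -/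
abbrev PolyCode : Type := List (ℤ × List ℕ)

/-- The polynomial in `ℤ[x_1, …, x_t]` given by a code. -/
noncomputable def PolyCode.toPoly (t : ℕ) (p : PolyCode) : MvPolynomial (Fin t) ℤ :=
  (p.map fun c => MvPolynomial.C c.1 *
    (List.ofFn fun k : Fin t => MvPolynomial.X k ^ c.2.getD k 0).prod).sum

/-- The value `p(A_1, …, A_t)` at elements of a ring (for instance of matrices); each term is
evaluated as the product `A_1^{α_1} ⋯ A_t^{α_t}` in this order. -/
def PolyCode.evalAt {A : Type*} [Ring A] {t : ℕ} (p : PolyCode) (x : Fin t → A) : A :=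
  (p.map fun c => c.1 • (List.ofFn fun k : Fin t => x k ^ c.2.getD k 0).prod).sum

/-- The result of Step (1): tuples `(d_{ij}) ∈ (ℤ^{2n})^{2n}` and generators of an ideal. -/
abbrev ScalarsCode : Type := List (List (List ℤ)) × List PolyCode

/-- The number `t` of tuples. -/
abbrev ScalarsCode.t (D : ScalarsCode) : ℕ := D.1.length

/-- The matrix `A_k = (d_{ij})_{i,j=1,…,n}` of the `k`-th tuple. -/
def ScalarsCode.matL (D : ScalarsCode) (n : ℕ) (k : Fin D.t) : Matrix (Fin n) (Fin n) ℤ :=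
  fun i j => ((D.1.get k).getD i []).getD j 0

/-- The matrix `A'_k = (d_{ij})_{i,j=n+1,…,2n}` of the `k`-th tuple. -/
def ScalarsCode.matR (D : ScalarsCode) (n : ℕ) (k : Fin D.t) : Matrix (Fin n) (Fin n) ℤ :=
  fun i j => ((D.1.get k).getD (n + i) []).getD (n + j) 0

/-- The ideal `I ⊆ ℤ[x_1, …, x_t]`. -/
noncomputable def ScalarsCode.ideal (D : ScalarsCode) : Ideal (MvPolynomial (Fin D.t) ℤ) :=
  Ideal.span {q | ∃ p ∈ D.2, q = p.toPoly D.t}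

/-- The result of Step (2): polynomials. -/
abbrev IdemCode : Type := List PolyCode

/-- The result of Step (3): the elements `r_{ij}` of `R`, each given by a coefficient vector with
respect to the generators of `R⁺`. -/
abbrev PartsCode : Type := List (List (List ℤ))

/-! ## The steps of the algorithm -/

section Steps

variable (C : AlgCode) (R : Type u) [NonUnitalNonAssocRing R] (a : Fin C.1 → R)

/-- Step (1): the tuples in `D` represent elements `φ_k = (φ_{k1}, φ_{k2})` of `𝔖(R)`, i.e.
`φ_{k1}(b_i) = ∑_j d_{ij} b_j` and `φ_{k2}(c_i) = ∑_j d_{n+i,n+j} c_j` where `b_i`, `c_i` are the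
residue classes of `a_i`; these elements generate the additive group of `𝔖(R)`; and
`𝔖(R) = ℤ[x_1, …, x_t]/I` via `x_k ↦ φ_k`. -/
def IsStep1 (D : ScalarsCode) : Prop :=
  ∃ φ : Fin D.t → algScalars R,
    (∀ k i, (φ k).1.1 (a i : R ⧸ annL R) = ∑ j, D.matL C.1 k i j • (a j : R ⧸ annL R)) ∧
    (∀ k i, (φ k).1.2 (a i : R ⧸ annR R) = ∑ j, D.matR C.1 k i j • (a j : R ⧸ annR R)) ∧
    AddSubgroup.closure (Set.range φ) = ⊤ ∧
    RingHom.ker (MvPolynomial.aeval φ : MvPolynomial (Fin D.t) ℤ →ₐ[ℤ] algScalars R) = D.ideal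

/-- Step (2): the polynomials in `E` represent the primitive idempotents of `ℤ[x_1, …, x_t]/I`, each
of them exactly once. -/
def IsStep2 (D : ScalarsCode) (E : IdemCode) : Prop :=
  Function.Injective (fun i : Fin E.length => Ideal.Quotient.mk D.ideal ((E.get i).toPoly D.t)) ∧
  Set.range (fun i : Fin E.length => Ideal.Quotient.mk D.ideal ((E.get i).toPoly D.t)) =
    {e | IsPrimitiveIdempotent e}

/-- The element `r_{ij}` of `R`. -/
def part (P : PartsCode) (i : ℕ) (j : Fin C.1) : R :=
  ∑ k : Fin C.1, ((P.getD i []).getD j []).getD k 0 • a k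

/-- Step (3): with `E_i = e_i(A_1, …, A_t)` and `E'_i = e_i(A'_1, …, A'_t)`, the element `r_{ij}` is a
preimage under `η` of the pair of the `j`-th entries of `E_i (b_1, …, b_n)^tr` and
`E'_i (c_1, …, c_n)^tr`. -/
def IsStep3 (D : ScalarsCode) (E : IdemCode) (P : PartsCode) : Prop :=
  ∀ (i : Fin E.length) (j : Fin C.1), eta R (part C R a P i j) =
    (∑ k, ((E.get i).evalAt (D.matL C.1)) j k • (a k : R ⧸ annL R),
     ∑ k, ((E.get i).evalAt (D.matR C.1)) j k • (a k : R ⧸ annR R))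

/-- Step (4): `R_i` is the subalgebra of `R/Ann(R)` generated by the residue classes of
`r_{i1}, …, r_{in}`. -/
def factor (P : PartsCode) (i : ℕ) : NonUnitalSubring (AnnQuot R) :=
  NonUnitalSubring.closure (Set.range fun j : Fin C.1 => annMk R (part C R a P i j))

end Steps

end ZAlg

/-!
Each of the three steps is an unbounded search for a result together with a certificate of its
correctness: if a relation between inputs and results is semidecidable, then some partial recursive
function returns, for every input that has a related result, such a result
(`Semi.exists_partrec`).  It remains to find, for each step, a semidecidable relation that implies
correctness and is always satisfiable.

The basic certificates concern integer lattices.  Membership in a lattice given by generators is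
certified by coefficients.  Non-membership is certified by a linear form modulo an integer, because
a finitely generated abelian group is residually finite (`latNotMem_iff`); so equality and
inequality of elements of a finitely presented abelian group are both semidecidable.  That given
vectors generate all solutions of a linear system modulo a lattice is certified by a splitting up to
an integer factor (`GenKer.mem_iff`, `exists_genKer`).

Step (1).  Pairs of endomorphisms of `R⁺/Ann_λ(R)` and `R⁺/Ann_ρ(R)` are represented by integer
matrices.  As `f_R` is non-degenerate, symmetry is a linear condition that already forces the
matrices to respect the annihilators.  Given generators of `Sym(f_R)` and of the relations between
the products `a_i a_j`, the remaining conditions that define `𝔖(R)` are linear as well; a third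
matrix witnesses that `η(R)` is stable.  The solutions are precisely the representations of elements
of `𝔖(R)` (`mem_algScalars_of_scalForm`, `exists_scalForm`).  The ideal of relations between
additive generators of `𝔖(R)` is generated by the multiplication table, the expression of `1` and
the linear relations (`ker_aeval_eq_span`).

Step (2).  Let `S` be a commutative ring with finitely generated additive group.  That vectors
represent a complete system of non-zero orthogonal idempotents `e_i` is semidecidable.  They are the
primitive idempotents if `f e_i ∈ {0, e_i}` for each idempotent `f` (`range_eq_primitive`), and this
has to be certified although the idempotents `f` are not known.  The certificate contains a
representation `ρ` of `S` by integer matrices with finite kernel, which the regular representation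
of `S` modulo torsion provides.  Up to an element of that kernel an idempotent `f` is determined by
its traces `tr ρ(f s)` at the generators `s` (`map_sub_eq_zero_of_trace`), and these traces are
bounded (`abs_trace_mul_le`).  So finitely many vectors of traces have to be treated, and each is
dealt with in one of three ways: it is not the vector of traces of any element; it is the one of an
element `x` with `tr ρ((x² - x) s) ≠ 0` for some `s`, in which case no idempotent has these traces
(`trace_mul_sub_eq_zero`); or it is the one of an idempotent, and all idempotents that differ from
it by an element of the kernel have the required property.  That these cases are exhaustive is a
lifting argument: if `x² - x` is in the kernel of the trace form, it is nilpotent modulo torsion,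
and the traces of `x` are those of an idempotent (`exists_faithful_representation`).

Step (3).  The condition on `r_{ij}` is a congruence modulo `Ann_λ(R)` and `Ann_ρ(R)`, hence
semidecidable, and it has a solution because `e_i` maps `η(R)` into itself (`isStep3_iff`,
`exists_isParts`).

Finally, `𝔖(R)` acts on `R/Ann(R)` and on `R²`, and a ring of scalars `S` embeds into it as its
elements induce, by faithfulness and bilinearity, endomorphisms of the two quotients of `R`
(`algScalarsIsMaximal`).  The primitive idempotents of the Noetherian ring `𝔖(R)` form a complete
orthogonal system, and `R_i = e_i (R/Ann(R))`, so that the multiplication being `𝔖(R)`-bilinear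
yields the direct decomposition (`isDirectProduct_of_idempotents`, `isDirectProduct_factor`).
-/

/-! ### Primitive recursive integer arithmetic -/

attribute [fun_prop] Primrec

namespace Primrec

variable {α β γ σ : Type*} [Primcodable α] [Primcodable β] [Primcodable γ] [Primcodable σ]

attribute [fun_prop] Primrec.id Primrec.const Primrec.comp Primrec.fst Primrec.snd Primrec.pair

@[fun_prop]
theorem pair_mk {f : α → β} {g : α → γ} (hf : Primrec f) (hg : Primrec g) :
    Primrec fun a => (f a, g a) := hf.pair hg

@[fun_prop]
theorem fst_comp {f : α → β × γ} (hf : Primrec f) : Primrec fun a => (f a).1 := fst.comp hf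

@[fun_prop]
theorem snd_comp {f : α → β × γ} (hf : Primrec f) : Primrec fun a => (f a).2 := snd.comp hf

@[fun_prop]
theorem natAdd {f g : α → ℕ} (hf : Primrec f) (hg : Primrec g) : Primrec fun a => f a + g a :=
  nat_add.comp hf hg

@[fun_prop]
theorem natMul {f g : α → ℕ} (hf : Primrec f) (hg : Primrec g) : Primrec fun a => f a * g a :=
  nat_mul.comp hf hg

@[fun_prop]
theorem natSub {f g : α → ℕ} (hf : Primrec f) (hg : Primrec g) : Primrec fun a => f a - g a :=
  nat_sub.comp hf hg

@[fun_prop]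
theorem natDiv {f g : α → ℕ} (hf : Primrec f) (hg : Primrec g) : Primrec fun a => f a / g a :=
  nat_div.comp hf hg

@[fun_prop]
theorem natMod {f g : α → ℕ} (hf : Primrec f) (hg : Primrec g) : Primrec fun a => f a % g a :=
  nat_mod.comp hf hg

@[fun_prop]
theorem natPow {f g : α → ℕ} (hf : Primrec f) (hg : Primrec g) : Primrec fun a => f a ^ g a :=
  (Primrec₂.unpaired'.1 Nat.Primrec.pow).comp hf hg

@[fun_prop]
theorem natPair {f g : α → ℕ} (hf : Primrec f) (hg : Primrec g) :
    Primrec fun a => Nat.pair (f a) (g a) := Primrec₂.natPair.comp hf hg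

@[fun_prop]
theorem unpair_comp {f : α → ℕ} (hf : Primrec f) : Primrec fun a => Nat.unpair (f a) :=
  Primrec.unpair.comp hf

@[fun_prop]
theorem length_comp {f : α → List β} (hf : Primrec f) : Primrec fun a => (f a).length :=
  list_length.comp hf

@[fun_prop]
theorem getD_comp {f : α → List β} {g : α → ℕ} {d : β} (hf : Primrec f) (hg : Primrec g) :
    Primrec fun a => (f a).getD (g a) d := (list_getD d).comp hf hg

@[fun_prop]
theorem append_comp {f g : α → List β} (hf : Primrec f) (hg : Primrec g) :
    Primrec fun a => f a ++ g a := list_append.comp hf hg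

@[fun_prop]
theorem cons_comp {f : α → β} {g : α → List β} (hf : Primrec f) (hg : Primrec g) :
    Primrec fun a => f a :: g a := list_cons.comp hf hg

@[fun_prop]
theorem range_comp {f : α → ℕ} (hf : Primrec f) : Primrec fun a => List.range (f a) :=
  list_range.comp hf

@[fun_prop]
theorem map_comp {f : α → List β} {g : α → β → σ} (hf : Primrec f)
    (hg : Primrec fun p : α × β => g p.1 p.2) : Primrec fun a => (f a).map (g a) :=
  list_map hf hg

@[fun_prop]
theorem ite_eq {f g : α → β} [DecidableEq β] {h k : α → σ} (hf : Primrec f) (hg : Primrec g)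
    (hh : Primrec h) (hk : Primrec k) : Primrec fun a => if f a = g a then h a else k a :=
  ite (Primrec.eq.comp hf hg) hh hk

@[fun_prop]
theorem ite_lt {f g : α → ℕ} {h k : α → σ} (hf : Primrec f) (hg : Primrec g)
    (hh : Primrec h) (hk : Primrec k) : Primrec fun a => if f a < g a then h a else k a :=
  ite (nat_lt.comp hf hg) hh hk

/-- The encoding of `ℤ` puts the non-negative integers at the even numbers.  The arithmetic of `ℤ`
is derived from this formula, with an integer split into its positive and its negative part. -/
theorem encode_int (x : ℤ) :
    Encodable.encode x = if 0 ≤ x then 2 * x.toNat else 2 * (-x).toNat - 1 := by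
  cases x with
  | ofNat n =>
    change 2 * n = _
    simp
  | negSucc n =>
    change 2 * n + 1 = _
    rw [if_neg (by omega)]
    omega

@[fun_prop]
theorem intToNat {f : α → ℤ} (hf : Primrec f) : Primrec fun a => (f a).toNat := by
  have h : Primrec fun n : ℕ => if n % 2 = 0 then n / 2 else 0 := by fun_prop
  refine (h.comp (Primrec.encode.comp hf)).of_eq fun a => ?_
  simp only [encode_int]
  split_ifs <;> omega

@[fun_prop]
theorem intNegToNat {f : α → ℤ} (hf : Primrec f) : Primrec fun a => (-f a).toNat := by
  have h : Primrec fun n : ℕ => if n % 2 = 0 then 0 else (n + 1) / 2 := by fun_prop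
  refine (h.comp (Primrec.encode.comp hf)).of_eq fun a => ?_
  simp only [encode_int]
  split_ifs <;> omega

@[fun_prop]
theorem intSubNat {f g : α → ℕ} (hf : Primrec f) (hg : Primrec g) :
    Primrec fun a => ((f a : ℤ) - (g a : ℤ)) := by
  refine Primrec.encode_iff.1 ?_
  have h : Primrec fun a => if f a < g a then 2 * (g a - f a) - 1 else 2 * (f a - g a) := by
    fun_prop
  refine h.of_eq fun a => ?_
  simp only [encode_int]
  split_ifs <;> omega

@[fun_prop]
theorem natCastInt {f : α → ℕ} (hf : Primrec f) : Primrec fun a => (f a : ℤ) :=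
  (intSubNat hf (.const 0)).of_eq fun a => by simp

@[fun_prop]
theorem intAdd {f g : α → ℤ} (hf : Primrec f) (hg : Primrec g) : Primrec fun a => f a + g a := by
  have h : Primrec fun a => (((f a).toNat + (g a).toNat : ℕ) : ℤ) -
    (((-f a).toNat + (-g a).toNat : ℕ) : ℤ) := by fun_prop
  exact h.of_eq fun a => by omega

@[fun_prop]
theorem intNeg {f : α → ℤ} (hf : Primrec f) : Primrec fun a => -f a := by
  have h : Primrec fun a => (((-f a).toNat : ℕ) : ℤ) - (((f a).toNat : ℕ) : ℤ) := by fun_prop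
  exact h.of_eq fun a => by omega

@[fun_prop]
theorem intSub {f g : α → ℤ} (hf : Primrec f) (hg : Primrec g) : Primrec fun a => f a - g a := by
  have h : Primrec fun a => f a + -g a := by fun_prop
  exact h.of_eq fun a => by omega

@[fun_prop]
theorem intMul {f g : α → ℤ} (hf : Primrec f) (hg : Primrec g) : Primrec fun a => f a * g a := by
  have h : Primrec fun a =>
      (((f a).toNat * (g a).toNat + (-f a).toNat * (-g a).toNat : ℕ) : ℤ) -
      (((f a).toNat * (-g a).toNat + (-f a).toNat * (g a).toNat : ℕ) : ℤ) := by fun_prop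
  refine h.of_eq fun a => ?_
  have h1 : f a = (f a).toNat - ((-f a).toNat : ℤ) := by omega
  have h2 : g a = (g a).toNat - ((-g a).toNat : ℤ) := by omega
  conv_rhs => rw [h1, h2]
  push_cast
  ring

@[fun_prop]
theorem intNatAbs {f : α → ℤ} (hf : Primrec f) : Primrec fun a => (f a).natAbs := by
  have h : Primrec fun a => (f a).toNat + (-f a).toNat := by fun_prop
  exact h.of_eq fun a => by omega

open Finset in
@[fun_prop]
theorem sum_range_int {f : α → ℕ → ℤ} {g : α → ℕ} (hf : Primrec fun p : α × ℕ => f p.1 p.2)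
    (hg : Primrec g) : Primrec fun a => ∑ i ∈ range (g a), f a i := by
  have h : Primrec₂ fun (a : α) (p : ℕ × ℤ) => p.2 + f a p.1 := by
    have : Primrec fun q : α × ℕ × ℤ => q.2.2 + f q.1 q.2.1 :=
      intAdd (by fun_prop) (hf.comp (f := fun p : α × ℕ => f p.1 p.2)
        (g := fun q : α × ℕ × ℤ => (q.1, q.2.1)) (by fun_prop))
    exact this
  refine (nat_rec' hg (.const 0) h).of_eq fun a => ?_
  induction g a with
  | zero => rfl
  | succ n ih => rw [sum_range_succ, ← ih]

@[fun_prop]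
theorem iterate_comp {f : α → ℕ} {g : α → β} {h : α → β → β} (hf : Primrec f) (hg : Primrec g)
    (hh : Primrec fun p : α × β => h p.1 p.2) : Primrec fun a => (h a)^[f a] (g a) :=
  nat_iterate hf hg hh

@[fun_prop]
theorem foldl_comp {f : α → List β} {g : α → σ} {h : α → σ → β → σ} (hf : Primrec f)
    (hg : Primrec g) (hh : Primrec fun p : α × σ × β => h p.1 p.2.1 p.2.2) :
    Primrec fun a => (f a).foldl (h a) (g a) :=
  list_foldl (h := fun a p => h a p.1 p.2) hf hg hh

end Primrec

/-! ### Semidecidable predicates -/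

/-- A predicate is semidecidable if it is the projection of a primitive recursive relation:
`p a` holds if and only if some natural number is a witness for it. -/
def Semi {α : Type*} [Primcodable α] (p : α → Prop) : Prop :=
  ∃ q : α → ℕ → Prop, PrimrecRel q ∧ ∀ a, p a ↔ ∃ k, q a k

namespace Semi

variable {α β γ : Type*} [Primcodable α] [Primcodable β] [Primcodable γ]

theorem of_primrecPred {p : α → Prop} (h : PrimrecPred p) : Semi p :=
  ⟨fun a _ => p a, h.comp Primrec.fst, fun a => by simp⟩

theorem of_iff {p q : α → Prop} (h : Semi p) (e : ∀ a, q a ↔ p a) : Semi q := by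
  obtain ⟨r, hr, hp⟩ := h
  exact ⟨r, hr, fun a => (e a).trans (hp a)⟩

theorem eq {f g : α → β} (hf : Primrec f) (hg : Primrec g) : Semi fun a => f a = g a :=
  of_primrecPred (Primrec.eq.comp hf hg)

theorem ne {f g : α → β} (hf : Primrec f) (hg : Primrec g) : Semi fun a => f a ≠ g a :=
  of_primrecPred (Primrec.eq.comp hf hg).not

theorem lt {f g : α → ℕ} (hf : Primrec f) (hg : Primrec g) : Semi fun a => f a < g a :=
  of_primrecPred (Primrec.nat_lt.comp hf hg)

theorem and {p q : α → Prop} (hp : Semi p) (hq : Semi q) : Semi fun a => p a ∧ q a := by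
  obtain ⟨r, hr, hp⟩ := hp
  obtain ⟨s, hs, hq⟩ := hq
  refine ⟨fun a k => r a k.unpair.1 ∧ s a k.unpair.2,
    (hr.comp (f := fun p : α × ℕ => p.1) (g := fun p => p.2.unpair.1) (by fun_prop)
      (by fun_prop)).and
    (hs.comp (f := fun p : α × ℕ => p.1) (g := fun p => p.2.unpair.2) (by fun_prop)
      (by fun_prop)), fun a => ?_⟩
  simp only [hp, hq]
  constructor
  · rintro ⟨⟨k, hk⟩, l, hl⟩
    exact ⟨Nat.pair k l, by simpa using ⟨hk, hl⟩⟩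
  · rintro ⟨k, hk, hl⟩
    exact ⟨⟨_, hk⟩, _, hl⟩

theorem or {p q : α → Prop} (hp : Semi p) (hq : Semi q) : Semi fun a => p a ∨ q a := by
  obtain ⟨r, hr, hp⟩ := hp
  obtain ⟨s, hs, hq⟩ := hq
  exact ⟨fun a k => r a k ∨ s a k, PrimrecPred.or hr hs, fun a => by simp only [hp, hq, exists_or]⟩

theorem ex {p : α → β → Prop} (hp : Semi fun x : α × β => p x.1 x.2) :
    Semi fun a => ∃ b, p a b := by
  obtain ⟨r, hr, hp⟩ := hp
  have hd : Primrec fun x : (α × ℕ) × β => ((x.1.1, x.2), x.1.2.unpair.2) := by fun_prop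
  have hq : PrimrecRel fun (x : α × ℕ) (b : β) => r (x.1, b) x.2.unpair.2 := by
    have := PrimrecPred.comp hr hd
    exact this
  refine ⟨fun a k => ∃ b ∈ (Encodable.decode (α := β) k.unpair.1).toList, r (a, b) k.unpair.2,
    ?_, fun a => ?_⟩
  · have h1 : Primrec fun x : α × ℕ => (Encodable.decode (α := β) x.2.unpair.1).toList :=
      Primrec.optionToList.comp (Primrec.decode.comp (by fun_prop))
    have h2 : PrimrecRel fun (b : β) (x : α × ℕ) => r (x.1, b) x.2.unpair.2 := hq.swap
    exact (PrimrecRel.exists_mem_list h2).comp h1 .id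
  · constructor
    · rintro ⟨b, hb⟩
      obtain ⟨k, hk⟩ := (hp (a, b)).1 hb
      exact ⟨Nat.pair (Encodable.encode b) k, b, by simp, by simpa using hk⟩
    · rintro ⟨k, b, -, hk⟩
      exact ⟨b, (hp (a, b)).2 ⟨_, hk⟩⟩

theorem forall_lt {p : α → ℕ → Prop} {g : α → ℕ} (hg : Primrec g)
    (hp : Semi fun x : α × ℕ => p x.1 x.2) : Semi fun a => ∀ i < g a, p a i := by
  obtain ⟨r, hr, hp⟩ := hp
  have hd : Primrec fun x : ℕ × (α × List ℕ) => ((x.2.1, x.1), x.2.2.getD x.1 0) := by fun_prop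
  have h2 : PrimrecRel fun (i : ℕ) (x : α × List ℕ) => r (x.1, i) (x.2.getD i 0) := by
    have := PrimrecPred.comp hr hd
    exact this
  have h3 : PrimrecPred fun x : α × List ℕ => ∀ i < g x.1, r (x.1, i) (x.2.getD i 0) := by
    have := PrimrecRel.comp (PrimrecRel.forall_mem_list h2)
      (f := fun x : α × List ℕ => List.range (g x.1)) (g := fun x => x)
      (Primrec.list_range.comp (hg.comp .fst)) .id
    exact this.of_eq fun x => by simp
  refine (Semi.ex (p := fun a (l : List ℕ) => ∀ i < g a, r (a, i) (l.getD i 0))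
    (of_primrecPred h3)).of_iff fun a => ?_
  constructor
  · intro h
    have h' : ∀ i, ∃ k, i < g a → r (a, i) k := fun i => by
      by_cases hi : i < g a
      · obtain ⟨k, hk⟩ := (hp (a, i)).1 (h i hi)
        exact ⟨k, fun _ => hk⟩
      · exact ⟨0, fun h => absurd h hi⟩
    choose k hk using h'
    refine ⟨(List.range (g a)).map k, fun i hi => ?_⟩
    simpa [List.getD, hi] using hk i hi
  · rintro ⟨l, hl⟩ i hi
    exact (hp (a, i)).2 ⟨_, hl i hi⟩

/-- Unbounded search selects, partial recursively, a solution of a semidecidable relation. -/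
theorem exists_partrec {p : α → β → Prop} (hp : Semi fun x : α × β => p x.1 x.2) :
    ∃ f : α →. β, Partrec f ∧ ∀ a, (∃ b, p a b) → ∃ b ∈ f a, p a b := by
  obtain ⟨r, hr, hp⟩ := hp
  classical
  let g : α → ℕ → Option β := fun a k =>
    (Encodable.decode (α := β) k.unpair.1).bind fun b =>
      Option.guard (fun b => r (a, b) k.unpair.2) b
  have hg : Primrec₂ g := by
    have h0 : Primrec fun x : α × ℕ => Encodable.decode (α := β) x.2.unpair.1 :=
      Primrec.decode.comp (by fun_prop)
    have hd : Primrec fun x : (α × ℕ) × β => ((x.1.1, x.2), x.1.2.unpair.2) := by fun_prop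
    have hq : PrimrecRel fun (x : α × ℕ) (b : β) => r (x.1, b) x.2.unpair.2 := by
      have := PrimrecPred.comp hr hd
      exact this
    have h2 := hq.comp (f := fun x : (α × ℕ) × β => x.1) (g := Prod.snd) .fst .snd
    refine Primrec.option_bind h0 ?_
    have h3 : PrimrecRel fun (x : (α × ℕ) × β) (b : β) => r (x.1.1, b) x.1.2.unpair.2 :=
      PrimrecPred.comp hq (f := fun y : ((α × ℕ) × β) × β => (y.1.1, y.2)) (by fun_prop)
    exact Primrec.option_guard h3 .snd
  have hs : ∀ a k b, b ∈ g a k → p a b := by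
    intro a k b hb
    obtain ⟨c, -, hc⟩ := Option.mem_bind_iff.1 hb
    obtain ⟨rfl, h⟩ := Option.guard_eq_some_iff.1 hc
    exact (hp (a, c)).2 ⟨_, by simpa using h⟩
  refine ⟨fun a => Nat.rfindOpt (g a), Partrec.rfindOpt hg.to_comp, fun a => ?_⟩
  rintro ⟨b, hb⟩
  obtain ⟨k, hk⟩ := (hp (a, b)).1 hb
  have hdom : (Nat.rfindOpt (g a)).Dom := by
    refine Nat.rfindOpt_dom.2 ⟨Nat.pair (Encodable.encode b) k, b, ?_⟩
    simp only [g, Nat.unpair_pair, Encodable.encodek]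
    refine Option.mem_bind_iff.2 ⟨b, rfl, Option.guard_eq_some_iff.2 ⟨rfl, by simpa using hk⟩⟩
  refine ⟨_, Part.get_mem hdom, ?_⟩
  obtain ⟨n, hn⟩ := Nat.rfindOpt_spec (Part.get_mem hdom)
  exact hs a n _ hn

end Semi

theorem List.exists_getD_eq {α : Type*} (d : α) (n : ℕ) (f : ℕ → α) :
    ∃ l : List α, l.length = n ∧ ∀ i < n, l.getD i d = f i :=
  ⟨(List.range n).map f, by simp, fun i hi => by simp [List.getD, hi]⟩

theorem List.exists_getD_forall {α : Type*} (d : α) (n : ℕ) (p : ℕ → α → Prop)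
    (h : ∀ i < n, ∃ x, p i x) : ∃ l : List α, l.length = n ∧ ∀ i < n, p i (l.getD i d) := by
  have : ∀ i, ∃ x, i < n → p i x := fun i => by
    by_cases hi : i < n
    · obtain ⟨x, hx⟩ := h i hi
      exact ⟨x, fun _ => hx⟩
    · exact ⟨d, fun h => absurd h hi⟩
  choose f hf using this
  obtain ⟨l, hl, hlf⟩ := List.exists_getD_eq d n f
  exact ⟨l, hl, fun i hi => by rw [hlf i hi]; exact hf i hi⟩

/-! ### Integer lattices given by generators -/

namespace ZAlg

open Finset

/-- The entry `l i` of a list of integers, zero beyond its end. -/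
abbrev ent (l : List ℤ) (i : ℕ) : ℤ := l.getD i 0

/-- The entry in row `i` and column `j` of a list of rows, zero where it is not present. -/
abbrev ent₂ (l : List (List ℤ)) (i j : ℕ) : ℤ := ent (l.getD i []) j

/-- The entry with indices `i, j, k` of a three-dimensional array. -/
abbrev ent₃ (l : List (List (List ℤ))) (i j k : ℕ) : ℤ := ent₂ (l.getD i []) j k

/-- The standard unit vectors. -/
def delta (i j : ℕ) : ℤ := if i = j then 1 else 0

/-- The first `n` coordinates of `x` form an integer combination of the vectors in `L`. -/
def LatMem (n : ℕ) (L : List (List ℤ)) (x : ℕ → ℤ) : Prop :=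
  ∃ y : List ℤ, ∀ i < n, x i = ∑ j ∈ range L.length, ent y j * ent₂ L j i

/-- A certificate that the first `n` coordinates of `x` do not form an integer combination of
the vectors in `L`: a linear form whose values at `L` are divisible by `m`, but not the value
at `x`. -/
def LatNotMem (n : ℕ) (L : List (List ℤ)) (x : ℕ → ℤ) : Prop :=
  ∃ (m : ℕ) (ψ : List ℤ), (∀ j < L.length, ∃ w : ℤ, ∑ i ∈ range n, ent ψ i * ent₂ L j i = m * w) ∧
    ∃ (w : ℤ) (s : ℕ), s ≠ 0 ∧ s < m ∧ ∑ i ∈ range n, ent ψ i * x i = m * w + s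

section Semi

variable {α : Type*} [Primcodable α]

@[fun_prop]
theorem primrec_delta {f g : α → ℕ} (hf : Primrec f) (hg : Primrec g) :
    Primrec fun a => delta (f a) (g a) := by
  unfold delta; fun_prop

theorem semi_latMem {n : α → ℕ} {L : α → List (List ℤ)} {x : α → ℕ → ℤ} (hn : Primrec n)
    (hL : Primrec L) (hx : Primrec fun p : α × ℕ => x p.1 p.2) :
    Semi fun a => LatMem (n a) (L a) (x a) := by
  unfold LatMem
  repeat' first
    | refine Semi.ex ?_
    | refine Semi.forall_lt (by fun_prop) ?_
    | refine Semi.eq ?_ ?_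
  all_goals fun_prop

theorem semi_latNotMem {n : α → ℕ} {L : α → List (List ℤ)} {x : α → ℕ → ℤ} (hn : Primrec n)
    (hL : Primrec L) (hx : Primrec fun p : α × ℕ => x p.1 p.2) :
    Semi fun a => LatNotMem (n a) (L a) (x a) := by
  unfold LatNotMem
  repeat' first
    | refine Semi.ex ?_
    | refine Semi.and ?_ ?_
    | refine Semi.forall_lt (by fun_prop) ?_
    | refine Semi.eq ?_ ?_
    | refine Semi.ne ?_ ?_
    | refine Semi.lt ?_ ?_
  all_goals fun_prop

end Semi

/-- The vectors in `L` as elements of `ℤⁿ`. -/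
def rowVec (n : ℕ) (L : List (List ℤ)) (j : Fin L.length) (i : Fin n) : ℤ := ent₂ L j i

theorem latMem_iff {n : ℕ} {L : List (List ℤ)} {x : ℕ → ℤ} :
    LatMem n L x ↔ (fun i : Fin n => x i) ∈ AddSubgroup.closure (Set.range (rowVec n L)) := by
  have h : (fun i : Fin n => x i) ∈ AddSubgroup.closure (Set.range (rowVec n L)) ↔
      (fun i : Fin n => x i) ∈ Submodule.span ℤ (Set.range (rowVec n L)) := by
    rw [← Submodule.mem_toAddSubgroup, Submodule.span_int_eq_addSubgroupClosure]
  rw [h, Submodule.mem_span_range_iff_exists_fun]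
  constructor
  · rintro ⟨y, hy⟩
    refine ⟨fun j => ent y j, funext fun i => ?_⟩
    rw [hy i i.2, Finset.sum_range, Finset.sum_apply]
    rfl
  · rintro ⟨c, hc⟩
    obtain ⟨y, -, hy⟩ := List.exists_getD_eq (0 : ℤ) L.length
      (fun j => if h : j < L.length then c ⟨j, h⟩ else 0)
    refine ⟨y, fun i hi => ?_⟩
    have := congrFun hc ⟨i, hi⟩
    rw [Finset.sum_apply] at this
    rw [← this, Finset.sum_range]
    refine Finset.sum_congr rfl fun j _ => ?_
    rw [show ent y j = c j from (hy j j.2).trans (dif_pos j.2)]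
    rfl

/-- A finitely generated subgroup of `ℤⁿ` is an intersection of kernels of homomorphisms to finite
cyclic groups, so that elements outside it have certificates. -/
theorem latNotMem_iff {n : ℕ} {L : List (List ℤ)} {x : ℕ → ℤ} :
    LatNotMem n L x ↔ ¬ LatMem n L x := by
  constructor
  · rintro ⟨m, ψ, hL, w, s, hs, hsm, hx⟩ ⟨y, hy⟩
    have hd : (m : ℤ) ∣ ∑ i ∈ range n, ent ψ i * x i := by
      rw [Finset.sum_congr rfl fun i hi => by rw [hy i (Finset.mem_range.1 hi), Finset.mul_sum],
        Finset.sum_comm]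
      refine Finset.dvd_sum fun j hj => ?_
      obtain ⟨v, hv⟩ := hL j (Finset.mem_range.1 hj)
      refine ⟨ent y j * v, ?_⟩
      rw [mul_left_comm, ← hv, Finset.mul_sum]
      exact Finset.sum_congr rfl fun i _ => by ring
    rw [hx] at hd
    have h2 : (m : ℤ) ∣ s := (dvd_add_right ⟨w, rfl⟩).1 hd
    have := Nat.le_of_dvd (Nat.pos_of_ne_zero hs) (Int.natCast_dvd_natCast.1 h2)
    omega
  · intro h
    rw [latMem_iff] at h
    set H := AddSubgroup.closure (Set.range (rowVec n L)) with hH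
    have h0 : ((fun i : Fin n => x i : Fin n → ℤ) : (Fin n → ℤ) ⧸ H) ≠ 0 := by
      rwa [ne_eq, QuotientAddGroup.eq_zero_iff]
    -- a character of the quotient with values in `ℚ/ℤ` separates `x` from the lattice
    obtain ⟨χ, hχ⟩ := CharacterModule.exists_character_apply_ne_zero_of_ne_zero h0
    let e : Fin n → Fin n → ℤ := fun i => Pi.single i 1
    choose r hr using fun i => QuotientAddGroup.mk_surjective (χ (e i : (Fin n → ℤ) ⧸ H))
    have hval : ∀ z : Fin n → ℤ, χ (z : (Fin n → ℤ) ⧸ H) =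
        ((∑ i, z i * r i : ℚ) : AddCircle (1 : ℚ)) := by
      intro z
      have hz : z = ∑ i, z i • e i := by
        conv_lhs => rw [← Finset.univ_sum_single z]
        refine Finset.sum_congr rfl fun i _ => ?_
        rw [← Pi.single_smul]
        simp
      have h1 : (z : (Fin n → ℤ) ⧸ H) = ∑ i, z i • (e i : (Fin n → ℤ) ⧸ H) := by
        conv_lhs => rw [hz]
        exact (map_sum (QuotientAddGroup.mk' H) _ _).trans
          (Finset.sum_congr rfl fun i _ => map_zsmul (QuotientAddGroup.mk' H) _ _)
      rw [h1]
      have h2 : ((∑ i, z i * r i : ℚ) : AddCircle (1 : ℚ)) =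
          ∑ i, z i • (r i : AddCircle (1 : ℚ)) := by
        refine (map_sum (QuotientAddGroup.mk' (AddSubgroup.zmultiples (1 : ℚ))) _ _).trans
          (Finset.sum_congr rfl fun i _ => ?_)
        rw [← zsmul_eq_mul, map_zsmul]
        rfl
      rw [h2, map_sum]
      refine Finset.sum_congr rfl fun i _ => ?_
      rw [map_zsmul]
      exact congrArg _ (hr i).symm
    have hzero : ∀ q : ℚ, (q : AddCircle (1 : ℚ)) = 0 ↔ ∃ w : ℤ, q = w := by
      intro q
      rw [AddCircle.coe_eq_zero_iff]
      simp [eq_comm]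
    -- a common denominator of the values of the character at the unit vectors
    let m : ℕ := ∏ i, (r i).den
    have hm : m ≠ 0 := Finset.prod_ne_zero_iff.2 fun i _ => (r i).den_nz
    have hm' : (m : ℚ) ≠ 0 := by exact_mod_cast hm
    have hint : ∀ i, ∃ k : ℤ, (k : ℚ) = m * r i := by
      intro i
      obtain ⟨d, hd⟩ : (r i).den ∣ m := Finset.dvd_prod_of_mem _ (Finset.mem_univ i)
      refine ⟨d * (r i).num, ?_⟩
      rw [hd]
      push_cast
      rw [mul_comm ((r i).den : ℚ), mul_assoc, Rat.den_mul_eq_num]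
    choose k hk using hint
    obtain ⟨ψ, -, hψ⟩ := List.exists_getD_eq (0 : ℤ) n
      (fun j => if h : j < n then k ⟨j, h⟩ else 0)
    have hsum : ∀ z : ℕ → ℤ, ((∑ i ∈ range n, ent ψ i * z i : ℤ) : ℚ) =
        m * ∑ i : Fin n, (z i : ℚ) * r i := by
      intro z
      rw [Finset.sum_range, Finset.mul_sum]
      push_cast
      refine Finset.sum_congr rfl fun i _ => ?_
      rw [show ent ψ i = k i from (hψ i i.2).trans (dif_pos i.2), hk]
      ring
    refine ⟨m, ψ, fun j hj => ?_, ?_⟩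
    · have h1 : ((rowVec n L ⟨j, hj⟩ : Fin n → ℤ) : (Fin n → ℤ) ⧸ H) = 0 :=
        (QuotientAddGroup.eq_zero_iff _).2 (AddSubgroup.subset_closure ⟨_, rfl⟩)
      have h2 := hval (rowVec n L ⟨j, hj⟩)
      rw [h1, map_zero] at h2
      obtain ⟨w, hw⟩ := (hzero _).1 h2.symm
      refine ⟨w, ?_⟩
      have h3 := hsum fun i => ent₂ L j i
      have h4 : (∑ i : Fin n, ((ent₂ L j i : ℤ) : ℚ) * r i) = w := hw
      rw [h4] at h3
      exact_mod_cast h3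
    · set N := ∑ i ∈ range n, ent ψ i * x i with hN
      have hmpos : (0 : ℤ) < m := by omega
      have h1 := Int.emod_nonneg N hmpos.ne'
      have h2 := Int.emod_lt_of_pos N hmpos
      refine ⟨N / m, (N % m).toNat, fun h0 => hχ ?_, by omega, ?_⟩
      · rw [hval, hzero]
        have h3 : N = m * (N / m) := by
          have := Int.mul_ediv_add_emod N m
          omega
        refine ⟨N / m, ?_⟩
        have h4 := hsum x
        rw [← hN, h3] at h4
        push_cast at h4
        exact (mul_left_cancel₀ hm' h4).symm
      · rw [Int.toNat_of_nonneg h1]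
        exact (Int.mul_ediv_add_emod N m).symm

end ZAlg

/-! ### Generators of the solutions of linear equations modulo a lattice -/

namespace ZAlg

open Finset

/-- A homomorphism of free `ℤ`-modules of finite rank splits up to an integer factor: its kernel has
a projection `P`, and `q (1 - P)` factors through it. -/
theorem exists_projection_ker {M N : Type*} [AddCommGroup M] [AddCommGroup N]
    [Module.Free ℤ M] [Module.Finite ℤ M] [Module.Free ℤ N] [Module.Finite ℤ N]
    (A : M →ₗ[ℤ] N) :
    ∃ (q : ℤ) (P : M →ₗ[ℤ] M) (B : N →ₗ[ℤ] M), q ≠ 0 ∧ (∀ x, A (P x) = 0) ∧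
      ∀ x, q • x = q • P x + B (A x) := by
  -- a section of `A` over its range, which is free
  obtain ⟨s, hs⟩ := Module.projective_lifting_property A.rangeRestrict LinearMap.id
    A.surjective_rangeRestrict
  have hs' : ∀ y : LinearMap.range A, A (s y) = y := fun y =>
    congrArg Subtype.val (LinearMap.congr_fun hs y)
  obtain ⟨k, ⟨bM, bN, f, c, hsnf⟩⟩ := Submodule.smithNormalForm (Module.Free.chooseBasis ℤ N)
    (LinearMap.range A)
  have hc : ∀ i, c i ≠ 0 := by
    intro i h0
    have h1 := hsnf i
    rw [h0, zero_smul] at h1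
    exact bN.ne_zero i (Subtype.ext h1)
  -- `bN i = c i • bM (f i)`, so that `∏ c • s` extends from the range of `A` to all of `N`
  let B : N →ₗ[ℤ] M := bM.constr ℤ
    (Function.extend f (fun i => (∏ j ∈ univ.erase i, c j) • s (bN i)) 0)
  have hB : B ∘ₗ (LinearMap.range A).subtype = (∏ j, c j) • s := by
    refine bN.ext fun i => ?_
    rw [LinearMap.comp_apply, Submodule.subtype_apply, hsnf i, map_smul, LinearMap.smul_apply]
    rw [Module.Basis.constr_basis, f.injective.extend_apply, smul_smul,
      Finset.mul_prod_erase _ _ (mem_univ i)]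
  refine ⟨∏ j, c j, LinearMap.id - s ∘ₗ A.rangeRestrict, B, Finset.prod_ne_zero_iff.2
    fun i _ => hc i, fun x => ?_, fun x => ?_⟩
  · rw [LinearMap.sub_apply, map_sub]
    exact sub_eq_zero.2 (hs' (A.rangeRestrict x)).symm
  · have h1 : B (A x) = (∏ j, c j) • s (A.rangeRestrict x) :=
      LinearMap.congr_fun hB (A.rangeRestrict x)
    rw [h1, ← smul_add]
    congr 1
    simp

/-- A certificate that the vectors in `G` generate the group of all `x ∈ ℤᵖ` for which each
`∑ i, x i T e i`, for `e < E`, lies in the lattice of `ℤⁿ` generated by `L`.  Up to the factor `q`,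
the linear map `B` splits the map `(x, y) ↦ (∑ i, x i T e i - ∑ r, y e r L r)_e` modulo `G`. -/
def GenKer (n : ℕ) (L : List (List ℤ)) (p E : ℕ) (T : ℕ → ℕ → ℕ → ℤ) (G : List (List ℤ)) : Prop :=
  (∀ s < G.length, ∀ e < E, LatMem n L fun c => ∑ i ∈ range p, ent₂ G s i * T e i c) ∧
  ∃ (q : ℤ) (B : List (List (List ℤ))) (U : List (List ℤ)) (V : List (List (List ℤ))), q ≠ 0 ∧
    (∀ i < p, ∀ i' < p, q * delta i i' =
      ∑ e ∈ range E, (∑ c ∈ range n, T e i c * ent₃ B e c i') +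
        q * ∑ s ∈ range G.length, ent₂ U i s * ent₂ G s i') ∧
    ∀ e < E, ∀ r < L.length, ∀ i' < p, ∑ c ∈ range n, ent₂ L r c * ent₃ B e c i' =
      q * ∑ s ∈ range G.length, ent₃ V e r s * ent₂ G s i'

theorem semi_genKer {α : Type*} [Primcodable α] {n p E : α → ℕ} {L G : α → List (List ℤ)}
    {T : α → ℕ → ℕ → ℕ → ℤ} (hn : Primrec n) (hL : Primrec L) (hp : Primrec p) (hE : Primrec E)
    (hT : Primrec fun x : α × ℕ × ℕ × ℕ => T x.1 x.2.1 x.2.2.1 x.2.2.2) (hG : Primrec G) :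
    Semi fun a => GenKer (n a) (L a) (p a) (E a) (T a) (G a) := by
  unfold GenKer
  repeat' first
    | refine Semi.ex ?_
    | refine Semi.and ?_ ?_
    | refine Semi.forall_lt (by fun_prop) ?_
    | refine semi_latMem ?_ ?_ ?_
    | refine Semi.eq ?_ ?_
    | refine Semi.ne ?_ ?_
  all_goals fun_prop

theorem sum_mul_sum_assoc {ι κ : Type*} (s : Finset ι) (t : Finset κ) (x : ι → ℤ) (a : ι → κ → ℤ)
    (b : κ → ℤ) :
    ∑ i ∈ s, x i * ∑ j ∈ t, a i j * b j = ∑ j ∈ t, (∑ i ∈ s, x i * a i j) * b j := by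
  simp only [Finset.mul_sum, Finset.sum_mul]
  rw [Finset.sum_comm]
  simp only [mul_assoc]

/-- The identities of the certificate, combined with coefficients of a solution, express `q` times
the solution by the rows of `G` with coefficients divisible by `q`. -/
theorem GenKer.mem_iff {n : ℕ} {L : List (List ℤ)} {p E : ℕ} {T : ℕ → ℕ → ℕ → ℤ}
    {G : List (List ℤ)} (h : GenKer n L p E T G) (x : ℕ → ℤ) :
    (∀ e < E, LatMem n L fun c => ∑ i ∈ range p, x i * T e i c) ↔
      ∃ y : ℕ → ℤ, ∀ i < p, x i = ∑ s ∈ range G.length, y s * ent₂ G s i := by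
  obtain ⟨hG, q, B, U, V, hq, h1, h2⟩ := h
  constructor
  · intro hx
    choose! y hy using hx
    refine ⟨fun s => ∑ i ∈ range p, x i * ent₂ U i s +
      ∑ e ∈ range E, ∑ r ∈ range L.length, ent (y e) r * ent₃ V e r s, fun i' hi' => ?_⟩
    refine mul_left_cancel₀ hq ?_
    have e1 : q * x i' = ∑ i ∈ range p, x i * (q * delta i i') := by
      simp only [delta]
      rw [Finset.sum_eq_single i' (fun j _ hj => by simp [hj])
        (fun h => absurd (Finset.mem_range.2 hi') h)]
      simp [mul_comm]
    have e2 : ∑ i ∈ range p, x i * ∑ e ∈ range E, (∑ c ∈ range n, T e i c * ent₃ B e c i') =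
        q * ∑ s ∈ range G.length, (∑ e ∈ range E, ∑ r ∈ range L.length,
          ent (y e) r * ent₃ V e r s) * ent₂ G s i' := by
      simp only [Finset.mul_sum _ _ (x _), Finset.sum_mul]
      rw [Finset.sum_comm, Finset.sum_comm (s := range G.length), Finset.mul_sum]
      refine Finset.sum_congr rfl fun e he => ?_
      have he := Finset.mem_range.1 he
      calc _ = ∑ i ∈ range p, x i * ∑ c ∈ range n, T e i c * ent₃ B e c i' := by
            simp only [Finset.mul_sum]
        _ = ∑ c ∈ range n, (∑ i ∈ range p, x i * T e i c) * ent₃ B e c i' :=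
            sum_mul_sum_assoc _ _ _ _ _
        _ = ∑ c ∈ range n, (∑ r ∈ range L.length, ent (y e) r * ent₂ L r c) * ent₃ B e c i' :=
            Finset.sum_congr rfl fun c hc => by
              rw [← hy e he c (Finset.mem_range.1 hc)]
        _ = ∑ r ∈ range L.length, ent (y e) r * ∑ c ∈ range n, ent₂ L r c * ent₃ B e c i' :=
            (sum_mul_sum_assoc _ _ _ _ _).symm
        _ = ∑ r ∈ range L.length, ent (y e) r *
              ∑ s ∈ range G.length, ent₃ V e r s * (q * ent₂ G s i') :=
            Finset.sum_congr rfl fun r hr => by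
              rw [h2 e he r (Finset.mem_range.1 hr) i' hi', Finset.mul_sum]
              simp only [mul_left_comm]
        _ = _ := by
            rw [sum_mul_sum_assoc, Finset.mul_sum]
            refine Finset.sum_congr rfl fun s _ => ?_
            rw [← Finset.sum_mul]
            ring
    have e3 : ∑ i ∈ range p, x i * (q * ∑ s ∈ range G.length, ent₂ U i s * ent₂ G s i') =
        q * ∑ s ∈ range G.length, (∑ i ∈ range p, x i * ent₂ U i s) * ent₂ G s i' := by
      rw [← sum_mul_sum_assoc, Finset.mul_sum]
      exact Finset.sum_congr rfl fun i _ => by ring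
    calc q * x i' = ∑ i ∈ range p, x i *
          (∑ e ∈ range E, (∑ c ∈ range n, T e i c * ent₃ B e c i') +
            q * ∑ s ∈ range G.length, ent₂ U i s * ent₂ G s i') :=
          e1.trans (Finset.sum_congr rfl fun i hi => by
            rw [h1 i (Finset.mem_range.1 hi) i' hi'])
      _ = _ := by
          simp only [mul_add, Finset.sum_add_distrib, add_mul]
          rw [e2, e3, add_comm]
  · rintro ⟨y, hy⟩ e he
    choose! z hz using fun s hs => hG s hs e he
    obtain ⟨w, -, hw⟩ := List.exists_getD_eq (0 : ℤ) L.length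
      fun r => ∑ s ∈ range G.length, y s * ent (z s) r
    refine ⟨w, fun c hc => ?_⟩
    calc ∑ i ∈ range p, x i * T e i c
        = ∑ i ∈ range p, (∑ s ∈ range G.length, y s * ent₂ G s i) * T e i c :=
          Finset.sum_congr rfl fun i hi => by rw [← hy i (Finset.mem_range.1 hi)]
      _ = ∑ s ∈ range G.length, y s * ∑ i ∈ range p, ent₂ G s i * T e i c :=
          (sum_mul_sum_assoc _ _ _ _ _).symm
      _ = ∑ s ∈ range G.length, y s * ∑ r ∈ range L.length, ent (z s) r * ent₂ L r c :=
          Finset.sum_congr rfl fun s hs => by rw [← hz s (Finset.mem_range.1 hs) c hc]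
      _ = ∑ r ∈ range L.length, (∑ s ∈ range G.length, y s * ent (z s) r) * ent₂ L r c :=
          sum_mul_sum_assoc _ _ _ _ _
      _ = _ := Finset.sum_congr rfl fun r hr => by
          rw [← hw r (Finset.mem_range.1 hr)]

theorem exists_genKer (n : ℕ) (L : List (List ℤ)) (p E : ℕ) (T : ℕ → ℕ → ℕ → ℤ) :
    ∃ G, GenKer n L p E T G := by
  -- the map `(x, y) ↦ (∑ i, x i T e i - ∑ r, y e r L r)_e`
  let A : ((Fin p → ℤ) × (Fin E × Fin L.length → ℤ)) →ₗ[ℤ] (Fin E × Fin n → ℤ) :=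
    LinearMap.coprod
      (Fintype.linearCombination ℤ fun (i : Fin p) (ec : Fin E × Fin n) => T ec.1 i ec.2)
      (-Fintype.linearCombination ℤ fun (er : Fin E × Fin L.length) (ec : Fin E × Fin n) =>
        if er.1 = ec.1 then ent₂ L er.2 ec.2 else 0)
  have hA : ∀ x y (e : Fin E) (c : Fin n), A (x, y) (e, c) =
      ∑ i, x i * T e i c - ∑ r, y (e, r) * ent₂ L r c := by
    intro x y e c
    simp only [A, LinearMap.coprod_apply, LinearMap.neg_apply, Fintype.linearCombination_apply,
      Pi.add_apply, Pi.neg_apply, Finset.sum_apply, Pi.smul_apply, smul_eq_mul, ← sub_eq_add_neg]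
    congr 1
    rw [Fintype.sum_prod_type, Finset.sum_eq_single e (fun e' _ he => by simp [he]) (by simp)]
    simp
  obtain ⟨q, P, B, hq, hAP, hqP⟩ := exists_projection_ker A
  -- the solutions are the first components of the elements in the kernel of `A`
  let H : Submodule ℤ (Fin p → ℤ) := LinearMap.range (LinearMap.fst ℤ _ _ ∘ₗ P)
  obtain ⟨m, g, hg⟩ := Submodule.fg_iff_exists_fin_generating_family.1 (IsNoetherian.noetherian H)
  have hgen : ∀ z, ∃ u : Fin m → ℤ, ∀ i, (P z).1 i = ∑ s, u s * g s i := by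
    intro z
    have : (P z).1 ∈ Submodule.span ℤ (Set.range g) := by
      rw [hg]; exact ⟨z, rfl⟩
    obtain ⟨u, hu⟩ := (Submodule.mem_span_range_iff_exists_fun ℤ).1 this
    exact ⟨u, fun i => by rw [← hu, Finset.sum_apply]; rfl⟩
  choose u hu using hgen
  obtain ⟨G, hGl, hG⟩ := List.exists_getD_forall [] m
    (fun s l => ∀ i : Fin p, ∀ hs : s < m, ent l i = g ⟨s, hs⟩ i) (fun s hs => by
      obtain ⟨l, -, hl⟩ := List.exists_getD_eq (0 : ℤ) p
        (fun i => if h : i < p then g ⟨s, hs⟩ ⟨i, h⟩ else 0)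
      exact ⟨l, fun i _ => (hl i i.2).trans (dif_pos i.2)⟩)
  have hG' : ∀ (s : Fin m) (i : Fin p), ent₂ G s i = g s i := fun s i => hG s s.2 i s.2
  subst hGl
  -- the coefficients of `B`, and the coordinates of the projected unit vectors with respect to `G`
  obtain ⟨Bl, -, hBl⟩ := List.exists_getD_forall [] E
    (fun e l => ∀ he : e < E, ∀ (c : Fin n) (i : Fin p),
      ent₂ l c i = (B (Pi.single (⟨e, he⟩, c) 1)).1 i) (fun e he => by
      obtain ⟨l, -, hl⟩ := List.exists_getD_forall [] n
        (fun c l => ∀ hc : c < n, ∀ (i : Fin p),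
          ent l i = (B (Pi.single (⟨e, he⟩, ⟨c, hc⟩) 1)).1 i) (fun c hc => by
        obtain ⟨l, -, hl⟩ := List.exists_getD_eq (0 : ℤ) p (fun i => if h : i < p then
          (B (Pi.single (⟨e, he⟩, ⟨c, hc⟩) 1)).1 ⟨i, h⟩ else 0)
        exact ⟨l, fun _ i => (hl i i.2).trans (dif_pos i.2)⟩)
      exact ⟨l, fun _ c i => hl c c.2 c.2 i⟩)
  obtain ⟨U, -, hU⟩ := List.exists_getD_forall [] p
    (fun i l => ∀ hi : i < p, ∀ s : Fin G.length, ent l s = u (Pi.single ⟨i, hi⟩ 1, 0) s)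
    (fun i hi => by
      obtain ⟨l, -, hl⟩ := List.exists_getD_eq (0 : ℤ) G.length (fun s => if h : s < G.length then
          u (Pi.single ⟨i, hi⟩ 1, 0) ⟨s, h⟩ else 0)
      exact ⟨l, fun _ s => (hl s s.2).trans (dif_pos s.2)⟩)
  obtain ⟨V, -, hV⟩ := List.exists_getD_forall [] E
    (fun e l => ∀ he : e < E, ∀ (r : Fin L.length) (s : Fin G.length),
      ent₂ l r s = u (0, Pi.single (⟨e, he⟩, r) 1) s) (fun e he => by
      obtain ⟨l, -, hl⟩ := List.exists_getD_forall [] L.length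
        (fun r l => ∀ hr : r < L.length, ∀ (s : Fin G.length),
          ent l s = u (0, Pi.single (⟨e, he⟩, ⟨r, hr⟩) 1) s) (fun r hr => by
        obtain ⟨l, -, hl⟩ := List.exists_getD_eq (0 : ℤ) G.length (fun s =>
          if h : s < G.length then u (0, Pi.single (⟨e, he⟩, ⟨r, hr⟩) 1) ⟨s, h⟩ else 0)
        exact ⟨l, fun _ s => (hl s s.2).trans (dif_pos s.2)⟩)
      exact ⟨l, fun _ c i => hl c c.2 c.2 i⟩)
  have hB : ∀ (w : Fin E × Fin n → ℤ) (i : Fin p),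
      (B w).1 i = ∑ e : Fin E, ∑ c : Fin n, w (e, c) * ent₃ Bl e c i := by
    intro w i
    conv_lhs => rw [← Finset.univ_sum_single w]
    rw [map_sum, Prod.fst_sum, Finset.sum_apply, Fintype.sum_prod_type]
    refine Finset.sum_congr rfl fun e _ => Finset.sum_congr rfl fun c _ => ?_
    have h1 : (Pi.single (e, c) (w (e, c)) : Fin E × Fin n → ℤ) =
        w (e, c) • Pi.single (e, c) 1 := by
      rw [← Pi.single_smul]; simp
    rw [h1, map_smul, Prod.smul_fst, Pi.smul_apply, smul_eq_mul]
    congr 1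
    exact (hBl e e.2 e.2 c i).symm
  refine ⟨G, fun s hs e he => ?_, q, Bl, U, V, hq, fun i hi i' hi' => ?_, fun e he r hr i' hi' => ?_⟩
  · obtain ⟨z, hz⟩ : g ⟨s, hs⟩ ∈ H := by
      rw [← hg]; exact Submodule.subset_span ⟨_, rfl⟩
    obtain ⟨y, -, hy⟩ := List.exists_getD_eq (0 : ℤ) L.length (fun r =>
      if h : r < L.length then (P z).2 (⟨e, he⟩, ⟨r, h⟩) else 0)
    refine ⟨y, fun c hc => ?_⟩
    have h1 := congrFun (hAP z) (⟨e, he⟩, ⟨c, hc⟩)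
    rw [show P z = ((P z).1, (P z).2) from rfl, hA] at h1
    beta_reduce
    rw [Finset.sum_range, Finset.sum_range]
    have h2 := sub_eq_zero.1 h1
    have h3 : (P z).1 = g ⟨s, hs⟩ := hz
    rw [h3] at h2
    refine Eq.trans ?_ (h2.trans ?_)
    · exact Finset.sum_congr rfl fun i _ => by rw [← hG' ⟨s, hs⟩ i]
    · exact Finset.sum_congr rfl fun r _ => by
        rw [show ent y r = _ from (hy r r.2).trans (dif_pos r.2)]
  · have h1 := congrFun (congrArg Prod.fst (hqP (Pi.single ⟨i, hi⟩ 1, 0))) ⟨i', hi'⟩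
    simp only [Prod.fst_add, Prod.smul_fst, Pi.add_apply, Pi.smul_apply, smul_eq_mul, hB, hA, hu]
      at h1
    simp only [Finset.sum_range]
    have h2 : delta i i' = (Pi.single ⟨i, hi⟩ 1 : Fin p → ℤ) ⟨i', hi'⟩ := by
      simp only [delta, Pi.single_apply, Fin.mk.injEq, eq_comm]
    rw [h2, h1, add_comm]
    congr 1
    · refine Finset.sum_congr rfl fun e _ => Finset.sum_congr rfl fun c _ => ?_
      rw [Finset.sum_eq_single ⟨i, hi⟩ (fun j _ hj => by simp [hj]) (by simp)]
      simp
    · congr 1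
      exact Finset.sum_congr rfl fun s _ => by rw [hG' s ⟨i', hi'⟩, ← hU i hi hi s]
  · have h1 := congrFun (congrArg Prod.fst (hqP (0, Pi.single (⟨e, he⟩, ⟨r, hr⟩) 1))) ⟨i', hi'⟩
    simp only [Prod.fst_add, Prod.smul_fst, Pi.add_apply, Pi.smul_apply, smul_eq_mul, hB, hA, hu]
      at h1
    simp only [Finset.sum_range]
    have h2 : ∑ e' : Fin E, ∑ c : Fin n, (∑ i : Fin p, (0 : Fin p → ℤ) i * T e' i c -
        ∑ r' : Fin L.length, (Pi.single (⟨e, he⟩, ⟨r, hr⟩) 1 : Fin E × Fin L.length → ℤ) (e', r') *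
          ent₂ L r' c) * ent₃ Bl e' c i' =
        - ∑ c : Fin n, ent₂ L r c * ent₃ Bl e c i' := by
      rw [Finset.sum_eq_single ⟨e, he⟩ _ (by simp), ← Finset.sum_neg_distrib]
      · refine Finset.sum_congr rfl fun c _ => ?_
        rw [Finset.sum_eq_single (a := (⟨r, hr⟩ : Fin L.length))
          (fun j _ hj => by simp [hj]) (by simp)]
        simp
      · intro e' _ he'
        refine Finset.sum_eq_zero fun c _ => ?_
        have h0 : ∑ r' : Fin L.length, (Pi.single (⟨e, he⟩, ⟨r, hr⟩) 1 :
            Fin E × Fin L.length → ℤ) (e', r') * ent₂ L r' c = 0 :=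
          Finset.sum_eq_zero fun j _ => by
            rw [Pi.single_eq_of_ne (fun h => he' (congrArg Prod.fst h)), zero_mul]
        rw [h0]
        simp
    rw [h2] at h1
    have h3 : ∑ s : Fin G.length, u (0, Pi.single (⟨e, he⟩, ⟨r, hr⟩) 1) s * g s ⟨i', hi'⟩ =
        ∑ s : Fin G.length, ent₃ V e r s * ent₂ G s i' :=
      Finset.sum_congr rfl fun s _ => by
        rw [hG' s ⟨i', hi'⟩, ← hV e he he ⟨r, hr⟩ s]
    rw [h3] at h1
    simp only [Pi.zero_apply, mul_zero] at h1
    linarith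

end ZAlg

/-! ### Computing with coefficient vectors in a presented algebra -/

namespace ZAlg

open Finset

/-- The coefficient vector of the product of two elements given by coefficient vectors. -/
def AlgCode.vmul (C : AlgCode) (x y : ℕ → ℤ) (k : ℕ) : ℤ :=
  ∑ i ∈ range C.1, ∑ j ∈ range C.1, x i * y j * ent₃ C.2.2 i j k

/-- The product of the row vector `w` and the `k`-th of the `n × n` matrices stored in `x`; the
entry `(i, c)` of that matrix is at position `⟨k, ⟨i, c⟩⟩` with respect to the pairing function. -/
def app (n k : ℕ) (x w : ℕ → ℤ) (c : ℕ) : ℤ :=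
  ∑ i ∈ range n, w i * x (Nat.pair k (Nat.pair i c))

section Primrec

variable {α : Type*} [Primcodable α]

@[fun_prop]
theorem primrec_vmul {C : α → AlgCode} {x y : α → ℕ → ℤ} {k : α → ℕ} (hC : Primrec C)
    (hx : Primrec fun p : α × ℕ => x p.1 p.2) (hy : Primrec fun p : α × ℕ => y p.1 p.2)
    (hk : Primrec k) : Primrec fun a => (C a).vmul (x a) (y a) (k a) := by
  unfold AlgCode.vmul; fun_prop

@[fun_prop]
theorem primrec_app {n k : α → ℕ} {x w : α → ℕ → ℤ} {c : α → ℕ} (hn : Primrec n) (hk : Primrec k)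
    (hx : Primrec fun p : α × ℕ => x p.1 p.2) (hw : Primrec fun p : α × ℕ => w p.1 p.2)
    (hc : Primrec c) : Primrec fun a => app (n a) (k a) (x a) (w a) (c a) := by
  unfold app; fun_prop

end Primrec

/-- The first `n` coordinates of `F x` are linear forms in the first `p` coordinates of `x`. -/
def IsLin (n p : ℕ) (F : (ℕ → ℤ) → ℕ → ℤ) : Prop :=
  ∀ x, ∀ c < n, F x c = ∑ u ∈ range p, x u * F (delta u) c

theorem sum_delta {p j : ℕ} (hj : j < p) (x : ℕ → ℤ) : ∑ u ∈ range p, x u * delta u j = x j := by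
  rw [Finset.sum_eq_single j (fun u _ hu => by simp [delta, hu])
    (fun h => absurd (Finset.mem_range.2 hj) h)]
  simp [delta]

namespace IsLin

variable {n p : ℕ} {F F' : (ℕ → ℤ) → ℕ → ℤ}

theorem sub (h : IsLin n p F) (h' : IsLin n p F') : IsLin n p fun x c => F x c - F' x c := by
  intro x c hc
  beta_reduce
  rw [h x c hc, h' x c hc, ← Finset.sum_sub_distrib]
  simp only [mul_sub]

theorem sum {m : ℕ} {F : ℕ → (ℕ → ℤ) → ℕ → ℤ} {r : ℕ → ℤ} (h : ∀ i < m, IsLin n p (F i)) :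
    IsLin n p fun x c => ∑ i ∈ range m, r i * F i x c := by
  intro x c hc
  simp only [Finset.mul_sum]
  rw [Finset.sum_comm]
  refine Finset.sum_congr rfl fun i hi => ?_
  rw [h i (Finset.mem_range.1 hi) x c hc, Finset.mul_sum]
  exact Finset.sum_congr rfl fun u _ => by ring

theorem app_const (h : IsLin n p F) (k : ℕ) (g : ℕ → ℤ) : IsLin n p fun x => app n k g (F x) := by
  intro x c hc
  simp only [app, Finset.mul_sum]
  rw [Finset.sum_comm]
  refine Finset.sum_congr rfl fun i hi => ?_
  rw [h x i (Finset.mem_range.1 hi), Finset.sum_mul]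
  exact Finset.sum_congr rfl fun u _ => by ring

theorem app_self {k : ℕ} (hk : ∀ i < n, ∀ c < n, Nat.pair k (Nat.pair i c) < p) (w : ℕ → ℤ) :
    IsLin n p fun x => app n k x w := by
  intro x c hc
  simp only [app, Finset.mul_sum]
  rw [Finset.sum_comm]
  refine Finset.sum_congr rfl fun i hi => ?_
  rw [← sum_delta (hk i (Finset.mem_range.1 hi) c hc) x, Finset.mul_sum]
  exact Finset.sum_congr rfl fun u _ => by ring

theorem vmul_left {C : AlgCode} (h : IsLin C.1 p F) (y : ℕ → ℤ) :
    IsLin C.1 p fun x => C.vmul (F x) y := by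
  intro x c hc
  simp only [AlgCode.vmul, Finset.mul_sum]
  refine Eq.trans (Finset.sum_congr rfl fun i hi => ?_) Finset.sum_comm
  refine Eq.trans (Finset.sum_congr rfl fun j _ => ?_) Finset.sum_comm
  rw [h x i (Finset.mem_range.1 hi), Finset.sum_mul, Finset.sum_mul]
  exact Finset.sum_congr rfl fun u _ => by ring

theorem vmul_right {C : AlgCode} (h : IsLin C.1 p F) (y : ℕ → ℤ) :
    IsLin C.1 p fun x => C.vmul y (F x) := by
  intro x c hc
  simp only [AlgCode.vmul, Finset.mul_sum]
  refine Eq.trans (Finset.sum_congr rfl fun i _ => ?_) Finset.sum_comm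
  refine Eq.trans (Finset.sum_congr rfl fun j hj => ?_) Finset.sum_comm
  rw [h x j (Finset.mem_range.1 hj), Finset.mul_sum, Finset.sum_mul]
  exact Finset.sum_congr rfl fun u _ => by ring

end IsLin

theorem latMem_congr {n : ℕ} {L : List (List ℤ)} {x y : ℕ → ℤ} (h : ∀ i < n, x i = y i) :
    LatMem n L x ↔ LatMem n L y := by
  unfold LatMem
  refine exists_congr fun z => forall₂_congr fun i hi => ?_
  rw [h i hi]

/-- The case of conditions given by linear maps `F e`; the certificate refers to their values at the
unit vectors. -/
theorem GenKer.mem_iff_of_isLin {n : ℕ} {L : List (List ℤ)} {p E : ℕ}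
    {F : ℕ → (ℕ → ℤ) → ℕ → ℤ} {G : List (List ℤ)}
    (h : GenKer n L p E (fun e u c => F e (delta u) c) G) (hF : ∀ e < E, IsLin n p (F e))
    (x : ℕ → ℤ) :
    (∀ e < E, LatMem n L (F e x)) ↔
      ∃ y : ℕ → ℤ, ∀ i < p, x i = ∑ s ∈ range G.length, y s * ent₂ G s i := by
  rw [← h.mem_iff]
  exact forall₂_congr fun e he => latMem_congr fun c hc => hF e he x c hc

/-! #### Values of coefficient vectors -/

section Values

variable {R : Type u} [NonUnitalNonAssocRing R]

/-- The element of `R` with coefficient vector `x` with respect to the family `a`. -/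
def val (C : AlgCode) (a : Fin C.1 → R) : (ℕ → ℤ) →+ R :=
  AddMonoidHom.mk' (fun x => ∑ i : Fin C.1, x i • a i) fun x y => by
    simp only [Pi.add_apply, add_smul, Finset.sum_add_distrib]

variable {C : AlgCode} {a : Fin C.1 → R}

theorem val_apply (x : ℕ → ℤ) : val C a x = ∑ i : Fin C.1, x i • a i := rfl

theorem val_congr {x y : ℕ → ℤ} (h : ∀ i < C.1, x i = y i) : val C a x = val C a y := by
  simp only [val_apply]
  exact Finset.sum_congr rfl fun i _ => by rw [h i i.2]

theorem val_delta (i : Fin C.1) : val C a (delta i) = a i := by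
  rw [val_apply, Finset.sum_eq_single i (fun j _ hj => by
    simp [delta, Fin.val_ne_of_ne hj.symm]) (by simp)]
  simp [delta]

theorem val_delta_of_lt {i : ℕ} (hi : i < C.1) : val C a (delta i) = a ⟨i, hi⟩ :=
  val_delta ⟨i, hi⟩

theorem val_sum {m : ℕ} (r : ℕ → ℤ) (F : ℕ → ℕ → ℤ) :
    val C a (fun c => ∑ i ∈ range m, r i * F i c) = ∑ i ∈ range m, r i • val C a (F i) := by
  have : (fun c => ∑ i ∈ range m, r i * F i c) = ∑ i ∈ range m, r i • F i := by
    funext c; simp [Finset.sum_apply]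
  rw [this, map_sum]
  simp only [map_zsmul]

theorem val_sub (x y : ℕ → ℤ) : val C a (fun c => x c - y c) = val C a x - val C a y :=
  map_sub (val C a) x y

theorem val_eq_sum_delta (x : ℕ → ℤ) :
    val C a x = ∑ i ∈ range C.1, x i • val C a (delta i) := by
  rw [val_apply, Finset.sum_range]
  simp only [val_delta]

theorem val_app (k : ℕ) (x w : ℕ → ℤ) :
    val C a (app C.1 k x w) = ∑ i : Fin C.1, w i • val C a (app C.1 k x (delta i)) := by
  have h : ∀ i : Fin C.1, app C.1 k x (delta i) = fun c => x (Nat.pair k (Nat.pair i c)) := by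
    intro i
    funext c
    rw [app, Finset.sum_eq_single (i : ℕ) (fun j _ hj => by simp [delta, hj.symm])
      (fun h => absurd (Finset.mem_range.2 i.2) h)]
    simp [delta]
  simp only [h]
  rw [← Finset.sum_range fun i => w i • val C a fun c => x (Nat.pair k (Nat.pair i c)), ← val_sum]
  rfl

theorem app_delta {n k i c : ℕ} (hi : i < n) (x : ℕ → ℤ) :
    app n k x (delta i) c = x (Nat.pair k (Nat.pair i c)) := by
  rw [app, Finset.sum_eq_single i (fun j _ hj => by simp [delta, hj.symm])
    (fun h => absurd (Finset.mem_range.2 hi) h)]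
  simp [delta]

variable (h : C.Presents R a)
include h

theorem val_vmul (x y : ℕ → ℤ) : val C a (C.vmul x y) = val C a x * val C a y := by
  rw [val_apply x, val_apply y, Finset.sum_mul_sum]
  simp only [smul_mul_smul_comm, h.mul_eq]
  simp only [val_apply, AlgCode.vmul, Finset.sum_range, Finset.sum_smul, Finset.smul_sum]
  rw [Finset.sum_comm]
  refine Finset.sum_congr rfl fun i _ => ?_
  rw [Finset.sum_comm]
  refine Finset.sum_congr rfl fun j _ => Finset.sum_congr rfl fun k _ => ?_
  rw [mul_smul]
  rfl

theorem latMem_iff_val {x : ℕ → ℤ} : LatMem C.1 C.2.1 x ↔ val C a x = 0 := by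
  have hr : rowVec C.1 C.2.1 = C.rel := by
    funext j i
    simp [rowVec, AlgCode.rel, List.getD_eq_getElem?_getD]
  rw [latMem_iff, val_apply, h.relations, hr]

theorem val_surjective : Function.Surjective (val C a) := by
  intro r
  have hr : r ∈ AddSubgroup.closure (Set.range a) := by rw [h.generates]; trivial
  have h2 : AddSubgroup.closure (Set.range a) ≤ (val C a).range := by
    rw [AddSubgroup.closure_le]
    rintro _ ⟨i, rfl⟩
    exact ⟨_, val_delta i⟩
  exact h2 hr

theorem val_mul_eq_zero_iff {r : R} : (∀ s, r * s = 0) ↔ ∀ k < C.1, r * val C a (delta k) = 0 := by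
  refine ⟨fun h _ _ => h _, fun hk s => ?_⟩
  obtain ⟨x, rfl⟩ := val_surjective h s
  rw [val_eq_sum_delta, Finset.mul_sum]
  exact Finset.sum_eq_zero fun k hk' => by
    rw [mul_smul_comm, hk k (Finset.mem_range.1 hk'), smul_zero]

theorem mul_val_eq_zero_iff {r : R} : (∀ s, s * r = 0) ↔ ∀ k < C.1, val C a (delta k) * r = 0 := by
  refine ⟨fun h _ _ => h _, fun hk s => ?_⟩
  obtain ⟨x, rfl⟩ := val_surjective h s
  rw [val_eq_sum_delta, Finset.sum_mul]
  exact Finset.sum_eq_zero fun k hk' => by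
    rw [smul_mul_assoc, hk k (Finset.mem_range.1 hk'), smul_zero]

end Values

end ZAlg

/-! ### Coefficient matrices of scalars -/

namespace ZAlg

open Finset

section Nondegenerate

variable {R : Type u} [NonUnitalNonAssocRing R]

/-- The residue class in `R⁺/Ann_λ(R)`. -/
abbrev mkL (R : Type u) [NonUnitalNonAssocRing R] : R →+ R ⧸ annL R := QuotientAddGroup.mk' _

/-- The residue class in `R⁺/Ann_ρ(R)`. -/
abbrev mkR (R : Type u) [NonUnitalNonAssocRing R] : R →+ R ⧸ annR R := QuotientAddGroup.mk' _

theorem mkL_surjective : Function.Surjective (mkL R) := QuotientAddGroup.mk'_surjective _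

theorem mkR_surjective : Function.Surjective (mkR R) := QuotientAddGroup.mk'_surjective _

theorem mkL_eq_zero {r : R} : mkL R r = 0 ↔ ∀ s, r * s = 0 := QuotientAddGroup.eq_zero_iff r

theorem mkR_eq_zero {r : R} : mkR R r = 0 ↔ ∀ s, s * r = 0 := QuotientAddGroup.eq_zero_iff r

theorem mkL_eq_iff {r r' : R} : mkL R r = mkL R r' ↔ ∀ s, r * s = r' * s := by
  rw [← sub_eq_zero, ← map_sub, mkL_eq_zero]
  exact forall_congr' fun s => by rw [sub_mul, sub_eq_zero]

theorem mkR_eq_iff {r r' : R} : mkR R r = mkR R r' ↔ ∀ s, s * r = s * r' := by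
  rw [← sub_eq_zero, ← map_sub, mkR_eq_zero]
  exact forall_congr' fun s => by rw [mul_sub, sub_eq_zero]

theorem fR_mk (r s : R) : (fR R (mkL R r) (mkR R s) : R) = r * s := rfl

theorem fR_left_ext {α α' : R ⧸ annL R} (h : ∀ β, fR R α β = fR R α' β) : α = α' := by
  obtain ⟨r, rfl⟩ := mkL_surjective α
  obtain ⟨r', rfl⟩ := mkL_surjective α'
  exact mkL_eq_iff.2 fun s => congrArg Subtype.val (h (mkR R s))

theorem fR_right_ext {β β' : R ⧸ annR R} (h : ∀ α, fR R α β = fR R α β') : β = β' := by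
  obtain ⟨r, rfl⟩ := mkR_surjective β
  obtain ⟨r', rfl⟩ := mkR_surjective β'
  exact mkR_eq_iff.2 fun s => congrArg Subtype.val (h (mkL R s))

/-- As `f_R` is non-degenerate, symmetric pairs commute as soon as their first components do. -/
theorem commute_of_fst {φ ψ : AddMonoid.End (R ⧸ annL R) × AddMonoid.End (R ⧸ annR R)}
    (hφ : φ ∈ Sym (fR R)) (hψ : ψ ∈ Sym (fR R)) (h : φ.1 * ψ.1 = ψ.1 * φ.1) : φ * ψ = ψ * φ := by
  refine Prod.ext h (AddMonoidHom.ext fun β => fR_right_ext fun α => ?_)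
  change fR R α (φ.2 (ψ.2 β)) = fR R α (ψ.2 (φ.2 β))
  rw [← hφ, ← hψ, ← hψ, ← hφ]
  exact congrArg (fun χ : AddMonoid.End (R ⧸ annL R) => fR R (χ α) β) h.symm

end Nondegenerate

section Rep

variable {R : Type u} [NonUnitalNonAssocRing R] (C : AlgCode) (a : Fin C.1 → R)

/-- The matrices number `0` and `1` stored in `x` represent the components of the pair `φ` of
endomorphisms. -/
structure Rep (φ : AddMonoid.End (R ⧸ annL R) × AddMonoid.End (R ⧸ annR R)) (x : ℕ → ℤ) : Prop where
  fst : ∀ i < C.1, φ.1 (mkL R (val C a (delta i))) = mkL R (val C a (app C.1 0 x (delta i)))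
  snd : ∀ i < C.1, φ.2 (mkR R (val C a (delta i))) = mkR R (val C a (app C.1 1 x (delta i)))

variable {C a} {φ φ' : AddMonoid.End (R ⧸ annL R) × AddMonoid.End (R ⧸ annR R)} {x : ℕ → ℤ}

theorem Rep.fst_apply (h : Rep C a φ x) (w : ℕ → ℤ) :
    φ.1 (mkL R (val C a w)) = mkL R (val C a (app C.1 0 x w)) := by
  rw [val_app, val_eq_sum_delta, Finset.sum_range]
  simp only [map_sum, map_zsmul]
  exact Finset.sum_congr rfl fun i _ => by rw [h.fst i i.2]

theorem Rep.snd_apply (h : Rep C a φ x) (w : ℕ → ℤ) :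
    φ.2 (mkR R (val C a w)) = mkR R (val C a (app C.1 1 x w)) := by
  rw [val_app, val_eq_sum_delta, Finset.sum_range]
  simp only [map_sum, map_zsmul]
  exact Finset.sum_congr rfl fun i _ => by rw [h.snd i i.2]

theorem exists_stored (X : ℕ → ℕ → ℕ → ℤ) :
    ∃ x : ℕ → ℤ, ∀ k i c, x (Nat.pair k (Nat.pair i c)) = X k i c :=
  ⟨fun m => X m.unpair.1 m.unpair.2.unpair.1 m.unpair.2.unpair.2, fun k i c => by simp⟩

theorem sym_bilinear (H : ∀ i < C.1, ∀ j < C.1, val C a (app C.1 0 x (delta i)) * val C a (delta j) =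
    val C a (delta i) * val C a (app C.1 1 x (delta j))) (w v : ℕ → ℤ) :
    val C a (app C.1 0 x w) * val C a v = val C a w * val C a (app C.1 1 x v) := by
  rw [val_app, val_app, val_eq_sum_delta w, val_eq_sum_delta v, Finset.sum_range, Finset.sum_range,
    Finset.sum_mul_sum, Finset.sum_mul_sum]
  refine Finset.sum_congr rfl fun i _ => Finset.sum_congr rfl fun j _ => ?_
  rw [smul_mul_smul_comm, smul_mul_smul_comm, H i i.2 j j.2]

variable (h : C.Presents R a)
include h

theorem val_mkL_ext {f g : (R ⧸ annL R) →+ R ⧸ annL R}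
    (hfg : ∀ i < C.1, f (mkL R (val C a (delta i))) = g (mkL R (val C a (delta i)))) : f = g := by
  refine AddMonoidHom.ext fun α => ?_
  obtain ⟨r, rfl⟩ := mkL_surjective α
  obtain ⟨w, rfl⟩ := val_surjective h r
  rw [val_eq_sum_delta]
  simp only [map_sum, map_zsmul]
  exact Finset.sum_congr rfl fun i hi => by rw [hfg i (Finset.mem_range.1 hi)]

theorem val_mkR_ext {f g : (R ⧸ annR R) →+ R ⧸ annR R}
    (hfg : ∀ i < C.1, f (mkR R (val C a (delta i))) = g (mkR R (val C a (delta i)))) : f = g := by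
  refine AddMonoidHom.ext fun α => ?_
  obtain ⟨r, rfl⟩ := mkR_surjective α
  obtain ⟨w, rfl⟩ := val_surjective h r
  rw [val_eq_sum_delta]
  simp only [map_sum, map_zsmul]
  exact Finset.sum_congr rfl fun i hi => by rw [hfg i (Finset.mem_range.1 hi)]

theorem Rep.unique (hx : Rep C a φ x) (hx' : Rep C a φ' x) : φ = φ' :=
  Prod.ext (val_mkL_ext h fun i hi => (hx.fst i hi).trans (hx'.fst i hi).symm)
    (val_mkR_ext h fun i hi => (hx.snd i hi).trans (hx'.snd i hi).symm)

/-- Every pair of endomorphisms is represented by matrices; the matrix number `2` is free. -/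
theorem exists_rep (φ : AddMonoid.End (R ⧸ annL R) × AddMonoid.End (R ⧸ annR R)) (Z : ℕ → ℕ → ℤ) :
    ∃ x, Rep C a φ x ∧ ∀ i c, x (Nat.pair 2 (Nat.pair i c)) = Z i c := by
  have h1 : ∀ i, ∃ w, mkL R (val C a w) = φ.1 (mkL R (val C a (delta i))) := fun i => by
    obtain ⟨r, hr⟩ := mkL_surjective (φ.1 (mkL R (val C a (delta i))))
    obtain ⟨w, rfl⟩ := val_surjective h r
    exact ⟨w, hr⟩
  have h2 : ∀ i, ∃ w, mkR R (val C a w) = φ.2 (mkR R (val C a (delta i))) := fun i => by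
    obtain ⟨r, hr⟩ := mkR_surjective (φ.2 (mkR R (val C a (delta i))))
    obtain ⟨w, rfl⟩ := val_surjective h r
    exact ⟨w, hr⟩
  choose X hX using h1
  choose Y hY using h2
  obtain ⟨x, hx⟩ := exists_stored fun k => if k = 0 then X else if k = 1 then Y else Z
  refine ⟨x, ⟨fun i hi => ?_, fun i hi => ?_⟩, fun i c => by simp [hx]⟩
  · rw [← hX]
    exact congrArg _ (val_congr fun c _ => by rw [app_delta hi, hx]; rfl)
  · rw [← hY]
    exact congrArg _ (val_congr fun c _ => by rw [app_delta hi, hx]; rfl)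

theorem Rep.mem_sym_iff (hx : Rep C a φ x) : φ ∈ Sym (fR R) ↔ ∀ w v,
    val C a (app C.1 0 x w) * val C a v = val C a w * val C a (app C.1 1 x v) := by
  constructor
  · intro hφ w v
    have := congrArg Subtype.val (hφ (mkL R (val C a w)) (mkR R (val C a v)))
    rw [hx.fst_apply, hx.snd_apply] at this
    exact this
  · intro H α β
    obtain ⟨r, rfl⟩ := mkL_surjective α
    obtain ⟨w, rfl⟩ := val_surjective h r
    obtain ⟨s, rfl⟩ := mkR_surjective β
    obtain ⟨v, rfl⟩ := val_surjective h s
    rw [hx.fst_apply, hx.snd_apply]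
    exact Subtype.ext (H w v)

/-- Matrices that satisfy the symmetry condition on the generators represent a pair of
endomorphisms: they respect the annihilators because `f_R` is non-degenerate. -/
theorem exists_sym_of_bilinear (H : ∀ w v,
    val C a (app C.1 0 x w) * val C a v = val C a w * val C a (app C.1 1 x v)) :
    ∃ φ ∈ Sym (fR R), Rep C a φ x := by
  have hadd : ∀ k w v, app C.1 k x (w + v) = app C.1 k x w + app C.1 k x v := by
    intro k w v
    funext c
    simp [app, add_mul, Finset.sum_add_distrib]
  let g₁ : (ℕ → ℤ) →+ R ⧸ annL R := AddMonoidHom.mk' (fun w => mkL R (val C a (app C.1 0 x w)))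
    fun w v => by rw [hadd, map_add, map_add]
  let g₂ : (ℕ → ℤ) →+ R ⧸ annR R := AddMonoidHom.mk' (fun w => mkR R (val C a (app C.1 1 x w)))
    fun w v => by rw [hadd, map_add, map_add]
  have s₁ : Function.Surjective ((mkL R).comp (val C a)) := mkL_surjective.comp (val_surjective h)
  have s₂ : Function.Surjective ((mkR R).comp (val C a)) := mkR_surjective.comp (val_surjective h)
  -- `val w ∈ Ann_λ(R)` implies `val (app C.1 0 x w) ∈ Ann_λ(R)`, by the symmetry condition
  have k₁ : ((mkL R).comp (val C a)).ker ≤ g₁.ker := by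
    intro w hw
    have hw' := mkL_eq_zero.1 hw
    refine mkL_eq_zero.2 fun s => ?_
    obtain ⟨v, rfl⟩ := val_surjective h s
    rw [H, hw']
  have k₂ : ((mkR R).comp (val C a)).ker ≤ g₂.ker := by
    intro w hw
    have hw' := mkR_eq_zero.1 hw
    refine mkR_eq_zero.2 fun s => ?_
    obtain ⟨v, rfl⟩ := val_surjective h s
    rw [← H, hw']
  have hx : Rep C a (AddMonoidHom.liftOfSurjective _ s₁ ⟨g₁, k₁⟩,
      AddMonoidHom.liftOfSurjective _ s₂ ⟨g₂, k₂⟩) x :=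
    ⟨fun i _ => AddMonoidHom.liftOfRightInverse_comp_apply _ _ _ ⟨g₁, k₁⟩ (delta i),
      fun i _ => AddMonoidHom.liftOfRightInverse_comp_apply _ _ _ ⟨g₂, k₂⟩ (delta i)⟩
  exact ⟨_, (hx.mem_sym_iff h).2 H, hx⟩

end Rep

end ZAlg

/-! ### The linear conditions that define the maximal ring of scalars -/

namespace ZAlg

open Finset

/-- A bound for the positions at which three `n × n` matrices are stored. -/
def storeBound (n : ℕ) : ℕ := Nat.pair 3 (Nat.pair n n) + 1

/-- The condition for the pair of matrices stored in `x` to be symmetric on the pair of generators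
with number `e`. -/
def symForm (C : AlgCode) (e : ℕ) (x : ℕ → ℤ) (c : ℕ) : ℤ :=
  C.vmul (app C.1 0 x (delta e.unpair.1)) (delta e.unpair.2) c -
    C.vmul (delta e.unpair.1) (app C.1 1 x (delta e.unpair.2)) c

/-- The rows of `G` generate the pairs of matrices that represent elements of `Sym(f_R)`. -/
def IsSymGen (C : AlgCode) (G : List (List ℤ)) : Prop :=
  GenKer C.1 C.2.1 (storeBound C.1) (Nat.pair C.1 C.1 + 1)
    (fun e u c => symForm C e (delta u) c) G

/-- The combination of the products `a_i a_j` with the coefficients in `x`.  It is a single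
condition; the ignored argument is the number of the condition. -/
def relForm (C : AlgCode) (_ : ℕ) (x : ℕ → ℤ) (c : ℕ) : ℤ :=
  ∑ i ∈ range C.1, ∑ j ∈ range C.1, x (Nat.pair i j) * C.vmul (delta i) (delta j) c

/-- The rows of `G` generate the linear relations between the products `a_i a_j`. -/
def IsRelGen (C : AlgCode) (G : List (List ℤ)) : Prop :=
  GenKer C.1 C.2.1 (Nat.pair C.1 C.1 + 1) 1 (fun e u c => relForm C e (delta u) c) G

/-- The conditions for the matrices stored in `x` to represent an element of `𝔖(R)`, given
generators `Gs` of the symmetric pairs and `Gr` of the relations between products.  The tag `q`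
selects the condition: symmetry, centrality, action on `R²`, linearity of the two canonical maps
from `R²`, and stability of `η(R)`, witnessed by the third stored matrix.  An element of
`R⁺/Ann_λ(R)` or `R⁺/Ann_ρ(R)` is tested for being zero by multiplication with a generator. -/
def scalForm' (C : AlgCode) (Gs Gr : List (List ℤ)) (q s i j k : ℕ) (x : ℕ → ℤ) : ℕ → ℤ :=
  if q = 0 then symForm C (Nat.pair i j) x
  else if q = 1 then C.vmul (fun c => app C.1 0 x (app C.1 0 (ent₂ Gs s) (delta i)) c -
    app C.1 0 (ent₂ Gs s) (app C.1 0 x (delta i)) c) (delta j)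
  else if q = 2 then fun c => ∑ i ∈ range C.1, 1 * ∑ j ∈ range C.1,
    ent₂ Gr s (Nat.pair i j) * C.vmul (app C.1 0 x (delta i)) (delta j) c
  else if q = 3 then C.vmul (fun c => C.vmul (app C.1 0 x (delta i)) (delta j) c -
    app C.1 0 x (C.vmul (delta i) (delta j)) c) (delta k)
  else if q = 4 then C.vmul (delta k) (fun c => C.vmul (app C.1 0 x (delta i)) (delta j) c -
    app C.1 1 x (C.vmul (delta i) (delta j)) c)
  else if q = 5 then C.vmul (fun c => app C.1 0 x (delta i) c - app C.1 2 x (delta i) c) (delta j)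
  else C.vmul (delta j) (fun c => app C.1 1 x (delta i) c - app C.1 2 x (delta i) c)

/-- The conditions for `𝔖(R)`, numbered by natural numbers. -/
def scalForm (C : AlgCode) (Gs Gr : List (List ℤ)) (e : ℕ) : (ℕ → ℤ) → ℕ → ℤ :=
  scalForm' C Gs Gr e.unpair.1 e.unpair.2.unpair.1 e.unpair.2.unpair.2.unpair.1
    e.unpair.2.unpair.2.unpair.2.unpair.1 e.unpair.2.unpair.2.unpair.2.unpair.2

/-- A bound for the numbers of the relevant conditions. -/
def scalBound (C : AlgCode) (Gs Gr : List (List ℤ)) : ℕ :=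
  Nat.pair 6 (Nat.pair (Gs.length + Gr.length) (Nat.pair C.1 (Nat.pair C.1 C.1))) + 1

/-- The rows of `G` generate the triples of matrices that represent elements of `𝔖(R)`. -/
def IsScalGen (C : AlgCode) (Gs Gr G : List (List ℤ)) : Prop :=
  GenKer C.1 C.2.1 (storeBound C.1) (scalBound C Gs Gr)
    (fun e u c => scalForm C Gs Gr e (delta u) c) G

section Semi

variable {α : Type*} [Primcodable α]

@[fun_prop]
theorem primrec_storeBound {f : α → ℕ} (hf : Primrec f) : Primrec fun a => storeBound (f a) := by
  unfold storeBound; fun_prop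

@[fun_prop]
theorem primrec_symForm {C : α → AlgCode} {e c : α → ℕ} {x : α → ℕ → ℤ} (hC : Primrec C)
    (he : Primrec e) (hx : Primrec fun p : α × ℕ => x p.1 p.2) (hc : Primrec c) :
    Primrec fun a => symForm (C a) (e a) (x a) (c a) := by
  unfold symForm; fun_prop

@[fun_prop]
theorem primrec_relForm {C : α → AlgCode} {e c : α → ℕ} {x : α → ℕ → ℤ} (hC : Primrec C)
    (hx : Primrec fun p : α × ℕ => x p.1 p.2) (hc : Primrec c) :
    Primrec fun a => relForm (C a) (e a) (x a) (c a) := by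
  unfold relForm; fun_prop

@[fun_prop]
theorem primrec_scalForm {C : α → AlgCode} {Gs Gr : α → List (List ℤ)} {e c : α → ℕ}
    {x : α → ℕ → ℤ} (hC : Primrec C) (hs : Primrec Gs) (hr : Primrec Gr)
    (he : Primrec e) (hx : Primrec fun p : α × ℕ => x p.1 p.2) (hc : Primrec c) :
    Primrec fun a => scalForm (C a) (Gs a) (Gr a) (e a) (x a) (c a) := by
  unfold scalForm scalForm'
  simp only [ite_apply]
  fun_prop

theorem semi_isSymGen {C : α → AlgCode} {G : α → List (List ℤ)} (hC : Primrec C) (hG : Primrec G) :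
    Semi fun a => IsSymGen (C a) (G a) := by
  unfold IsSymGen
  refine semi_genKer ?_ ?_ ?_ ?_ ?_ ?_ <;> fun_prop

theorem semi_isRelGen {C : α → AlgCode} {G : α → List (List ℤ)} (hC : Primrec C) (hG : Primrec G) :
    Semi fun a => IsRelGen (C a) (G a) := by
  unfold IsRelGen
  refine semi_genKer ?_ ?_ ?_ ?_ ?_ ?_ <;> fun_prop

theorem semi_isScalGen {C : α → AlgCode} {Gs Gr G : α → List (List ℤ)} (hC : Primrec C)
    (hs : Primrec Gs) (hr : Primrec Gr) (hG : Primrec G) :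
    Semi fun a => IsScalGen (C a) (Gs a) (Gr a) (G a) := by
  unfold IsScalGen scalBound
  refine semi_genKer ?_ ?_ ?_ ?_ ?_ ?_ <;> fun_prop

end Semi

theorem pair_le_pair {a b c d : ℕ} (h : a ≤ c) (h' : b ≤ d) : Nat.pair a b ≤ Nat.pair c d := by
  rcases h.eq_or_lt with rfl | h
  · rcases h'.eq_or_lt with rfl | h'
    · exact le_rfl
    · exact (Nat.pair_lt_pair_right _ h').le
  · rcases h'.eq_or_lt with rfl | h'
    · exact (Nat.pair_lt_pair_left _ h).le
    · exact ((Nat.pair_lt_pair_left _ h).trans (Nat.pair_lt_pair_right _ h')).le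

theorem lt_storeBound {n k i c : ℕ} (hk : k ≤ 3) (hi : i < n) (hc : c < n) :
    Nat.pair k (Nat.pair i c) < storeBound n :=
  Nat.lt_succ_of_le (pair_le_pair hk (pair_le_pair hi.le hc.le))

theorem isLin_app {n k : ℕ} (hk : k ≤ 3) (w : ℕ → ℤ) : IsLin n (storeBound n) fun x => app n k x w :=
  IsLin.app_self (fun _ hi _ hc => lt_storeBound hk hi hc) w

theorem isLin_symForm (C : AlgCode) (e : ℕ) : IsLin C.1 (storeBound C.1) (symForm C e) :=
  ((isLin_app (by simp) _).vmul_left _).sub ((isLin_app (by simp) _).vmul_right _)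

theorem isLin_relForm (C : AlgCode) (e : ℕ) : IsLin C.1 (Nat.pair C.1 C.1 + 1) (relForm C e) := by
  intro x c _
  simp only [relForm, Finset.mul_sum]
  refine Eq.trans (Finset.sum_congr rfl fun i hi => ?_) Finset.sum_comm
  refine Eq.trans (Finset.sum_congr rfl fun j hj => ?_) Finset.sum_comm
  rw [← sum_delta (Nat.lt_succ_of_le (pair_le_pair (Finset.mem_range.1 hi).le
    (Finset.mem_range.1 hj).le)) x, Finset.sum_mul]
  exact Finset.sum_congr rfl fun u _ => by ring

theorem isLin_scalForm (C : AlgCode) (Gs Gr : List (List ℤ)) (e : ℕ) :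
    IsLin C.1 (storeBound C.1) (scalForm C Gs Gr e) := by
  unfold scalForm
  generalize e.unpair.1 = q
  generalize e.unpair.2.unpair.1 = s
  generalize e.unpair.2.unpair.2.unpair.1 = i
  generalize e.unpair.2.unpair.2.unpair.2.unpair.1 = j
  generalize e.unpair.2.unpair.2.unpair.2.unpair.2 = k
  have h0 : ∀ w, IsLin C.1 (storeBound C.1) fun x => app C.1 0 x w := isLin_app (by simp)
  have h1 : ∀ w, IsLin C.1 (storeBound C.1) fun x => app C.1 1 x w := isLin_app (by simp)
  have h2 : ∀ w, IsLin C.1 (storeBound C.1) fun x => app C.1 2 x w := isLin_app (by simp)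
  unfold scalForm'
  split_ifs
  · exact isLin_symForm C _
  · exact ((h0 _).sub ((h0 _).app_const _ _)).vmul_left _
  · exact IsLin.sum fun i _ => IsLin.sum fun j _ => (h0 _).vmul_left _
  · exact (((h0 _).vmul_left _).sub (h0 _)).vmul_left _
  · exact (((h0 _).vmul_left _).sub (h1 _)).vmul_right _
  · exact ((h0 _).sub (h2 _)).vmul_left _
  · exact ((h1 _).sub (h2 _)).vmul_right _

end ZAlg

/-! ### Symmetric pairs of endomorphisms and their action on `R²` -/

namespace ZAlg

open Finset

section Rep

variable {R : Type u} [NonUnitalNonAssocRing R] {C : AlgCode} {a : Fin C.1 → R}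
variable {φ : AddMonoid.End (R ⧸ annL R) × AddMonoid.End (R ⧸ annR R)} {x : ℕ → ℤ}

theorem app_congr {n k : ℕ} (hk : k ≤ 3) {x x' : ℕ → ℤ} (hx : ∀ i < storeBound n, x i = x' i)
    (w : ℕ → ℤ) : ∀ c < n, app n k x w c = app n k x' w c := fun c hc =>
  Finset.sum_congr rfl fun i hi => by rw [hx _ (lt_storeBound hk (Finset.mem_range.1 hi) hc)]

theorem Rep.congr (hx : Rep C a φ x) {x' : ℕ → ℤ} (h : ∀ i < storeBound C.1, x i = x' i) :
    Rep C a φ x' :=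
  ⟨fun i hi => by rw [hx.fst i hi, val_congr (app_congr (by simp) h _)],
    fun i hi => by rw [hx.snd i hi, val_congr (app_congr (by simp) h _)]⟩

theorem Rep.sum {m : ℕ} {ψ : ℕ → AddMonoid.End (R ⧸ annL R) × AddMonoid.End (R ⧸ annR R)}
    {g : ℕ → ℕ → ℤ} (h : ∀ s < m, Rep C a (ψ s) (g s)) (y : ℕ → ℤ) :
    Rep C a (∑ s ∈ range m, y s • ψ s) fun i => ∑ s ∈ range m, y s * g s i := by
  have hval : ∀ k w, val C a (app C.1 k (fun i => ∑ s ∈ range m, y s * g s i) w) =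
      ∑ s ∈ range m, y s • val C a (app C.1 k (g s) w) := by
    intro k w
    rw [← val_sum]
    congr 1
    funext c
    simp only [app, Finset.mul_sum]
    rw [Finset.sum_comm]
    exact Finset.sum_congr rfl fun s _ => Finset.sum_congr rfl fun i _ => by ring
  constructor
  · intro i hi
    let ev : (AddMonoid.End (R ⧸ annL R) × AddMonoid.End (R ⧸ annR R)) →+ R ⧸ annL R :=
      AddMonoidHom.mk' (fun χ => χ.1 (mkL R (val C a (delta i)))) fun _ _ => rfl
    change ev _ = _
    rw [hval, map_sum, map_sum]
    refine Finset.sum_congr rfl fun s hs => ?_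
    rw [map_zsmul, map_zsmul, ← (h s (Finset.mem_range.1 hs)).fst i hi]
    rfl
  · intro i hi
    let ev : (AddMonoid.End (R ⧸ annL R) × AddMonoid.End (R ⧸ annR R)) →+ R ⧸ annR R :=
      AddMonoidHom.mk' (fun χ => χ.2 (mkR R (val C a (delta i)))) fun _ _ => rfl
    change ev _ = _
    rw [hval, map_sum, map_sum]
    refine Finset.sum_congr rfl fun s hs => ?_
    rw [map_zsmul, map_zsmul, ← (h s (Finset.mem_range.1 hs)).snd i hi]
    rfl

variable (h : C.Presents R a)
include h

theorem Rep.eq_sum (hx : Rep C a φ x) {m : ℕ}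
    {ψ : ℕ → AddMonoid.End (R ⧸ annL R) × AddMonoid.End (R ⧸ annR R)}
    {g : ℕ → ℕ → ℤ} (hψ : ∀ s < m, Rep C a (ψ s) (g s)) {y : ℕ → ℤ}
    (hy : ∀ i < storeBound C.1, x i = ∑ s ∈ range m, y s * g s i) :
    φ = ∑ s ∈ range m, y s • ψ s :=
  (hx.congr hy).unique h (Rep.sum hψ y)

/-! #### Symmetric pairs -/

theorem latMem_symForm {e : ℕ} : LatMem C.1 C.2.1 (symForm C e x) ↔
    val C a (app C.1 0 x (delta e.unpair.1)) * val C a (delta e.unpair.2) =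
      val C a (delta e.unpair.1) * val C a (app C.1 1 x (delta e.unpair.2)) := by
  rw [latMem_iff_val h, ← val_vmul h, ← val_vmul h,
    ← sub_eq_zero (a := val C a (C.vmul _ _)), ← val_sub]
  rfl

theorem symForm_iff : (∀ e < Nat.pair C.1 C.1 + 1, LatMem C.1 C.2.1 (symForm C e x)) ↔
    ∀ w v, val C a (app C.1 0 x w) * val C a v = val C a w * val C a (app C.1 1 x v) := by
  constructor
  · intro H
    refine sym_bilinear fun i hi j hj => ?_
    have := (latMem_symForm h).1 (H (Nat.pair i j) (Nat.lt_succ_of_le (pair_le_pair hi.le hj.le)))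
    simpa using this
  · exact fun H e _ => (latMem_symForm h).2 (H _ _)

omit h in
theorem sum_delta_rows (G : List (List ℤ)) (s i : ℕ) :
    ent₂ G s i = ∑ j ∈ range G.length, delta s j * ent₂ G j i := by
  by_cases hs : s < G.length
  · rw [Finset.sum_eq_single s (fun j _ hj => by simp [delta, hj.symm])
      (fun h => absurd (Finset.mem_range.2 hs) h)]
    simp [delta]
  · rw [Finset.sum_eq_zero fun j hj => by
      rw [delta, if_neg (by rintro rfl; exact hs (Finset.mem_range.1 hj)), zero_mul]]
    simp [List.getElem?_eq_none (Nat.le_of_not_lt hs)]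

theorem IsSymGen.exists_rep {Gs : List (List ℤ)} (hs : IsSymGen C Gs) (s : ℕ) :
    ∃ ψ ∈ Sym (fR R), Rep C a ψ (ent₂ Gs s) := by
  refine exists_sym_of_bilinear h ((symForm_iff h).1 ?_)
  exact (hs.mem_iff_of_isLin (fun e _ => isLin_symForm C e) _).2
    ⟨delta s, fun i _ => sum_delta_rows Gs s i⟩

/-- A scalar that commutes with generators of the symmetric pairs is central. -/
theorem IsSymGen.commute {Gs : List (List ℤ)} (hs : IsSymGen C Gs) (hφ : φ ∈ Sym (fR R))
    (H : ∀ s < Gs.length, ∀ ψ ∈ Sym (fR R), Rep C a ψ (ent₂ Gs s) → φ.1 * ψ.1 = ψ.1 * φ.1) :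
    φ ∈ CenSym (fR R) := by
  refine ⟨hφ, fun χ hχ => commute_of_fst hφ hχ ?_⟩
  obtain ⟨x, hx, -⟩ := ZAlg.exists_rep h χ fun _ _ => 0
  obtain ⟨y, hy⟩ := (hs.mem_iff_of_isLin (fun e _ => isLin_symForm C e) x).1
    ((symForm_iff h).2 ((hx.mem_sym_iff h).1 hχ))
  choose ψ hψ using hs.exists_rep h
  rw [hx.eq_sum h (fun s _ => (hψ s).2) hy, Prod.fst_sum, Finset.mul_sum, Finset.sum_mul]
  refine Finset.sum_congr rfl fun s hs => ?_
  have hs := Finset.mem_range.1 hs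
  have e1 : φ.1 * (y s • ψ s).1 = y s • (φ.1 * (ψ s).1) :=
    map_zsmul (AddMonoidHom.mulLeft φ.1) _ _
  have e2 : (y s • ψ s).1 * φ.1 = y s • ((ψ s).1 * φ.1) :=
    map_zsmul (AddMonoidHom.mulRight φ.1) _ _
  rw [e1, e2, H s hs _ (hψ s).1 (hψ s).2]

/-! #### The action on `R²` -/

omit h in
/-- The value of `φ₁` at a combination `∑ K_{ij} a_i a_j` of products, when `g i` represents the
value of `φ₁` at the `i`-th generator. -/
def prodSum (C : AlgCode) (a : Fin C.1 → R) (K : ℕ → ℤ) (g : ℕ → R) : R :=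
  ∑ i ∈ range C.1, ∑ j ∈ range C.1, K (Nat.pair i j) • (g i * val C a (delta j))

/-- The coefficients `K` are independent of the endomorphism `f`, so that the sums with `f = 1` and
`f = φ₁` that occur in `ActsOnTarget` can be compared. -/
theorem exists_prodSum (l : List ((R ⧸ annL R) × (R ⧸ annR R))) :
    ∃ K : ℕ → ℤ, ∀ (f : AddMonoid.End (R ⧸ annL R)) (g : ℕ → R),
      (∀ i < C.1, f (mkL R (val C a (delta i))) = mkL R (g i)) →
      ((l.map fun p => fR R (f p.1) p.2).sum : R) = prodSum C a K g := by
  induction l with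
  | nil => exact ⟨0, fun f g _ => by simp [prodSum]⟩
  | cons p l ih =>
    obtain ⟨K, hK⟩ := ih
    obtain ⟨r, hr⟩ := mkL_surjective p.1
    obtain ⟨w, rfl⟩ := val_surjective h r
    obtain ⟨s, hs⟩ := mkR_surjective p.2
    obtain ⟨v, rfl⟩ := val_surjective h s
    refine ⟨fun m => w m.unpair.1 * v m.unpair.2 + K m, fun f g hg => ?_⟩
    have h1 : f p.1 = mkL R (∑ i ∈ range C.1, w i • g i) := by
      rw [← hr, val_eq_sum_delta]
      simp only [map_sum, map_zsmul]
      exact Finset.sum_congr rfl fun i hi => by rw [hg i (Finset.mem_range.1 hi)]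
    rw [List.map_cons, List.sum_cons, AddSubgroup.coe_add, hK f g hg, h1, ← hs, fR_mk,
      val_eq_sum_delta v, Finset.sum_mul_sum]
    simp only [prodSum, Nat.unpair_pair, add_smul, Finset.sum_add_distrib, smul_mul_smul_comm]

theorem relForm_iff {K : ℕ → ℤ} : (∀ e < 1, LatMem C.1 C.2.1 (relForm C e K)) ↔
    prodSum C a K (fun i => val C a (delta i)) = 0 := by
  have : ∀ e, LatMem C.1 C.2.1 (relForm C e K) ↔
      prodSum C a K (fun i => val C a (delta i)) = 0 := by
    intro e
    rw [latMem_iff_val h]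
    have h1 : relForm C e K = fun c => ∑ i ∈ range C.1, 1 * (fun i c => ∑ j ∈ range C.1,
        K (Nat.pair i j) * C.vmul (delta i) (delta j) c) i c := by
      funext c; simp [relForm]
    rw [h1, val_sum]
    simp only [val_sum, one_smul, val_vmul h, prodSum]
  exact ⟨fun H => (this 0).1 (H 0 one_pos), fun H e _ => (this e).2 H⟩

theorem actsOnTarget_of_prodSum {g : ℕ → R}
    (hg : ∀ i < C.1, φ.1 (mkL R (val C a (delta i))) = mkL R (g i))
    (H : ∀ K, prodSum C a K (fun i => val C a (delta i)) = 0 → prodSum C a K g = 0) :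
    ActsOnTarget (fR R) φ := by
  have key : ∀ l : List ((R ⧸ annL R) × (R ⧸ annR R)), (l.map fun p => fR R p.1 p.2).sum = 0 →
      (l.map fun p => fR R (φ.1 p.1) p.2).sum = 0 := by
    intro l hl
    obtain ⟨K, hK⟩ := exists_prodSum h l
    refine Subtype.ext ((hK φ.1 g hg).trans (H K ?_))
    rw [← hK (AddMonoidHom.id _) _ fun _ _ => rfl]
    exact congrArg Subtype.val hl
  have hneg : ∀ (f : AddMonoid.End (R ⧸ annL R)) (l : List ((R ⧸ annL R) × (R ⧸ annR R))),
      ((l.map fun p => (-p.1, p.2)).map fun p => fR R (f p.1) p.2).sum =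
        -(l.map fun p => fR R (f p.1) p.2).sum := by
    intro f l
    induction l with
    | nil => simp
    | cons p l ih =>
      simp only [List.map_cons, List.sum_cons, neg_add, map_neg, AddMonoidHom.neg_apply, ← ih]
  intro l l' hl
  have h1 := key (l ++ l'.map fun p => (-p.1, p.2)) (by
    rw [List.map_append, List.sum_append]
    refine (congrArg _ (hneg (AddMonoidHom.id _) l')).trans ?_
    exact (congrArg (· + -_) hl).trans (add_neg_cancel _))
  rw [List.map_append, List.sum_append, hneg] at h1
  exact add_neg_eq_zero.1 h1

omit h in
theorem prodSum_of_actsOnTarget {g : ℕ → R}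
    (hg : ∀ i < C.1, φ.1 (mkL R (val C a (delta i))) = mkL R (g i)) (hφ : ActsOnTarget (fR R) φ)
    {K : ℕ → ℤ} (hK : prodSum C a K (fun i => val C a (delta i)) = 0) : prodSum C a K g = 0 := by
  let l : List ((R ⧸ annL R) × (R ⧸ annR R)) := (range C.1 ×ˢ range C.1).toList.map fun p =>
    (K (Nat.pair p.1 p.2) • mkL R (val C a (delta p.1)), mkR R (val C a (delta p.2)))
  have hl : ∀ (f : AddMonoid.End (R ⧸ annL R)) (g : ℕ → R),
      (∀ i < C.1, f (mkL R (val C a (delta i))) = mkL R (g i)) →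
      (l.map fun p => fR R (f p.1) p.2).sum.1 = prodSum C a K g := by
    intro f g hg
    rw [List.map_map, Finset.sum_map_toList, Finset.sum_product, prodSum]
    simp only [AddSubgroup.val_finsetSum]
    refine Finset.sum_congr rfl fun i hi => Finset.sum_congr rfl fun j _ => ?_
    simp only [Function.comp_apply, map_zsmul, hg i (Finset.mem_range.1 hi)]
    rfl
  have h1 := hφ l [] (Subtype.ext ((hl (AddMonoidHom.id _) _ fun _ _ => rfl).trans hK))
  rw [← hl φ.1 g hg]
  exact congrArg Subtype.val h1

end Rep

end ZAlg

/-! ### The solutions of the linear conditions are the scalars -/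

namespace ZAlg

open Finset

section Rep

variable {R : Type u} [NonUnitalNonAssocRing R] {C : AlgCode} {a : Fin C.1 → R}
variable {φ : AddMonoid.End (R ⧸ annL R) × AddMonoid.End (R ⧸ annR R)} {x : ℕ → ℤ}

theorem mkL_app_congr {x y : ℕ → ℤ} {k l : ℕ}
    (H : ∀ i < C.1, mkL R (val C a (app C.1 k x (delta i))) =
      mkL R (val C a (app C.1 l y (delta i)))) (w : ℕ → ℤ) :
    mkL R (val C a (app C.1 k x w)) = mkL R (val C a (app C.1 l y w)) := by
  rw [val_app k, val_app l]
  simp only [map_sum, map_zsmul]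
  exact Finset.sum_congr rfl fun i _ => by rw [H i i.2]

theorem mkR_app_congr {x y : ℕ → ℤ} {k l : ℕ}
    (H : ∀ i < C.1, mkR R (val C a (app C.1 k x (delta i))) =
      mkR R (val C a (app C.1 l y (delta i)))) (w : ℕ → ℤ) :
    mkR R (val C a (app C.1 k x w)) = mkR R (val C a (app C.1 l y w)) := by
  rw [val_app k, val_app l]
  simp only [map_sum, map_zsmul]
  exact Finset.sum_congr rfl fun i _ => by rw [H i i.2]

/-- An identity between expressions in `φ₁(r) s` and in `r s` holds if it holds for the generators.
-/
theorem biadditive_ext {A : Type*} [AddCommGroup A] (x : ℕ → ℤ) (F G : R →+ A)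
    (H : ∀ i < C.1, ∀ j < C.1, F (val C a (app C.1 0 x (delta i)) * val C a (delta j)) =
      G (val C a (delta i) * val C a (delta j))) (w v : ℕ → ℤ) :
    F (val C a (app C.1 0 x w) * val C a v) = G (val C a w * val C a v) := by
  rw [val_app, val_eq_sum_delta w, val_eq_sum_delta v, Finset.sum_range, Finset.sum_range,
    Finset.sum_mul_sum, Finset.sum_mul_sum]
  simp only [smul_mul_smul_comm, map_sum, map_zsmul]
  exact Finset.sum_congr rfl fun i _ => Finset.sum_congr rfl fun j _ => by rw [H i i.2 j j.2]

variable (h : C.Presents R a)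
include h

theorem mkL_val_eq_iff {r r' : R} :
    mkL R r = mkL R r' ↔ ∀ k < C.1, (r - r') * val C a (delta k) = 0 := by
  rw [← sub_eq_zero, ← map_sub, mkL_eq_zero, val_mul_eq_zero_iff h]

theorem mkR_val_eq_iff {r r' : R} :
    mkR R r = mkR R r' ↔ ∀ k < C.1, val C a (delta k) * (r - r') = 0 := by
  rw [← sub_eq_zero, ← map_sub, mkR_eq_zero, mul_val_eq_zero_iff h]

/-- Every solution of the linear conditions represents an element of `𝔖(R)`. -/
theorem mem_algScalars_of_scalForm {Gs Gr : List (List ℤ)} (hs : IsSymGen C Gs)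
    (hr : IsRelGen C Gr) (H : ∀ e < scalBound C Gs Gr, LatMem C.1 C.2.1 (scalForm C Gs Gr e x)) :
    ∃ φ ∈ algScalars R, Rep C a φ x := by
  have H' : ∀ q s i j k, q ≤ 6 → s ≤ Gs.length + Gr.length → i < C.1 → j < C.1 → k ≤ C.1 →
      val C a (scalForm' C Gs Gr q s i j k x) = 0 := by
    intro q s i j k hq hsl hi hj hk
    have := H (Nat.pair q (Nat.pair s (Nat.pair i (Nat.pair j k)))) (Nat.lt_succ_of_le
      (pair_le_pair hq (pair_le_pair hsl (pair_le_pair hi.le (pair_le_pair hj.le hk)))))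
    rw [latMem_iff_val h] at this
    simpa [scalForm] using this
  obtain ⟨φ, hφ, hx⟩ := exists_sym_of_bilinear h (x := x) (sym_bilinear fun i hi j hj => by
    have := H' 0 0 i j 0 (by simp) (by simp) hi hj (by simp)
    simpa using (latMem_symForm h).1 ((latMem_iff_val h).2 this))
  refine ⟨φ, ⟨⟨hs.commute h hφ fun s hsl ψ _ hψx => ?_, ?_⟩, ?_, ?_, ?_⟩, hx⟩
  · refine val_mkL_ext h fun i hi => ?_
    change φ.1 (ψ.1 _) = ψ.1 (φ.1 _)
    rw [hψx.fst_apply, hx.fst_apply, hx.fst_apply, hψx.fst_apply, mkL_val_eq_iff h]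
    intro j hj
    have := H' 1 s i j 0 (by simp) (by omega) hi hj (by simp)
    simp only [scalForm', one_ne_zero, if_true, if_false] at this
    rwa [val_vmul h, val_sub] at this
  · refine actsOnTarget_of_prodSum h hx.fst fun K hK => ?_
    obtain ⟨y, hy⟩ := (hr.mem_iff_of_isLin (fun e _ => isLin_relForm C e) K).1
      ((relForm_iff h).2 hK)
    have h1 : ∀ s < Gr.length,
        prodSum C a (ent₂ Gr s) (fun i => val C a (app C.1 0 x (delta i))) = 0 := by
      intro s hsl
      by_cases hn : 0 < C.1
      · have := H' 2 s 0 0 0 (by simp) (by omega) hn hn (by simp)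
        simp only [scalForm', OfNat.ofNat_ne_zero, OfNat.ofNat_ne_one, if_true, if_false] at this
        rw [val_sum] at this
        simpa only [val_sum, one_smul, val_vmul h, prodSum] using this
      · rw [prodSum, Nat.eq_zero_of_not_pos hn]; rfl
    have h2 : prodSum C a K (fun i => val C a (app C.1 0 x (delta i))) =
        ∑ s ∈ range Gr.length, y s •
          prodSum C a (ent₂ Gr s) (fun i => val C a (app C.1 0 x (delta i))) := by
      simp only [prodSum, Finset.smul_sum]
      refine Eq.trans (Finset.sum_congr rfl fun i hi => ?_) Finset.sum_comm
      refine Eq.trans (Finset.sum_congr rfl fun j hj => ?_) Finset.sum_comm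
      rw [hy _ (Nat.lt_succ_of_le (pair_le_pair (Finset.mem_range.1 hi).le
        (Finset.mem_range.1 hj).le)), Finset.sum_smul]
      exact Finset.sum_congr rfl fun s _ => by rw [mul_smul]
    rw [h2]
    exact Finset.sum_eq_zero fun s hsl => by rw [h1 s (Finset.mem_range.1 hsl), smul_zero]
  · intro α β
    obtain ⟨r, rfl⟩ := mkL_surjective α
    obtain ⟨w, rfl⟩ := val_surjective h r
    obtain ⟨r, rfl⟩ := mkR_surjective β
    obtain ⟨v, rfl⟩ := val_surjective h r
    rw [hx.fst_apply]
    refine biadditive_ext x (mkL R) (φ.1.comp (mkL R)) (fun i hi j hj => ?_) w v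
    change _ = φ.1 (mkL R _)
    rw [← val_vmul h, ← val_vmul h, hx.fst_apply, mkL_val_eq_iff h]
    intro k hk
    have := H' 3 0 i j k (by simp) (by simp) hi hj hk.le
    simp only [scalForm', OfNat.ofNat_ne_zero, OfNat.ofNat_ne_one, Nat.reduceEqDiff, if_true,
      if_false] at this
    rwa [val_vmul h, val_sub] at this
  · intro α β
    obtain ⟨r, rfl⟩ := mkL_surjective α
    obtain ⟨w, rfl⟩ := val_surjective h r
    obtain ⟨r, rfl⟩ := mkR_surjective β
    obtain ⟨v, rfl⟩ := val_surjective h r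
    rw [hx.fst_apply]
    refine biadditive_ext x (mkR R) (φ.2.comp (mkR R)) (fun i hi j hj => ?_) w v
    change _ = φ.2 (mkR R _)
    rw [← val_vmul h, ← val_vmul h, hx.snd_apply, mkR_val_eq_iff h]
    intro k hk
    have := H' 4 0 i j k (by simp) (by simp) hi hj hk.le
    simp only [scalForm', OfNat.ofNat_ne_zero, OfNat.ofNat_ne_one, Nat.reduceEqDiff, if_true,
      if_false] at this
    rwa [val_vmul h, val_sub] at this
  · intro r
    obtain ⟨w, rfl⟩ := val_surjective h r
    refine ⟨val C a (app C.1 2 x w), Prod.ext ((hx.fst_apply w).trans ?_)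
      ((hx.snd_apply w).trans ?_)⟩
    · refine mkL_app_congr (fun i hi => (mkL_val_eq_iff h).2 fun j hj => ?_) w
      have := H' 5 0 i j 0 (by simp) (by simp) hi hj (by simp)
      simp only [scalForm', OfNat.ofNat_ne_zero, OfNat.ofNat_ne_one, Nat.reduceEqDiff, if_true,
        if_false] at this
      rwa [val_vmul h, val_sub] at this
    · refine mkR_app_congr (fun i hi => (mkR_val_eq_iff h).2 fun j hj => ?_) w
      have := H' 6 0 i j 0 (by simp) (by simp) hi hj (by simp)
      simp only [scalForm', OfNat.ofNat_ne_zero, OfNat.ofNat_ne_one, Nat.reduceEqDiff,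
        if_false] at this
      rwa [val_vmul h, val_sub] at this

/-- Every element of `𝔖(R)` is represented by a solution; the third matrix is chosen such that it
describes the action on `η(R)`. -/
theorem exists_scalForm {Gs Gr : List (List ℤ)} (hs : IsSymGen C Gs)
    (hr : IsRelGen C Gr) (hφ : φ ∈ algScalars R) :
    ∃ x, Rep C a φ x ∧ ∀ e < scalBound C Gs Gr, LatMem C.1 C.2.1 (scalForm C Gs Gr e x) := by
  obtain ⟨⟨⟨hsym, hcen⟩, hact⟩, hL, hR, heta⟩ := hφ
  have hZ : ∀ i, ∃ z, (φ.1 (mkL R (val C a (delta i))), φ.2 (mkR R (val C a (delta i)))) =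
      eta R (val C a z) := fun i => by
    obtain ⟨r, hr⟩ := heta (val C a (delta i))
    obtain ⟨z, rfl⟩ := val_surjective h r
    exact ⟨z, hr⟩
  choose Z hZ using hZ
  obtain ⟨x, hx, hxZ⟩ := exists_rep h φ Z
  have hZL : ∀ i < C.1, φ.1 (mkL R (val C a (delta i))) =
      mkL R (val C a (app C.1 2 x (delta i))) := fun i hi =>
    (congrArg Prod.fst (hZ i)).trans (congrArg _ (val_congr fun c _ => by rw [app_delta hi, hxZ]))
  have hZR : ∀ i < C.1, φ.2 (mkR R (val C a (delta i))) =
      mkR R (val C a (app C.1 2 x (delta i))) := fun i hi =>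
    (congrArg Prod.snd (hZ i)).trans (congrArg _ (val_congr fun c _ => by rw [app_delta hi, hxZ]))
  refine ⟨x, hx, fun e _ => ?_⟩
  unfold scalForm
  generalize e.unpair.1 = q
  generalize e.unpair.2.unpair.1 = s
  generalize e.unpair.2.unpair.2.unpair.1 = i
  generalize e.unpair.2.unpair.2.unpair.2.unpair.1 = j
  generalize e.unpair.2.unpair.2.unpair.2.unpair.2 = k
  have happ0 : ∀ m y, ¬ i < C.1 → app C.1 m y (delta i) = 0 := fun m y hi => by
    funext c
    exact Finset.sum_eq_zero fun l hl => by
      rw [delta, if_neg (by rintro rfl; exact hi (Finset.mem_range.1 hl)), zero_mul]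
  unfold scalForm'
  split_ifs
  · exact (latMem_symForm h).2 ((hx.mem_sym_iff h).1 hsym _ _)
  · rw [latMem_iff_val h, val_vmul h, val_sub]
    obtain ⟨ψ, hψ, hψx⟩ := hs.exists_rep h s
    have h1 : mkL R (val C a (app C.1 0 x (app C.1 0 (ent₂ Gs s) (delta i)))) =
        mkL R (val C a (app C.1 0 (ent₂ Gs s) (app C.1 0 x (delta i)))) := by
      rw [← hx.fst_apply, ← hψx.fst_apply, ← hψx.fst_apply, ← hx.fst_apply]
      exact congrArg (fun χ : AddMonoid.End (R ⧸ annL R) × AddMonoid.End (R ⧸ annR R) =>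
        χ.1 (mkL R (val C a (delta i)))) (hcen ψ hψ)
    rw [sub_mul, sub_eq_zero]
    exact mkL_eq_iff.1 h1 _
  · rw [latMem_iff_val h, val_sum]
    simp only [val_sum, one_smul, val_vmul h]
    refine prodSum_of_actsOnTarget hx.fst hact ((relForm_iff h).1 ?_)
    exact (hr.mem_iff_of_isLin (fun e _ => isLin_relForm C e) _).2
      ⟨delta s, fun i _ => sum_delta_rows Gr s i⟩
  · rw [latMem_iff_val h, val_vmul h, val_sub, sub_mul, sub_eq_zero]
    refine mkL_eq_iff.1 ?_ _
    rw [← hx.fst_apply, val_vmul h, val_vmul h]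
    have := hL (mkL R (val C a (delta i))) (mkR R (val C a (delta j)))
    rw [hx.fst_apply] at this
    exact this
  · rw [latMem_iff_val h, val_vmul h, val_sub, mul_sub, sub_eq_zero]
    refine mkR_eq_iff.1 ?_ _
    rw [← hx.snd_apply, val_vmul h, val_vmul h]
    have := hR (mkL R (val C a (delta i))) (mkR R (val C a (delta j)))
    rw [hx.fst_apply] at this
    exact this
  · rw [latMem_iff_val h, val_vmul h, val_sub, sub_mul, sub_eq_zero]
    by_cases hi : i < C.1
    · exact mkL_eq_iff.1 ((hx.fst i hi).symm.trans (hZL i hi)) _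
    · rw [happ0 _ _ hi, happ0 _ _ hi]
  · rw [latMem_iff_val h, val_vmul h, val_sub, mul_sub, sub_eq_zero]
    by_cases hi : i < C.1
    · exact mkR_eq_iff.1 ((hx.snd i hi).symm.trans (hZR i hi)) _
    · rw [happ0 _ _ hi, happ0 _ _ hi]

end Rep

end ZAlg

/-! ### A presentation of the maximal ring of scalars -/

namespace ZAlg

open Finset

/-- The two matrices of the `k`-th tuple in `D`, stored in one vector. -/
def tupleStore (n : ℕ) (D : List (List (List ℤ))) (k m : ℕ) : ℤ :=
  if m.unpair.1 = 0 then ent₃ D k m.unpair.2.unpair.1 m.unpair.2.unpair.2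
  else ent₃ D k (n + m.unpair.2.unpair.1) (n + m.unpair.2.unpair.2)

/-- The stored matrices of a composition. -/
def mulStore (n : ℕ) (x y : ℕ → ℤ) (m : ℕ) : ℤ :=
  app n m.unpair.1 x (app n m.unpair.1 y (delta m.unpair.2.unpair.1)) m.unpair.2.unpair.2

/-- Identity matrices, stored in a vector. -/
def oneStore (m : ℕ) : ℤ := delta m.unpair.2.unpair.1 m.unpair.2.unpair.2

/-- The conditions for the stored matrices `x` to represent the zero endomorphisms. -/
def zeroForm (C : AlgCode) (e : ℕ) (x : ℕ → ℤ) : ℕ → ℤ :=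
  if e.unpair.1 = 0 then
    C.vmul (app C.1 0 x (delta e.unpair.2.unpair.1)) (delta e.unpair.2.unpair.2)
  else C.vmul (delta e.unpair.2.unpair.2) (app C.1 1 x (delta e.unpair.2.unpair.1))

/-- The matrices stored in `x` represent the zero endomorphisms. -/
def ZeroRep (C : AlgCode) (x : ℕ → ℤ) : Prop :=
  ∀ e < Nat.pair 1 (Nat.pair C.1 C.1) + 1, LatMem C.1 C.2.1 (zeroForm C e x)

/-- The list `Λ` generates the relations between the elements represented by the tuples in `D`, and
`c` contains structure constants for them. -/
def IsTable (C : AlgCode) (D : List (List (List ℤ))) (Λ : List (List ℤ))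
    (c : List (List (List ℤ))) : Prop :=
  GenKer C.1 C.2.1 D.length (Nat.pair 1 (Nat.pair C.1 C.1) + 1)
    (fun e u => zeroForm C e fun m => ∑ k ∈ range D.length, delta u k * tupleStore C.1 D k m) Λ ∧
  ∀ i < D.length, ∀ j < D.length, ZeroRep C fun m =>
    mulStore C.1 (tupleStore C.1 D i) (tupleStore C.1 D j) m -
      ∑ k ∈ range D.length, ent₃ c i j k * tupleStore C.1 D k m

/-- The combination of the tuples in `D` with coefficients `d` represents the identity. -/
def IsUnitVec (C : AlgCode) (D : List (List (List ℤ))) (d : List ℤ) : Prop :=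
  ZeroRep C fun m => oneStore m - ∑ k ∈ range D.length, ent d k * tupleStore C.1 D k m

section Semi

variable {α : Type*} [Primcodable α]

@[fun_prop]
theorem primrec_tupleStore {n k m : α → ℕ} {D : α → List (List (List ℤ))} (hn : Primrec n)
    (hD : Primrec D) (hk : Primrec k) (hm : Primrec m) :
    Primrec fun a => tupleStore (n a) (D a) (k a) (m a) := by
  unfold tupleStore; fun_prop

@[fun_prop]
theorem primrec_mulStore {n m : α → ℕ} {x y : α → ℕ → ℤ} (hn : Primrec n)
    (hx : Primrec fun p : α × ℕ => x p.1 p.2) (hy : Primrec fun p : α × ℕ => y p.1 p.2)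
    (hm : Primrec m) : Primrec fun a => mulStore (n a) (x a) (y a) (m a) := by
  unfold mulStore; fun_prop

@[fun_prop]
theorem primrec_oneStore {m : α → ℕ} (hm : Primrec m) : Primrec fun a => oneStore (m a) := by
  unfold oneStore; fun_prop

@[fun_prop]
theorem primrec_zeroForm {C : α → AlgCode} {e c : α → ℕ} {x : α → ℕ → ℤ} (hC : Primrec C)
    (he : Primrec e) (hx : Primrec fun p : α × ℕ => x p.1 p.2) (hc : Primrec c) :
    Primrec fun a => zeroForm (C a) (e a) (x a) (c a) := by
  unfold zeroForm
  simp only [ite_apply]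
  fun_prop

theorem semi_zeroRep {C : α → AlgCode} {x : α → ℕ → ℤ} (hC : Primrec C)
    (hx : Primrec fun p : α × ℕ => x p.1 p.2) : Semi fun a => ZeroRep (C a) (x a) := by
  unfold ZeroRep
  refine Semi.forall_lt (by fun_prop) (semi_latMem ?_ ?_ ?_) <;> fun_prop

theorem semi_isTable {C : α → AlgCode} {D c : α → List (List (List ℤ))} {Λ : α → List (List ℤ)}
    (hC : Primrec C) (hD : Primrec D) (hΛ : Primrec Λ) (hc : Primrec c) :
    Semi fun a => IsTable (C a) (D a) (Λ a) (c a) := by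
  unfold IsTable
  refine Semi.and (semi_genKer ?_ ?_ ?_ ?_ ?_ ?_) (Semi.forall_lt (by fun_prop)
    (Semi.forall_lt (by fun_prop) (semi_zeroRep ?_ ?_)))
  all_goals fun_prop

theorem semi_isUnitVec {C : α → AlgCode} {D : α → List (List (List ℤ))} {d : α → List ℤ}
    (hC : Primrec C) (hD : Primrec D) (hd : Primrec d) :
    Semi fun a => IsUnitVec (C a) (D a) (d a) := by
  unfold IsUnitVec
  refine semi_zeroRep ?_ ?_ <;> fun_prop

end Semi

theorem exists_sum_of_closure {A : Type*} [AddCommGroup A] {t : ℕ} {f : ℕ → A}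
    (hf : AddSubgroup.closure (Set.range fun i : Fin t => f i) = ⊤) (s : A) :
    ∃ y : ℕ → ℤ, s = ∑ k ∈ range t, y k • f k := by
  have hs : s ∈ AddSubgroup.closure (Set.range fun i : Fin t => f i) := by rw [hf]; trivial
  induction hs using AddSubgroup.closure_induction with
  | mem s hs =>
    obtain ⟨i, rfl⟩ := hs
    refine ⟨delta i, ?_⟩
    rw [Finset.sum_eq_single (i : ℕ) (fun j _ hj => by simp [delta, hj.symm])
      (fun h => absurd (Finset.mem_range.2 i.2) h)]
    simp [delta]
  | zero => exact ⟨0, by simp⟩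
  | add x y _ _ hx hy =>
    obtain ⟨u, rfl⟩ := hx
    obtain ⟨v, rfl⟩ := hy
    exact ⟨u + v, by simp [add_smul, Finset.sum_add_distrib]⟩
  | neg x _ hx =>
    obtain ⟨u, rfl⟩ := hx
    exact ⟨-u, by simp⟩

section Rep

variable {R : Type u} [NonUnitalNonAssocRing R] {C : AlgCode} {a : Fin C.1 → R}
variable {φ ψ : AddMonoid.End (R ⧸ annL R) × AddMonoid.End (R ⧸ annR R)} {x y : ℕ → ℤ}

theorem Rep.sub (hx : Rep C a φ x) (hy : Rep C a ψ y) : Rep C a (φ - ψ) fun m => x m - y m := by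
  have hval : ∀ k w, val C a (app C.1 k (fun i => x i - y i) w) =
      val C a (app C.1 k x w) - val C a (app C.1 k y w) := by
    intro k w
    rw [← val_sub]
    congr 1
    funext c
    simp only [app, mul_sub, Finset.sum_sub_distrib]
  constructor
  · intro i hi
    rw [hval, map_sub, ← hx.fst i hi, ← hy.fst i hi]
    rfl
  · intro i hi
    rw [hval, map_sub, ← hx.snd i hi, ← hy.snd i hi]
    rfl

theorem Rep.mul (hx : Rep C a φ x) (hy : Rep C a ψ y) : Rep C a (φ * ψ) (mulStore C.1 x y) := by
  constructor
  · intro i hi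
    change φ.1 (ψ.1 _) = _
    rw [hy.fst_apply, hx.fst_apply]
    exact congrArg _ (val_congr fun c _ => by rw [app_delta hi]; simp [mulStore])
  · intro i hi
    change φ.2 (ψ.2 _) = _
    rw [hy.snd_apply, hx.snd_apply]
    exact congrArg _ (val_congr fun c _ => by rw [app_delta hi]; simp [mulStore])

theorem Rep.one : Rep C a 1 oneStore := by
  have h1 : ∀ k i, i < C.1 → val C a (app C.1 k oneStore (delta i)) = val C a (delta i) :=
    fun k i hi => val_congr fun c _ => by rw [app_delta hi]; simp [oneStore]
  exact ⟨fun i hi => by rw [h1 0 i hi]; rfl, fun i hi => by rw [h1 1 i hi]; rfl⟩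

variable (h : C.Presents R a)
include h

theorem Rep.eq_zero_iff (hx : Rep C a φ x) : ZeroRep C x ↔ φ = 0 := by
  constructor
  · intro H
    refine Prod.ext (val_mkL_ext h fun i hi => ?_) (val_mkR_ext h fun i hi => ?_)
    · refine (hx.fst i hi).trans ?_
      change _ = 0
      rw [mkL_eq_zero, val_mul_eq_zero_iff h]
      intro j hj
      have := (latMem_iff_val h).1 (H (Nat.pair 0 (Nat.pair i j)) (Nat.lt_succ_of_le
        (pair_le_pair (by simp) (pair_le_pair hi.le hj.le))))
      simpa [zeroForm, val_vmul h] using this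
    · refine (hx.snd i hi).trans ?_
      change _ = 0
      rw [mkR_eq_zero, mul_val_eq_zero_iff h]
      intro j hj
      have := (latMem_iff_val h).1 (H (Nat.pair 1 (Nat.pair i j)) (Nat.lt_succ_of_le
        (pair_le_pair (by simp) (pair_le_pair hi.le hj.le))))
      simpa [zeroForm, val_vmul h] using this
  · rintro rfl e -
    rw [latMem_iff_val h]
    unfold zeroForm
    have happ0 : ∀ m i, ¬ i < C.1 → app C.1 m x (delta i) = 0 := fun m i hi => by
      funext c
      exact Finset.sum_eq_zero fun l hl => by
        rw [delta, if_neg (by rintro rfl; exact hi (Finset.mem_range.1 hl)), zero_mul]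
    split_ifs
    · rw [val_vmul h]
      by_cases hi : e.unpair.2.unpair.1 < C.1
      · exact mkL_eq_zero.1 (hx.fst _ hi).symm _
      · rw [happ0 _ _ hi, map_zero, zero_mul]
    · rw [val_vmul h]
      by_cases hi : e.unpair.2.unpair.1 < C.1
      · exact mkR_eq_zero.1 (hx.snd _ hi).symm _
      · rw [happ0 _ _ hi, map_zero, mul_zero]

theorem Rep.eq_iff (hx : Rep C a φ x) (hy : Rep C a ψ y) :
    ZeroRep C (fun m => x m - y m) ↔ φ = ψ := by
  rw [(hx.sub hy).eq_zero_iff h, sub_eq_zero]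

omit h in
theorem Rep.algScalars_sum {t : ℕ} {f : ℕ → algScalars R} {g : ℕ → ℕ → ℤ}
    (hf : ∀ k < t, Rep C a (f k).1 (g k)) (y : ℕ → ℤ) :
    Rep C a (∑ k ∈ range t, y k • f k : algScalars R).1 fun m => ∑ k ∈ range t, y k * g k m := by
  have : (∑ k ∈ range t, y k • f k : algScalars R).1 = ∑ k ∈ range t, y k • (f k).1 := by
    rw [AddSubmonoidClass.coe_finsetSum]
    rfl
  rw [this]
  exact Rep.sum hf y

variable {D : List (List (List ℤ))} {f : ℕ → algScalars R}
  (hf : ∀ k < D.length, Rep C a (f k).1 (tupleStore C.1 D k))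
include hf

omit h hf in
theorem isLin_zeroForm (C : AlgCode) (D : List (List (List ℤ))) (e : ℕ) :
    IsLin C.1 D.length fun x => zeroForm C e fun m =>
      ∑ k ∈ range D.length, x k * tupleStore C.1 D k m := by
  have h0 : ∀ q w, IsLin C.1 D.length fun x => app C.1 q (fun m =>
      ∑ k ∈ range D.length, x k * tupleStore C.1 D k m) w := by
    intro q w x c _
    simp only [app, Finset.mul_sum]
    refine Eq.trans (Finset.sum_congr rfl fun i _ => ?_) Finset.sum_comm
    refine Eq.trans (Finset.sum_congr rfl fun k hk => ?_) Finset.sum_comm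
    rw [← sum_delta (Finset.mem_range.1 hk) x, Finset.sum_mul, Finset.mul_sum]
    exact Finset.sum_congr rfl fun u _ => by ring
  unfold zeroForm
  split_ifs
  · exact (h0 _ _).vmul_left _
  · exact (h0 _ _).vmul_right _

theorem IsTable.presents (hgen : AddSubgroup.closure (Set.range fun k : Fin D.length => f k) = ⊤)
    {Λ : List (List ℤ)} {c : List (List (List ℤ))} (ht : IsTable C D Λ c) :
    AlgCode.Presents (D.length, Λ, c) (algScalars R) fun k => f k := by
  refine ⟨hgen, fun x => ?_, fun i j => ?_⟩
  · obtain ⟨x, rfl⟩ : ∃ x' : ℕ → ℤ, x = fun i : Fin D.length => x' i :=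
      ⟨fun i => if h : i < D.length then x ⟨i, h⟩ else 0, funext fun i => by simp⟩
    have h1 := ht.1.mem_iff_of_isLin (F := fun e x => zeroForm C e fun m =>
      ∑ k ∈ range D.length, x k * tupleStore C.1 D k m) (fun e _ => isLin_zeroForm C D e) x
    have h2 := (Rep.algScalars_sum hf x).eq_zero_iff h
    change ∑ i : Fin D.length, x i • f i = 0 ↔ _
    rw [← Finset.sum_range fun i => x i • f i, ← Subtype.coe_inj]
    refine (h2.symm.trans h1).trans ?_
    have hr : AlgCode.rel (D.length, Λ, c) = rowVec D.length Λ := by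
      funext j i
      simp [rowVec, AlgCode.rel, List.getD_eq_getElem?_getD]
    rw [hr, ← latMem_iff]
    constructor
    · rintro ⟨y, hy⟩
      obtain ⟨l, -, hl⟩ := List.exists_getD_eq (0 : ℤ) Λ.length y
      exact ⟨l, fun i hi => (hy i hi).trans (Finset.sum_congr rfl fun s hs => by
        rw [← hl s (Finset.mem_range.1 hs)])⟩
    · rintro ⟨l, hl⟩
      exact ⟨ent l, hl⟩
  · have h1 := ((((hf i i.2).mul (hf j j.2)).eq_iff h (Rep.algScalars_sum hf _)).1
      (ht.2 i i.2 j j.2))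
    refine (Subtype.ext h1 : f i * f j = _).trans ?_
    rw [Finset.sum_range]
    rfl

theorem exists_isTable (hgen : AddSubgroup.closure (Set.range fun k : Fin D.length => f k) = ⊤) :
    ∃ Λ c, IsTable C D Λ c := by
  obtain ⟨Λ, hΛ⟩ := exists_genKer C.1 C.2.1 D.length (Nat.pair 1 (Nat.pair C.1 C.1) + 1)
    (fun e u => zeroForm C e fun m => ∑ k ∈ range D.length, delta u k * tupleStore C.1 D k m)
  choose y hy using fun i j => exists_sum_of_closure hgen (f i * f j)
  obtain ⟨c, -, hc⟩ := List.exists_getD_forall [] D.length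
    (fun i l => ∀ j < D.length, ∀ k < D.length, ent₂ l j k = y i j k) (fun i _ => by
      obtain ⟨l, -, hl⟩ := List.exists_getD_forall [] D.length
        (fun j l => ∀ k < D.length, ent l k = y i j k) (fun j _ => by
          obtain ⟨l, -, hl⟩ := List.exists_getD_eq (0 : ℤ) D.length (y i j)
          exact ⟨l, hl⟩)
      exact ⟨l, hl⟩)
  refine ⟨Λ, c, hΛ, fun i hi j hj => ?_⟩
  rw [((hf i hi).mul (hf j hj)).eq_iff h (Rep.algScalars_sum hf _)]
  refine (congrArg Subtype.val (hy i j)).trans (congrArg Subtype.val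
    (Finset.sum_congr rfl fun k hk => ?_))
  rw [← hc i hi j hj k (Finset.mem_range.1 hk)]

theorem isUnitVec_iff (d : List ℤ) :
    IsUnitVec C D d ↔ 1 = ∑ k ∈ range D.length, ent d k • f k := by
  rw [IsUnitVec, Rep.one.eq_iff h (Rep.algScalars_sum hf _), ← Subtype.coe_inj]
  rfl

theorem exists_isUnitVec
    (hgen : AddSubgroup.closure (Set.range fun k : Fin D.length => f k) = ⊤) :
    ∃ d, IsUnitVec C D d := by
  obtain ⟨y, hy⟩ := exists_sum_of_closure hgen (1 : algScalars R)
  obtain ⟨d, -, hd⟩ := List.exists_getD_eq (0 : ℤ) D.length y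
  refine ⟨d, (isUnitVec_iff h hf d).2 (hy.trans (Finset.sum_congr rfl fun k hk => ?_))⟩
  rw [← hd k (Finset.mem_range.1 hk)]

end Rep

end ZAlg

/-! ### Generators of the ideal of relations -/

namespace ZAlg

open Finset

/-- The exponent list of the monomial `x_i` in `t` variables. -/
def expo (t i : ℕ) : List ℕ := (List.range t).map fun k => if k = i then 1 else 0

/-- The exponent list of the monomial `x_i x_j` in `t` variables. -/
def expo₂ (t i j : ℕ) : List ℕ :=
  (List.range t).map fun k => (if k = i then 1 else 0) + if k = j then 1 else 0

/-- A code for the linear form `∑ k, v k x_k`. -/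
def linCode (t : ℕ) (v : ℕ → ℤ) : PolyCode := (List.range t).map fun k => (v k, expo t k)

/-- Codes for generators of the ideal of relations of a commutative ring with additive generators
`x_k`: the products `x_i x_j` and the unit are expressed by linear forms, and the linear relations
are added. -/
def idealCodes (t : ℕ) (Λ : List (List ℤ)) (c : List (List (List ℤ))) (d : List ℤ) :
    List PolyCode :=
  ((List.range (t * t)).map fun e =>
    (1, expo₂ t (e / t) (e % t)) :: linCode t fun k => -ent₃ c (e / t) (e % t) k) ++
  ((1, []) :: linCode t fun k => -ent d k) :: Λ.map fun l => linCode t (ent l)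

section Semi

variable {α : Type*} [Primcodable α]

@[fun_prop]
theorem primrec_expo {t i : α → ℕ} (ht : Primrec t) (hi : Primrec i) :
    Primrec fun a => expo (t a) (i a) := by
  unfold expo; fun_prop

@[fun_prop]
theorem primrec_expo₂ {t i j : α → ℕ} (ht : Primrec t) (hi : Primrec i) (hj : Primrec j) :
    Primrec fun a => expo₂ (t a) (i a) (j a) := by
  unfold expo₂; fun_prop

@[fun_prop]
theorem primrec_linCode {t : α → ℕ} {v : α → ℕ → ℤ} (ht : Primrec t)
    (hv : Primrec fun p : α × ℕ => v p.1 p.2) : Primrec fun a => linCode (t a) (v a) := by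
  unfold linCode; fun_prop

@[fun_prop]
theorem primrec_idealCodes {t : α → ℕ} {Λ : α → List (List ℤ)} {c : α → List (List (List ℤ))}
    {d : α → List ℤ} (ht : Primrec t) (hΛ : Primrec Λ) (hc : Primrec c) (hd : Primrec d) :
    Primrec fun a => idealCodes (t a) (Λ a) (c a) (d a) := by
  unfold idealCodes; fun_prop

end Semi

theorem prod_expo {A : Type*} [CommRing A] {t : ℕ} (x : Fin t → A) (i : Fin t) :
    (List.ofFn fun k : Fin t => x k ^ (expo t i).getD k 0).prod = x i := by
  rw [List.prod_ofFn, Finset.prod_eq_single i (fun k _ hk => ?_) (by simp)]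
  · simp [expo]
  · simp [expo, Fin.val_ne_of_ne hk]

theorem prod_expo₂ {A : Type*} [CommRing A] {t : ℕ} (x : Fin t → A) (i j : Fin t) :
    (List.ofFn fun k : Fin t => x k ^ (expo₂ t i j).getD k 0).prod = x i * x j := by
  rw [List.prod_ofFn]
  rw [← prod_expo x i, ← prod_expo x j, List.prod_ofFn, List.prod_ofFn, ← Finset.prod_mul_distrib]
  refine Finset.prod_congr rfl fun k _ => ?_
  rw [← pow_add]
  simp [expo, expo₂]

theorem toPoly_linCode (t : ℕ) (v : ℕ → ℤ) :
    (linCode t v).toPoly t = ∑ k : Fin t, v k • (MvPolynomial.X k : MvPolynomial (Fin t) ℤ) := by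
  rw [PolyCode.toPoly, linCode, List.map_map, ← List.sum_toFinset _ List.nodup_range,
    List.toFinset_range, Finset.sum_range]
  refine Finset.sum_congr rfl fun k _ => ?_
  rw [Function.comp_apply, prod_expo, MvPolynomial.smul_eq_C_mul]

theorem toPoly_cons (t : ℕ) (c : ℤ × List ℕ) (p : PolyCode) : PolyCode.toPoly t (c :: p) =
    MvPolynomial.C c.1 * (List.ofFn fun k : Fin t => MvPolynomial.X k ^ c.2.getD k 0).prod +
      p.toPoly t := by
  rw [PolyCode.toPoly, List.map_cons, List.sum_cons]
  rfl

/-- In a commutative ring with additive generators, all relations between them follow from the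
multiplication table, the expression of the unit and the linear relations. -/
theorem ker_aeval_eq_span {S : Type u} [CommRing S] {t : ℕ} {Λ : List (List ℤ)}
    {c : List (List (List ℤ))} {d : List ℤ} {f : Fin t → S}
    (hS : AlgCode.Presents (t, Λ, c) S f) (hd : 1 = ∑ k : Fin t, ent d k • f k) :
    RingHom.ker (MvPolynomial.aeval f : MvPolynomial (Fin t) ℤ →ₐ[ℤ] S) =
      Ideal.span {q | ∃ p ∈ idealCodes t Λ c d, q = p.toPoly t} := by
  set J : Ideal (MvPolynomial (Fin t) ℤ) :=
    Ideal.span {q | ∃ p ∈ idealCodes t Λ c d, q = p.toPoly t} with hJ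
  have hmul : ∀ i j : Fin t, f i * f j = ∑ k : Fin t, ent₃ c i j k • f k := hS.mul_eq
  have hrel : ∀ x : Fin t → ℤ, ∑ i, x i • f i = 0 ↔
      x ∈ AddSubgroup.closure (Set.range (AlgCode.rel (t, Λ, c))) := hS.relations
  have hle : J ≤ RingHom.ker
      (MvPolynomial.aeval f : MvPolynomial (Fin t) ℤ →ₐ[ℤ] S) := by
    refine Ideal.span_le.2 ?_
    rintro _ ⟨p, hp, rfl⟩
    have hlin : ∀ v : ℕ → ℤ, MvPolynomial.aeval f ((linCode t v).toPoly t) =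
        ∑ k : Fin t, v k • f k := by
      intro v
      simp only [toPoly_linCode, map_sum, map_zsmul, MvPolynomial.aeval_X]
    change MvPolynomial.aeval f (p.toPoly t) = 0
    rcases List.mem_append.1 hp with hp | hp
    · obtain ⟨e, he, rfl⟩ := List.mem_map.1 hp
      have he' := List.mem_range.1 he
      have ht : 0 < t := Nat.pos_of_ne_zero (by rintro rfl; simp at he')
      have hm := hmul ⟨e / t, Nat.div_lt_of_lt_mul he'⟩ ⟨e % t, Nat.mod_lt _ ht⟩
      have hx := prod_expo₂ (fun k : Fin t => (MvPolynomial.X k : MvPolynomial (Fin t) ℤ))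
        ⟨e / t, Nat.div_lt_of_lt_mul he'⟩ ⟨e % t, Nat.mod_lt _ ht⟩
      dsimp only at hx hm
      rw [toPoly_cons, map_add, hlin, hx]
      simp only [map_one, one_mul, map_mul, MvPolynomial.aeval_X, neg_smul,
        Finset.sum_neg_distrib]
      rw [hm, add_neg_cancel]
    · rcases List.mem_cons.1 hp with rfl | hp
      · rw [toPoly_cons, map_add, hlin]
        simp only [List.getD_nil, pow_zero, List.prod_ofFn, Finset.prod_const_one, map_one,
          one_mul, neg_smul, Finset.sum_neg_distrib]
        rw [← hd, add_neg_cancel]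
      · obtain ⟨l, hl, rfl⟩ := List.mem_map.1 hp
        obtain ⟨s, rfl⟩ := List.mem_iff_get.1 hl
        rw [hlin]
        exact (hrel _).2 (AddSubgroup.subset_closure ⟨s, rfl⟩)
  refine le_antisymm ?_ hle
  · have hmem : ∀ p ∈ idealCodes t Λ c d, Ideal.Quotient.mk J (p.toPoly t) = 0 := fun p hp =>
      Ideal.Quotient.eq_zero_iff_mem.2 (Ideal.subset_span ⟨p, hp, rfl⟩)
    set π := Ideal.Quotient.mk J
    have h1 : ∀ i j : Fin t, π (MvPolynomial.X i) * π (MvPolynomial.X j) =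
        ∑ k : Fin t, ent₃ c i j k • π (MvPolynomial.X k) := by
      intro i j
      have hij : (i * t + j : ℕ) < t * t := by
        have := i.2; have := j.2; nlinarith
      have e1 : (i * t + j : ℕ) / t = i := by
        rw [Nat.mul_comm, Nat.mul_add_div (by have := j.2; omega), Nat.div_eq_of_lt j.2, add_zero]
      have e2 : (i * t + j : ℕ) % t = j := by
        rw [Nat.mul_comm, Nat.mul_add_mod, Nat.mod_eq_of_lt j.2]
      have := hmem ((1, expo₂ t i j) :: linCode t fun k => -ent₃ c i j k)
        (List.mem_append_left _ (List.mem_map.2 ⟨i * t + j, List.mem_range.2 hij, by rw [e1, e2]⟩))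
      rw [toPoly_cons, prod_expo₂, toPoly_linCode] at this
      simp only [map_one, one_mul, map_add, map_mul, neg_smul, Finset.sum_neg_distrib, map_neg,
        map_sum, map_zsmul] at this
      exact add_neg_eq_zero.1 this
    have h2 : (1 : MvPolynomial (Fin t) ℤ ⧸ J) = ∑ k : Fin t, ent d k • π (MvPolynomial.X k) := by
      have := hmem ((1, []) :: linCode t fun k => -ent d k)
        (List.mem_append_right _ List.mem_cons_self)
      rw [toPoly_cons, toPoly_linCode] at this
      simp only [List.getD_nil, pow_zero, List.prod_ofFn, Finset.prod_const_one, map_one, one_mul,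
        map_add, neg_smul, Finset.sum_neg_distrib, map_neg, map_sum, map_zsmul] at this
      exact add_neg_eq_zero.1 this
    have h3 : ∀ x ∈ AddSubgroup.closure (Set.range (AlgCode.rel (t, Λ, c))),
        ∑ k : Fin t, x k • π (MvPolynomial.X k) = 0 := by
      intro x hx
      induction hx using AddSubgroup.closure_induction with
      | mem x hx =>
        obtain ⟨s, rfl⟩ := hx
        have := hmem (linCode t (ent (Λ.get s))) (List.mem_append_right _
          (List.mem_cons_of_mem _ (List.mem_map.2 ⟨_, List.get_mem _ _, rfl⟩)))
        rw [toPoly_linCode] at this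
        simp only [map_sum, map_zsmul] at this
        exact this
      | zero => simp
      | add x y _ _ hx hy =>
        simp only [Pi.add_apply, add_smul, Finset.sum_add_distrib, hx, hy, add_zero]
      | neg x _ hx =>
        simp only [Pi.neg_apply, neg_smul, Finset.sum_neg_distrib, hx, neg_zero]
    -- modulo the ideal, every polynomial is a linear form
    have h4 : ∀ p, ∃ l : Fin t → ℤ, π p = ∑ k, l k • π (MvPolynomial.X k) := by
      intro p
      induction p using MvPolynomial.induction_on with
      | C z =>
        refine ⟨fun k => z * ent d k, ?_⟩
        simp only [mul_smul, ← Finset.smul_sum, ← h2]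
        rw [zsmul_eq_mul, mul_one, eq_intCast (MvPolynomial.C) z, map_intCast]
      | add p q hp hq =>
        obtain ⟨l, hl⟩ := hp
        obtain ⟨m, hm⟩ := hq
        exact ⟨l + m, by simp [add_smul, Finset.sum_add_distrib, hl, hm]⟩
      | mul_X p i hp =>
        obtain ⟨l, hl⟩ := hp
        refine ⟨fun k => ∑ j, l j * ent₃ c j i k, ?_⟩
        rw [map_mul, hl, Finset.sum_mul]
        simp only [smul_mul_assoc, h1, Finset.smul_sum, Finset.sum_smul, mul_smul]
        rw [Finset.sum_comm]
    intro p hp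
    obtain ⟨l, hl⟩ := h4 p
    have h5 : π p = π (∑ k, l k • MvPolynomial.X k) := by simp only [hl, map_sum, map_zsmul]
    have h6 : p - ∑ k, l k • MvPolynomial.X k ∈ J := (Ideal.Quotient.mk_eq_mk_iff_sub_mem _ _).1 h5
    have h7 : ∑ k, l k • f k = 0 := by
      have : MvPolynomial.aeval f _ = 0 := hle h6
      rw [map_sub, show MvPolynomial.aeval f p = 0 from hp, zero_sub, neg_eq_zero] at this
      simpa using this
    refine Ideal.Quotient.eq_zero_iff_mem.1 (hl.trans (h3 l ((hrel l).1 h7)))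

end ZAlg

/-! ### The first step -/

namespace ZAlg

open Finset

/-- The tuples in `D` contain the matrices number `0` and `1` that are stored in the rows of `G`. -/
def IsReadOff (n : ℕ) (G : List (List ℤ)) (D : List (List (List ℤ))) : Prop :=
  ∀ k < G.length, ∀ i < n, ∀ j < n,
    ent₃ D k i j = ent₂ G k (Nat.pair 0 (Nat.pair i j)) ∧
    ent₃ D k (n + i) (n + j) = ent₂ G k (Nat.pair 1 (Nat.pair i j))

/-- The tuples in `D` are read off from generators of the linear system for `𝔖(R)`. -/
def IsScalTuples (C : AlgCode) (D : List (List (List ℤ))) : Prop :=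
  ∃ Gs Gr G : List (List ℤ), IsSymGen C Gs ∧ IsRelGen C Gr ∧ IsScalGen C Gs Gr G ∧
    D.length = G.length ∧ IsReadOff C.1 G D

/-- The polynomials in `I` are the ones of a multiplication table. -/
def IsTableIdeal (C : AlgCode) (D : List (List (List ℤ))) (I : List PolyCode) : Prop :=
  ∃ Λ c d, IsTable C D Λ c ∧ IsUnitVec C D d ∧ I = idealCodes D.length Λ c d

section Semi

variable {α : Type*} [Primcodable α]

theorem semi_isReadOff {n : α → ℕ} {G : α → List (List ℤ)} {D : α → List (List (List ℤ))}
    (hn : Primrec n) (hG : Primrec G) (hD : Primrec D) :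
    Semi fun x => IsReadOff (n x) (G x) (D x) := by
  refine Semi.forall_lt ?_ (Semi.forall_lt ?_ (Semi.forall_lt ?_
    (Semi.and (Semi.eq ?_ ?_) (Semi.eq ?_ ?_))))
  all_goals fun_prop

theorem semi_isScalTuples {C : α → AlgCode} {D : α → List (List (List ℤ))}
    (hC : Primrec C) (hD : Primrec D) : Semi fun x => IsScalTuples (C x) (D x) := by
  refine Semi.ex (Semi.ex (Semi.ex (Semi.and (semi_isSymGen ?_ ?_) (Semi.and (semi_isRelGen ?_ ?_)
    (Semi.and (semi_isScalGen ?_ ?_ ?_ ?_) (Semi.and (Semi.eq ?_ ?_)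
      (semi_isReadOff ?_ ?_ ?_)))))))
  all_goals fun_prop

theorem semi_isTableIdeal {C : α → AlgCode} {D : α → List (List (List ℤ))} {I : α → List PolyCode}
    (hC : Primrec C) (hD : Primrec D) (hI : Primrec I) :
    Semi fun x => IsTableIdeal (C x) (D x) (I x) := by
  refine Semi.ex (Semi.ex (Semi.ex (Semi.and (semi_isTable ?_ ?_ ?_ ?_) (Semi.and
      (semi_isUnitVec ?_ ?_ ?_) (Semi.eq ?_ ?_)))))
  all_goals fun_prop

theorem semi_step1 :
    Semi fun x : AlgCode × ScalarsCode => IsScalTuples x.1 x.2.1 ∧ IsTableIdeal x.1 x.2.1 x.2.2 := by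
  refine Semi.and (semi_isScalTuples ?_ ?_) (semi_isTableIdeal ?_ ?_ ?_)
  all_goals fun_prop

end Semi

section Step

variable {R : Type u} [NonUnitalNonAssocRing R] {C : AlgCode} {a : Fin C.1 → R}

theorem val_app_delta {i : ℕ} (hi : i < C.1) (k : ℕ) (x : ℕ → ℤ) :
    val C a (app C.1 k x (delta i)) = ∑ j : Fin C.1, x (Nat.pair k (Nat.pair i j)) • a j := by
  rw [val_apply]
  exact Finset.sum_congr rfl fun j _ => by rw [app_delta hi]

/-- The first step in terms of a sequence of elements of `𝔖(R)`. -/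
theorem isStep1_iff {D : ScalarsCode} : IsStep1 C R a D ↔ ∃ f : ℕ → algScalars R,
    (∀ k < D.1.length, Rep C a (f k).1 (tupleStore C.1 D.1 k)) ∧
    AddSubgroup.closure (Set.range fun k : Fin D.1.length => f k) = ⊤ ∧
    RingHom.ker (MvPolynomial.aeval (fun k : Fin D.1.length => f k) :
      MvPolynomial (Fin D.t) ℤ →ₐ[ℤ] algScalars R) = D.ideal := by
  have hget : ∀ (k : Fin D.t) i j, ((D.1.get k).getD i []).getD j 0 = ent₃ D.1 k i j := by
    intro k i j
    simp [List.getD_eq_getElem?_getD]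
  have key : ∀ (φ : AddMonoid.End (R ⧸ annL R) × AddMonoid.End (R ⧸ annR R)) (k : Fin D.t),
      Rep C a φ (tupleStore C.1 D.1 k) ↔
      (∀ i, φ.1 (a i : R ⧸ annL R) = ∑ j, D.matL C.1 k i j • (a j : R ⧸ annL R)) ∧
      (∀ i, φ.2 (a i : R ⧸ annR R) = ∑ j, D.matR C.1 k i j • (a j : R ⧸ annR R)) := by
    intro φ k
    have e1 : ∀ i : Fin C.1, mkL R (val C a (app C.1 0 (tupleStore C.1 D.1 k) (delta i))) =
        ∑ j, D.matL C.1 k i j • (a j : R ⧸ annL R) := fun i => by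
      rw [val_app_delta i.2, map_sum]
      refine Finset.sum_congr rfl fun j _ => ?_
      rw [map_zsmul, tupleStore, ScalarsCode.matL, hget]
      simp
    have e2 : ∀ i : Fin C.1, mkR R (val C a (app C.1 1 (tupleStore C.1 D.1 k) (delta i))) =
        ∑ j, D.matR C.1 k i j • (a j : R ⧸ annR R) := fun i => by
      rw [val_app_delta i.2, map_sum]
      refine Finset.sum_congr rfl fun j _ => ?_
      rw [map_zsmul, tupleStore, ScalarsCode.matR, hget]
      simp
    constructor
    · intro hr
      refine ⟨fun i => ?_, fun i => ?_⟩
      · rw [← e1, ← hr.fst i i.2, val_delta]; rfl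
      · rw [← e2, ← hr.snd i i.2, val_delta]; rfl
    · rintro ⟨h1, h2⟩
      refine ⟨fun i hi => ?_, fun i hi => ?_⟩
      · rw [val_delta_of_lt hi]; exact (h1 ⟨i, hi⟩).trans (e1 ⟨i, hi⟩).symm
      · rw [val_delta_of_lt hi]; exact (h2 ⟨i, hi⟩).trans (e2 ⟨i, hi⟩).symm
  constructor
  · rintro ⟨φ, hL, hR, hgen, hker⟩
    have hφ : (fun k : Fin D.1.length =>
        (fun k => if hk : k < D.1.length then φ ⟨k, hk⟩ else 0 : ℕ → algScalars R) k) = φ :=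
      funext fun k => dif_pos k.2
    refine ⟨fun k => if hk : k < D.1.length then φ ⟨k, hk⟩ else 0, fun k hk => ?_, ?_, ?_⟩
    · beta_reduce
      rw [dif_pos hk]
      exact (key _ ⟨k, hk⟩).2 ⟨hL ⟨k, hk⟩, hR ⟨k, hk⟩⟩
    · rw [hφ, hgen]
    · rw [hφ, hker]
  · rintro ⟨f, hf, hgen, hker⟩
    exact ⟨fun k => f k, fun k => ((key _ k).1 (hf k k.2)).1, fun k => ((key _ k).1 (hf k k.2)).2,
      hgen, hker⟩

theorem Rep.of_eq_store {φ : AddMonoid.End (R ⧸ annL R) × AddMonoid.End (R ⧸ annR R)}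
    {x x' : ℕ → ℤ} (hx : Rep C a φ x)
    (h0 : ∀ i < C.1, ∀ j < C.1, x' (Nat.pair 0 (Nat.pair i j)) = x (Nat.pair 0 (Nat.pair i j)))
    (h1 : ∀ i < C.1, ∀ j < C.1, x' (Nat.pair 1 (Nat.pair i j)) = x (Nat.pair 1 (Nat.pair i j))) :
    Rep C a φ x' :=
  ⟨fun i hi => by
    rw [hx.fst i hi, val_app_delta hi, val_app_delta hi]
    exact congrArg _ (Finset.sum_congr rfl fun j _ => by rw [h0 i hi j j.2]),
  fun i hi => by
    rw [hx.snd i hi, val_app_delta hi, val_app_delta hi]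
    exact congrArg _ (Finset.sum_congr rfl fun j _ => by rw [h1 i hi j j.2])⟩

variable (h : C.Presents R a)
include h

/-- Generators of the solution space represent additive generators of `𝔖(R)`. -/
theorem IsScalGen.exists_family {Gs Gr G : List (List ℤ)} (hs : IsSymGen C Gs)
    (hr : IsRelGen C Gr) (hG : IsScalGen C Gs Gr G) : ∃ f : ℕ → algScalars R,
    (∀ k, Rep C a (f k).1 (ent₂ G k)) ∧
    AddSubgroup.closure (Set.range fun k : Fin G.length => f k) = ⊤ := by
  have hlin := hG.mem_iff_of_isLin fun e _ => isLin_scalForm C Gs Gr e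
  choose f hf hrep using fun k => mem_algScalars_of_scalForm h hs hr
    ((hlin (ent₂ G k)).2 ⟨delta k, fun i _ => sum_delta_rows G k i⟩)
  refine ⟨fun k => ⟨f k, hf k⟩, hrep, eq_top_iff.2 fun φ _ => ?_⟩
  obtain ⟨x, hx, H⟩ := exists_scalForm h hs hr φ.2
  obtain ⟨y, hy⟩ := (hlin x).1 H
  have h1 := hx.eq_sum h (fun s (_ : s < G.length) => hrep s) hy
  have h2 : φ = ∑ s ∈ range G.length, y s • (⟨f s, hf s⟩ : algScalars R) := by
    refine Subtype.ext (h1.trans ?_)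
    rw [AddSubmonoidClass.coe_finsetSum]
    rfl
  rw [h2]
  refine sum_mem fun s hsG => zsmul_mem (AddSubgroup.subset_closure ?_) _
  exact ⟨⟨s, Finset.mem_range.1 hsG⟩, rfl⟩

omit h in
theorem rep_tupleStore {G : List (List ℤ)} {D : List (List (List ℤ))} {f : ℕ → algScalars R}
    (hf : ∀ k, Rep C a (f k).1 (ent₂ G k))
    (H : IsReadOff C.1 G D)
    {k : ℕ} (hk : k < G.length) : Rep C a (f k).1 (tupleStore C.1 D k) :=
  (hf k).of_eq_store (fun i hi j hj => by simpa [tupleStore] using (H k hk i hi j hj).1)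
    fun i hi j hj => by simpa [tupleStore] using (H k hk i hi j hj).2

theorem ker_aeval_eq_ideal {D : ScalarsCode} {f : ℕ → algScalars R}
    (hf : ∀ k < D.1.length, Rep C a (f k).1 (tupleStore C.1 D.1 k))
    (hgen : AddSubgroup.closure (Set.range fun k : Fin D.1.length => f k) = ⊤)
    {Λ : List (List ℤ)} {c : List (List (List ℤ))} {d : List ℤ} (hT : IsTable C D.1 Λ c)
    (hd : IsUnitVec C D.1 d) (hD : D.2 = idealCodes D.1.length Λ c d) :
    RingHom.ker (MvPolynomial.aeval (fun k : Fin D.1.length => f k) :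
      MvPolynomial (Fin D.t) ℤ →ₐ[ℤ] algScalars R) = D.ideal := by
  rw [ker_aeval_eq_span (hT.presents h hf hgen) (d := d), ScalarsCode.ideal, hD]
  rw [(isUnitVec_iff h hf d).1 hd, Finset.sum_range]

theorem isStep1_of_isScalTuples {D : ScalarsCode} (hD : IsScalTuples C D.1)
    (hI : IsTableIdeal C D.1 D.2) : IsStep1 C R a D := by
  obtain ⟨Gs, Gr, G, hs, hr, hG, hlen, H⟩ := hD
  obtain ⟨Λ, c, d, hT, hd, hI⟩ := hI
  obtain ⟨f, hf, hgen⟩ := hG.exists_family h hs hr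
  rw [← hlen] at hgen
  have hf' : ∀ k < D.1.length, Rep C a (f k).1 (tupleStore C.1 D.1 k) := fun k hk =>
    rep_tupleStore hf H (hlen ▸ hk)
  exact isStep1_iff.2 ⟨f, hf', hgen, ker_aeval_eq_ideal h hf' hgen hT hd hI⟩

theorem exists_isScalTuples : ∃ D : ScalarsCode, IsScalTuples C D.1 ∧ IsTableIdeal C D.1 D.2 := by
  obtain ⟨Gs, hs⟩ : ∃ Gs, IsSymGen C Gs := exists_genKer _ _ _ _ _
  obtain ⟨Gr, hr⟩ : ∃ Gr, IsRelGen C Gr := exists_genKer _ _ _ _ _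
  obtain ⟨G, hG⟩ : ∃ G, IsScalGen C Gs Gr G := exists_genKer _ _ _ _ _
  obtain ⟨f, hf, hgen⟩ := hG.exists_family h hs hr
  let D : List (List (List ℤ)) := (List.range G.length).map fun k =>
    (List.range (C.1 + C.1)).map fun i => (List.range (C.1 + C.1)).map fun j =>
      if i < C.1 then ent₂ G k (Nat.pair 0 (Nat.pair i j))
      else ent₂ G k (Nat.pair 1 (Nat.pair (i - C.1) (j - C.1)))
  have hlen : D.length = G.length := by simp [D]
  have H : IsReadOff C.1 G D := by
    intro k hk i hi j hj
    have h1 : i < C.1 + C.1 := by omega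
    have h2 : j < C.1 + C.1 := by omega
    constructor <;> simp [D, hk, hi, hj, h1, h2]
  rw [← hlen] at hgen
  have hf' : ∀ k < D.length, Rep C a (f k).1 (tupleStore C.1 D k) := fun k hk =>
    rep_tupleStore hf H (hlen ▸ hk)
  obtain ⟨Λ, c, hT⟩ := exists_isTable h hf' hgen
  obtain ⟨d, hd⟩ := exists_isUnitVec h hf' hgen
  exact ⟨(D, idealCodes D.length Λ c d), ⟨Gs, Gr, G, hs, hr, hG, hlen, H⟩, Λ, c, d, hT, hd, rfl⟩

end Step

end ZAlg

/-! ### Primitive idempotents -/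

namespace ZAlg

open Finset

section Primitive

variable {S : Type*} [CommRing S]

theorem IsPrimitiveIdempotent.mul_eq {e f : S} (he : IsPrimitiveIdempotent e)
    (hf : IsIdempotentElem f) : f * e = 0 ∨ f * e = e := by
  have hf' : f * f = f := hf
  have he' : e * e = e := he.1
  rcases he.2.2 (f * e) ((1 - f) * e) (hf.mul he.1) (hf.one_sub.mul he.1)
    (by linear_combination -e * e * hf') (by ring) with h | h
  · exact Or.inl h
  · exact Or.inr (by linear_combination -h)

theorem IsPrimitiveIdempotent.mul_eq_zero {e f : S} (he : IsPrimitiveIdempotent e)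
    (hf : IsPrimitiveIdempotent f) (hne : e ≠ f) : e * f = 0 := by
  rcases hf.mul_eq he.1 with h | h
  · exact h
  · rcases he.mul_eq hf.1 with h' | h'
    · rw [mul_comm, h']
    · exact absurd (by rw [← h', mul_comm, h]) hne

/-- A complete system of non-zero orthogonal idempotents that no idempotent splits consists of all
primitive idempotents. -/
theorem range_eq_primitive {ι : Type*} [Fintype ι] {e : ι → S}
    (he : CompleteOrthogonalIdempotents e) (h0 : ∀ i, e i ≠ 0)
    (h : ∀ f, IsIdempotentElem f → ∀ i, f * e i = 0 ∨ f * e i = e i) :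
    Function.Injective e ∧ Set.range e = {f | IsPrimitiveIdempotent f} := by
  have hprim : ∀ i, IsPrimitiveIdempotent (e i) := fun i =>
    ⟨he.idem i, h0 i, fun f g hf hg hfg hs => by
      have h1 : f * e i = f := by rw [hs, mul_add, hfg, add_zero]; exact hf
      rcases h f hf i with h2 | h2
      · exact Or.inl (h1.symm.trans h2)
      · exact Or.inr (by rw [← h2, h1] at hs; exact left_eq_add.1 hs)⟩
  refine ⟨fun i j hij => by_contra fun hne => h0 i ?_, Set.Subset.antisymm ?_ fun f hf => ?_⟩
  · have : e i * e j = 0 := he.ortho hne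
    rw [← hij] at this
    exact (he.idem i).symm.trans this
  · rintro _ ⟨i, rfl⟩
    exact hprim i
  · by_contra hne
    refine hf.2.1 ?_
    rw [← mul_one f, ← he.complete, Finset.mul_sum]
    exact Finset.sum_eq_zero fun i _ => hf.mul_eq_zero (hprim i) fun hfi => hne ⟨i, hfi.symm⟩

/-- In a Noetherian ring every idempotent is a sum of primitive ones, as a proper decomposition of
`e` makes the ideal generated by `1 - e` larger. -/
theorem exists_sum_primitive [IsNoetherianRing S] (e : S) (he : IsIdempotentElem e) :
    ∃ s : Finset S, (∀ f ∈ s, IsPrimitiveIdempotent f ∧ f * e = f) ∧ ∑ f ∈ s, f = e := by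
  classical
  have hlt : ∀ f g : S, IsIdempotentElem f → IsIdempotentElem g → f * g = 0 → g ≠ 0 →
      Ideal.span {1 - (f + g)} < Ideal.span {1 - f} := by
    intro f g hf hg hfg hg0
    have hg' : g * g = g := hg
    have hf' : f * f = f := hf
    refine lt_of_le_of_ne ?_ fun h => hg0 ?_
    · rw [Ideal.span_singleton_le_span_singleton]
      exact ⟨1 - g, by linear_combination -hfg⟩
    · obtain ⟨c, hc⟩ := Ideal.mem_span_singleton.1 (h.ge (Ideal.mem_span_singleton_self (1 - f)))
      linear_combination g * hc + (-c) * hfg + (1 : S) * hfg - c * hg'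
  induction hI : Ideal.span {1 - e} using
    (wellFounded_gt (α := Ideal S)).induction generalizing e with
  | _ I ih =>
    by_cases h0 : e = 0
    · exact ⟨∅, by simp, by simp [h0]⟩
    by_cases hp : IsPrimitiveIdempotent e
    · exact ⟨{e}, by simpa using ⟨hp, he⟩, by simp⟩
    · have : ∃ f g, IsIdempotentElem f ∧ IsIdempotentElem g ∧ f * g = 0 ∧ e = f + g ∧
          f ≠ 0 ∧ g ≠ 0 := by
        by_contra hcon
        push Not at hcon
        refine hp ⟨he, h0, fun f g hf hg hfg hs => ?_⟩
        by_contra hne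
        rw [not_or] at hne
        exact hne.2 (hcon f g hf hg hfg hs hne.1)
      obtain ⟨f, g, hf, hg, hfg, rfl, hf0, hg0⟩ := this
      obtain ⟨s, hs, hs'⟩ := ih _ (hI ▸ hlt f g hf hg hfg hg0) f hf rfl
      obtain ⟨t, ht, ht'⟩ := ih _ (hI ▸ by
        rw [add_comm]; exact hlt g f hg hf (by rw [mul_comm, hfg]) hf0) g hg rfl
      have hd : Disjoint s t := Finset.disjoint_left.2 fun x hxs hxt => (hs x hxs).1.2.1 (by
        rw [← (ht x hxt).2, ← (hs x hxs).2, mul_assoc, hfg, mul_zero])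
      refine ⟨s ∪ t, fun x hx => ?_, by rw [Finset.sum_union hd, hs', ht']⟩
      rcases Finset.mem_union.1 hx with hx | hx
      · refine ⟨(hs x hx).1, ?_⟩
        have h1 := (hs x hx).2
        linear_combination h1 - g * h1 + x * hfg
      · refine ⟨(ht x hx).1, ?_⟩
        have h1 := (ht x hx).2
        linear_combination h1 - f * h1 + x * hfg

theorem exists_completeOrthogonal_primitive (S : Type*) [CommRing S] [IsNoetherianRing S] :
    ∃ (l : ℕ) (e : Fin l → S), CompleteOrthogonalIdempotents e ∧
      ∀ i, IsPrimitiveIdempotent (e i) := by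
  obtain ⟨s, hs, hs'⟩ := exists_sum_primitive (1 : S) IsIdempotentElem.one
  refine ⟨s.card, fun i => s.equivFin.symm i, ⟨⟨fun i => (hs _ (s.equivFin.symm i).2).1.1,
    fun i j hij => (hs _ (s.equivFin.symm i).2).1.mul_eq_zero (hs _ (s.equivFin.symm j).2).1
      fun h => hij (s.equivFin.symm.injective (Subtype.ext h))⟩, ?_⟩,
    fun i => (hs _ (s.equivFin.symm i).2).1⟩
  rw [← hs', ← Finset.sum_coe_sort s,
    ← Equiv.sum_comp s.equivFin.symm (fun x : s => (x : S))]

theorem IsPrimitiveIdempotent.map {S' : Type*} [CommRing S'] (f : S ≃+* S') {e : S}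
    (he : IsPrimitiveIdempotent e) : IsPrimitiveIdempotent (f e) := by
  refine ⟨he.1.map f, fun h => he.2.1 ((map_eq_zero_iff f f.injective).1 h),
    fun x y hx hy hxy hs => ?_⟩
  have h1 := he.2.2 (f.symm x) (f.symm y) (hx.map f.symm) (hy.map f.symm)
    (by rw [← map_mul, hxy, map_zero]) (by rw [← map_add, ← hs, f.symm_apply_apply])
  simpa using h1

end Primitive

end ZAlg

/-! ### Idempotents and traces -/

namespace ZAlg

open Finset

section Matrices

variable {r : ℕ}

theorem eq_zero_of_trace_eq_zero_of_idempotent {M : Matrix (Fin r) (Fin r) ℚ}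
    (hM : IsIdempotentElem M) (h : M.trace = 0) : M = 0 := by
  have h1 : IsIdempotentElem (Matrix.toLin' M) := by
    rw [IsIdempotentElem, Module.End.mul_eq_comp, ← Matrix.toLin'_mul, hM.eq]
  have h2 := LinearMap.IsIdempotentElem.eq_zero_of_trace_eq_zero h1
    (by rw [Matrix.trace_toLin'_eq]; exact h)
  exact (map_eq_zero_iff _ (Matrix.toLin' (R := ℚ)).injective).1 h2

/-- An integer matrix of trace zero with `M² = N M`, `N ≠ 0`, vanishes: over the rational numbers,
`M / N` is an idempotent of trace zero. -/
theorem eq_zero_of_trace_eq_zero {M : Matrix (Fin r) (Fin r) ℤ} {N : ℤ} (hN : N ≠ 0)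
    (hM : M * M = N • M) (h : M.trace = 0) : M = 0 := by
  have hN' : (N : ℚ) ≠ 0 := by exact_mod_cast hN
  set M' : Matrix (Fin r) (Fin r) ℚ := M.map (Int.castRingHom ℚ) with hM'
  have h1 : M' * M' = (N : ℚ) • M' := by
    rw [hM', ← Matrix.map_mul, hM]
    ext i j
    rw [Matrix.map_apply, Matrix.smul_apply, Matrix.smul_apply, Matrix.map_apply]
    simp
  have h2 : (N : ℚ)⁻¹ • M' = 0 := by
    refine eq_zero_of_trace_eq_zero_of_idempotent ?_ ?_
    · rw [IsIdempotentElem, smul_mul_smul_comm, h1, smul_smul, mul_assoc, inv_mul_cancel₀ hN', mul_one]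
    · have h3 : M'.trace = ((M.trace : ℤ) : ℚ) := by simp [Matrix.trace, hM']
      rw [Matrix.trace_smul, h3, h, Int.cast_zero, smul_zero]
  have h3 : M' = 0 := (smul_eq_zero.1 h2).resolve_left (inv_ne_zero hN')
  ext i j
  have := congrFun (congrFun h3 i) j
  simpa [hM'] using this

/-- The eigenvalues of the product of a matrix with a commuting idempotent matrix are zero or
eigenvalues of the matrix, and therefore bounded by the sum of the absolute values of its
entries. -/
theorem abs_trace_mul_le {M P : Matrix (Fin r) (Fin r) ℤ} (hP : IsIdempotentElem P)
    (hPM : P * M = M * P) : |(P * M).trace| ≤ r * ∑ i, ∑ j, |M i j| := by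
  let ψ := (Int.castRingHom ℂ).mapMatrix (m := Fin r)
  have hroot : ∀ μ ∈ (ψ (P * M)).charpoly.roots, ‖μ‖ ≤ ((∑ i, ∑ j, |M i j| : ℤ) : ℝ) := by
    intro μ hμ
    have hnn : (0 : ℝ) ≤ ((∑ i, ∑ j, |M i j| : ℤ) : ℝ) := by
      exact_mod_cast Finset.sum_nonneg fun i _ => Finset.sum_nonneg fun j _ => abs_nonneg _
    by_cases h0 : μ = 0
    · rw [h0, norm_zero]; exact hnn
    have hev : Module.End.HasEigenvalue (Matrix.toLin' (ψ (P * M))) μ := by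
      rw [Module.End.hasEigenvalue_iff_isRoot_charpoly, Matrix.charpoly_toLin']
      exact (Polynomial.mem_roots'.1 hμ).2
    obtain ⟨v, hv⟩ := hev.exists_hasEigenvector
    have hv1 : (ψ (P * M)).mulVec v = μ • v := hv.apply_eq_smul
    -- an eigenvector of `P M` for a non-zero eigenvalue is fixed by `P`
    have hPv : (ψ P).mulVec v = v := by
      have : μ • (ψ P).mulVec v = μ • v := by
        rw [← Matrix.mulVec_smul, ← hv1, Matrix.mulVec_mulVec, ← map_mul, ← mul_assoc, hP.eq]
      exact smul_right_injective _ h0 this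
    have hMv : (ψ M).mulVec v = μ • v := by
      rw [← hv1, hPM, map_mul, ← Matrix.mulVec_mulVec, hPv]
    have hev' : Module.End.HasEigenvalue (Matrix.toLin' (ψ M)) μ :=
      Module.End.hasEigenvalue_of_hasEigenvector
        ⟨Module.End.mem_eigenspace_iff.2 hMv, hv.2⟩
    -- the eigenvalue lies in a Gershgorin disc
    obtain ⟨k, hk⟩ := eigenvalue_mem_ball hev'
    have h1 : ‖μ‖ ≤ ∑ j, ‖ψ M k j‖ := by
      rw [← Finset.add_sum_erase _ _ (Finset.mem_univ k)]
      have := norm_sub_norm_le μ (ψ M k k)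
      rw [Metric.mem_closedBall, dist_eq_norm] at hk
      linarith
    refine h1.trans ?_
    have h2 : ∑ j, ‖ψ M k j‖ = ((∑ j, |M k j| : ℤ) : ℝ) := by
      push_cast
      exact Finset.sum_congr rfl fun j _ => by simp [ψ]
    rw [h2]
    exact_mod_cast Finset.single_le_sum (f := fun i => ∑ j, |M i j|)
      (fun i _ => Finset.sum_nonneg fun j _ => abs_nonneg _) (Finset.mem_univ k)
  have htr : (((P * M).trace : ℤ) : ℂ) = (ψ (P * M)).charpoly.roots.sum := by
    rw [← Matrix.trace_eq_sum_roots_charpoly]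
    simp [Matrix.trace, ψ]
  have hnorm : ‖(((P * M).trace : ℤ) : ℂ)‖ ≤ r * ((∑ i, ∑ j, |M i j| : ℤ) : ℝ) := by
    rw [htr]
    refine (norm_multiset_sum_le _).trans ?_
    have h3 := Multiset.sum_le_card_nsmul ((ψ (P * M)).charpoly.roots.map fun x => ‖x‖)
      ((∑ i, ∑ j, |M i j| : ℤ) : ℝ) (by
        intro x hx
        obtain ⟨μ, hμ, rfl⟩ := Multiset.mem_map.1 hx
        exact hroot μ hμ)
    refine h3.trans ?_
    rw [Multiset.card_map, nsmul_eq_mul]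
    refine mul_le_mul_of_nonneg_right ?_ (by
      exact_mod_cast Finset.sum_nonneg fun i _ => Finset.sum_nonneg fun j _ => abs_nonneg _)
    have := (ψ (P * M)).charpoly.card_roots'
    rw [Matrix.charpoly_natDegree_eq_dim, Fintype.card_fin] at this
    exact_mod_cast this
  rw [Complex.norm_intCast] at hnorm
  exact_mod_cast hnorm

end Matrices

section Soundness

variable {S : Type*} [CommRing S] {r : ℕ} (ρ : S →ₙ+* Matrix (Fin r) (Fin r) ℤ)

/-- If `x` has the traces of an idempotent, then `x² - x` is in the kernel of the trace form,
although `x` need not be an idempotent. -/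
theorem trace_mul_sub_eq_zero {e x : S} (he : IsIdempotentElem e)
    (hx : ∀ s, (ρ (x * s)).trace = (ρ (e * s)).trace) (s : S) :
    (ρ ((x * x - x) * s)).trace = 0 := by
  have he' : e * e = e := he
  have h1 : (x * x - x) * s = x * ((x + e - 1) * s) - e * ((x + e - 1) * s) := by
    linear_combination s * he'
  rw [h1, map_sub, Matrix.trace_sub, hx, sub_self]

/-- Two idempotents with the same traces have the same image: the square of their difference is an
idempotent, and it has trace zero. -/
theorem map_sub_eq_zero_of_trace {e q : S} (he : IsIdempotentElem e) (hq : IsIdempotentElem q)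
    (hx : ∀ s, (ρ (q * s)).trace = (ρ (e * s)).trace) : ρ (e - q) = 0 := by
  have he' : e * e = e := he
  have hq' : q * q = q := hq
  have h1 : ((e - q) * (e - q)) * (e - q) = e - q := by
    linear_combination (e - 3 * q + 1) * he' + (3 * e - q - 1) * hq'
  have h2 : ρ ((e - q) * (e - q)) = 0 := by
    refine eq_zero_of_trace_eq_zero one_ne_zero ?_ ?_
    · rw [one_smul, ← map_mul, ← mul_assoc, h1]
    · rw [sub_mul, map_sub, Matrix.trace_sub, hx, sub_self]
  rw [← h1, map_mul, h2, zero_mul]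

end Soundness

section Completeness

/-- In a ring that is free of finite rank over the integers, the kernel of the trace form consists
of nilpotent elements. -/
theorem isNilpotent_of_trace_eq_zero {A : Type*} [CommRing A] {r : ℕ}
    (b : Module.Basis (Fin r) ℤ A) {y : A}
    (hy : ∀ a, (Algebra.leftMulMatrix b (y * a)).trace = 0) : IsNilpotent y := by
  have := Module.Finite.of_basis b
  have := Module.Free.of_basis b
  -- a multiple of `y ^ (k + 1)` is divisible by `y ^ (k + 2)`
  obtain ⟨N, k, h, hN, hh⟩ : ∃ (N : ℤ) (k : ℕ) (h : A), N ≠ 0 ∧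
      N • y ^ (k + 1) = y ^ (k + 2) * h := by
    obtain ⟨p, hp, hpy⟩ := Algebra.IsIntegral.isIntegral (R := ℤ) y
    obtain ⟨g, hg, hg0⟩ := Polynomial.exists_eq_pow_rootMultiplicity_mul_and_not_dvd p hp.ne_zero 0
    rw [Polynomial.C_0, sub_zero] at hg hg0
    refine ⟨g.coeff 0, p.rootMultiplicity 0, -Polynomial.aeval y g.divX,
      fun h => hg0 (Polynomial.X_dvd_iff.2 h), ?_⟩
    have h1 : Polynomial.aeval y p = 0 := hpy
    rw [hg, ← Polynomial.divX_mul_X_add g] at h1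
    simp only [map_mul, map_add, map_pow, Polynomial.aeval_X, Polynomial.aeval_C] at h1
    rw [zsmul_eq_mul]
    have h2 : (algebraMap ℤ A) (g.coeff 0) = (g.coeff 0 : A) := rfl
    rw [h2] at h1
    linear_combination y * h1
  have hj : ∀ j, N ^ j • y ^ (k + 1) = y ^ (k + 1 + j) * h ^ j := by
    intro j
    induction j with
    | zero => simp
    | succ j ih =>
      rw [pow_succ', mul_smul, ih]
      have : N • (y ^ (k + 1 + j) * h ^ j) = (N • y ^ (k + 1)) * (y ^ j * h ^ j) := by
        rw [smul_mul_assoc]; congr 1; ring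
      rw [this, hh]
      ring
  -- a multiple of an idempotent in the ideal generated by `y`
  set u := y ^ (k + 1) * h ^ (k + 1) with hu_def
  have hu : N ^ (k + 1) • y ^ (k + 1) = y ^ (k + 1) * u := by rw [hj, hu_def]; ring
  have huu : u * u = N ^ (k + 1) • u := by
    have : N ^ (k + 1) • u = (N ^ (k + 1) • y ^ (k + 1)) * h ^ (k + 1) := by rw [smul_mul_assoc]
    rw [this, hu, hu_def]; ring
  have hu0 : u = 0 := by
    refine Algebra.leftMulMatrix_injective b ?_
    rw [map_zero]
    refine eq_zero_of_trace_eq_zero (pow_ne_zero (k + 1) hN) ?_ ?_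
    · rw [← map_mul, huu, map_zsmul]
    · have : u = y * (y ^ k * h ^ (k + 1)) := by rw [hu_def]; ring
      rw [this, hy]
  rw [hu0, mul_zero] at hu
  exact ⟨k + 1, (smul_eq_zero.1 hu).resolve_left (pow_ne_zero (k + 1) hN)⟩

/-- An additively finitely generated commutative ring has, modulo its finite torsion ideal, a
faithful integral matrix representation, and an element `x` for which `x² - x` is in the kernel of
the trace form can be replaced by an idempotent without changing the traces. -/
theorem exists_faithful_representation (S : Type*) [CommRing S] [Module.Finite ℤ S] :
    ∃ (r : ℕ) (ρ : S →ₙ+* Matrix (Fin r) (Fin r) ℤ), {s | ρ s = 0}.Finite ∧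
      ∀ x, (∀ s, (ρ ((x * x - x) * s)).trace = 0) →
        ∃ q, IsIdempotentElem q ∧ ∀ s, (ρ (q * s)).trace = (ρ (x * s)).trace := by
  -- the torsion ideal
  let I : Ideal S :=
    { carrier := {x | ∃ n : ℤ, n ≠ 0 ∧ n • x = 0}
      add_mem' := by
        rintro x y ⟨n, hn, hx⟩ ⟨m, hm, hy⟩
        exact ⟨n * m, mul_ne_zero hn hm, by
          rw [smul_add, mul_comm, mul_smul, hx, mul_comm, mul_smul, hy, smul_zero, smul_zero,
            add_zero]⟩
      zero_mem' := ⟨1, one_ne_zero, smul_zero _⟩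
      smul_mem' := by
        rintro s x ⟨n, hn, hx⟩
        exact ⟨n, hn, by rw [smul_eq_mul, ← mul_smul_comm, hx, mul_zero]⟩ }
  have hmemI : ∀ x, x ∈ I ↔ ∃ n : ℤ, n ≠ 0 ∧ n • x = 0 := fun _ => Iff.rfl
  have : Module.Finite ℤ (S ⧸ I) :=
    Module.Finite.of_surjective (Ideal.Quotient.mk I).toIntAlgHom.toLinearMap
      Ideal.Quotient.mk_surjective
  have : Module.IsTorsionFree ℤ (S ⧸ I) := by
    refine Module.IsTorsionFree.of_smul_eq_zero fun n z hz => ?_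
    obtain ⟨s, rfl⟩ := Ideal.Quotient.mk_surjective z
    rw [← map_zsmul, Ideal.Quotient.eq_zero_iff_mem] at hz
    obtain ⟨m, hm, hs⟩ := hz
    by_cases hn : n = 0
    · exact Or.inl hn
    · exact Or.inr (Ideal.Quotient.eq_zero_iff_mem.2
        ⟨m * n, mul_ne_zero hm hn, by rw [mul_smul, hs]⟩)
  have : Module.Free ℤ (S ⧸ I) := inferInstance
  let b := Module.finBasis ℤ (S ⧸ I)
  let ρ := (Algebra.leftMulMatrix b).toRingHom.comp (Ideal.Quotient.mk I)
  have hρ : ∀ s, ρ s = 0 ↔ s ∈ I := fun s => by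
    rw [← Ideal.Quotient.eq_zero_iff_mem]
    exact map_eq_zero_iff (Algebra.leftMulMatrix b) (Algebra.leftMulMatrix_injective b)
  have hfin : (I : Set S).Finite := by
    have : Module.Finite ℤ (I.restrictScalars ℤ) := Module.IsNoetherian.finite ℤ _
    have : Finite (I.restrictScalars ℤ) := Module.finite_of_fg_torsion _ fun {x} => by
      obtain ⟨n, hn, hx⟩ := (hmemI _).1 x.2
      exact ⟨⟨n, mem_nonZeroDivisors_of_ne_zero hn⟩, Subtype.ext hx⟩
    exact Set.toFinite (I.restrictScalars ℤ : Set S)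
  refine ⟨Module.finrank ℤ (S ⧸ I), ρ.toNonUnitalRingHom, ?_, fun x hx => ?_⟩
  · refine hfin.subset fun s hs => (hρ s).1 hs
  · set y := x * x - x with hy
    obtain ⟨k, hk⟩ : IsNilpotent (Ideal.Quotient.mk I y) := by
      refine isNilpotent_of_trace_eq_zero b fun a => ?_
      obtain ⟨s, rfl⟩ := Ideal.Quotient.mk_surjective a
      rw [← map_mul]
      exact hx s
    rw [← map_pow, Ideal.Quotient.eq_zero_iff_mem] at hk
    -- the powers of `y` from `y ^ k` on belong to a finite set, so that one of them is idempotent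
    obtain ⟨m, hm0, hm⟩ : ∃ m, m ≠ 0 ∧ IsIdempotentElem (y ^ m) := by
      have hI : ∀ j, y ^ (k + j) ∈ (I : Set S) := fun j => by
        rw [pow_add]; exact I.mul_mem_right _ hk
      obtain ⟨i, j, hij, h⟩ : ∃ i j, i < j ∧ y ^ (k + i) = y ^ (k + j) := by
        have := hfin.to_subtype
        obtain ⟨i, j, hne, h⟩ :=
          Finite.exists_ne_map_eq_of_infinite fun j => (⟨_, hI j⟩ : (I : Set S))
        rcases lt_or_gt_of_ne hne with hlt | hlt
        · exact ⟨i, j, hlt, congrArg Subtype.val h⟩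
        · exact ⟨j, i, hlt, congrArg Subtype.val h.symm⟩
      obtain ⟨p, rfl⟩ := Nat.exists_eq_add_of_lt hij
      have hper : ∀ n t, y ^ (k + i + n + t * (p + 1)) = y ^ (k + i + n) := by
        intro n t
        induction t with
        | zero => simp
        | succ t ih =>
          have e : k + i + n + (t + 1) * (p + 1) = k + (i + p + 1) + (n + t * (p + 1)) := by ring
          rw [e, pow_add, ← h, ← pow_add, ← ih]
          congr 1; ring
      refine ⟨(k + i + 1) * (p + 1), by positivity, ?_⟩
      have e : (k + i + 1) * (p + 1) = k + i + (1 + (k + i + 1) * p) := by ring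
      have := hper (1 + (k + i + 1) * p) (k + i + 1)
      rw [← e, pow_add] at this
      exact this
    have hm' : y ^ m * y ^ m = y ^ m := hm
    obtain ⟨z, hz⟩ : y ∣ y ^ m := dvd_pow_self y hm0
    -- `x' - x' ^ 2` is nilpotent, so that `1 - (1 - x' ^ m) ^ m` is an idempotent congruent to `x`
    -- modulo `y`; multiples of `y` have trace zero
    set x' := x * (1 - y ^ m) with hx'
    have h1 : x' - x' ^ 2 = -(y * (1 - y ^ m)) := by
      rw [hx']
      linear_combination (-x ^ 2) * hm' - (1 - y ^ m) * hy
    have h2 : (x' - x' ^ 2) ^ m = 0 := by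
      have h0 : y ^ m * (1 - y ^ m) = 0 := by linear_combination -hm'
      obtain ⟨v, hv⟩ := dvd_pow_self (1 - y ^ m) hm0
      rw [h1, neg_pow, mul_pow, hv]
      linear_combination ((-1) ^ m * v) * h0
    refine ⟨_, isIdempotentElem_one_sub_one_sub_pow_pow x' m h2, ?_⟩
    obtain ⟨w, hw⟩ : y ∣ (1 - (1 - x' ^ m) ^ m) - x := by
      rw [← Ideal.mem_span_singleton, ← Ideal.Quotient.mk_eq_mk_iff_sub_mem]
      have hx2 : IsIdempotentElem (Ideal.Quotient.mk (Ideal.span {y}) x) := by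
        rw [IsIdempotentElem, ← map_mul, Ideal.Quotient.mk_eq_mk_iff_sub_mem]
        exact Ideal.mem_span_singleton_self y
      have hxx : Ideal.Quotient.mk (Ideal.span {y}) x' = Ideal.Quotient.mk (Ideal.span {y}) x := by
        rw [Ideal.Quotient.mk_eq_mk_iff_sub_mem, Ideal.mem_span_singleton]
        exact ⟨-(x * z), by rw [hx']; linear_combination (-x) * hz⟩
      obtain ⟨l, rfl⟩ := Nat.exists_eq_succ_of_ne_zero hm0
      rw [map_sub, map_one, map_pow, map_sub, map_one, map_pow, hxx, hx2.pow_succ_eq,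
        hx2.one_sub.pow_succ_eq, sub_sub_cancel]
    intro s
    rw [sub_eq_iff_eq_add.1 hw, add_mul, map_add, Matrix.trace_add, mul_assoc]
    have := hx (w * s)
    rw [this, zero_add]

end Completeness

end ZAlg

/-! ### Certificates for systems of primitive idempotents -/

namespace ZAlg

open Finset

/-- The matrices in `M` define an additive map on `ℤᵗ` that vanishes on the relations of `B` and
respects the multiplication. -/
def IsMatRep (B : AlgCode) (r : ℕ) (M : List (List (List ℤ))) : Prop :=
  (∀ s < B.2.1.length, ∀ i < r, ∀ j < r, ∑ k ∈ range B.1, ent₂ B.2.1 s k * ent₃ M k i j = 0) ∧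
  ∀ k < B.1, ∀ l < B.1, ∀ i < r, ∀ j < r, ∑ m ∈ range r, ent₃ M k i m * ent₃ M l m j =
    ∑ u ∈ range B.1, ent₃ B.2.2 k l u * ent₃ M u i j

/-- The trace of the product of the `k`-th and the `l`-th matrix. -/
def gram (r : ℕ) (M : List (List (List ℤ))) (k l : ℕ) : ℤ :=
  ∑ i ∈ range r, ∑ j ∈ range r, ent₃ M k i j * ent₃ M l j i

/-- The matrix of the trace form. -/
def gramRows (t r : ℕ) (M : List (List (List ℤ))) : List (List ℤ) :=
  (List.range t).map fun k => (List.range t).map fun l => gram r M k l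

/-- The traces of the products of the combination of the matrices with coefficients `x` and the
given matrices. -/
def traceVec (t r : ℕ) (M : List (List (List ℤ))) (x : ℕ → ℤ) (l : ℕ) : ℤ :=
  ∑ k ∈ range t, x k * gram r M k l

/-- `b` exceeds the bound of `abs_trace_mul_le` for the traces of the products of the matrices with
idempotents. -/
def IsTraceBound (t r : ℕ) (M : List (List (List ℤ))) (b : ℕ) : Prop :=
  ∀ k < t, (r * ∑ i ∈ range r, ∑ j ∈ range r, ((ent₃ M k i j).natAbs : ℤ)).toNat < b

/-- The `k`-th coordinate of the `N`-th integer vector in the box of radius `b`. -/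
def boxVec (b N k : ℕ) : ℤ := (N / (2 * b + 1) ^ k % (2 * b + 1) : ℕ) - b

/-- The product of `x` with each vector in `E` is zero or that vector, modulo the relations. -/
def IsUnsplit (B : AlgCode) (E : List (List ℤ)) (x : ℕ → ℤ) : Prop :=
  ∀ i < E.length, LatMem B.1 B.2.1 (B.vmul x (ent₂ E i)) ∨
    LatMem B.1 B.2.1 fun c => B.vmul x (ent₂ E i) c - ent₂ E i c

/-- `x` represents an idempotent, and none of the idempotents in its coset modulo the elements in
`K` splits an element of `E`. -/
def IsUnsplitCoset (B : AlgCode) (E K : List (List ℤ)) (x : ℕ → ℤ) : Prop :=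
  (LatMem B.1 B.2.1 fun c => B.vmul x x c - x c) ∧ ∀ s < K.length,
    (LatNotMem B.1 B.2.1 fun c => B.vmul (fun i => x i + ent₂ K s i) (fun i => x i + ent₂ K s i) c -
      (x c + ent₂ K s c)) ∨ IsUnsplit B E fun c => x c + ent₂ K s c

/-- Each vector in the box of radius `b` is either not a vector of traces, or the vector of traces
of an element `x` for which `x² - x` has a non-zero trace vector, or of an idempotent whose coset
does not split `E`. -/
def IsUnsplitBox (B : AlgCode) (r : ℕ) (M : List (List (List ℤ))) (E K : List (List ℤ))
    (b : ℕ) : Prop :=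
  ∀ N < (2 * b + 1) ^ B.1, LatNotMem B.1 (gramRows B.1 r M) (boxVec b N) ∨
    ∃ x : List ℤ, (∀ l < B.1, traceVec B.1 r M (ent x) l = boxVec b N l) ∧
      ((∃ l, l < B.1 ∧ traceVec B.1 r M (fun c => B.vmul (ent x) (ent x) c - ent x c) l ≠ 0) ∨
        IsUnsplitCoset B E K (ent x))

/-- The vectors in `K` represent all elements in the kernel of the matrix representation: `K`
contains zero, and is closed under addition and subtraction of the rows of `G`, which generate the
kernel. -/
def IsKerList (B : AlgCode) (r : ℕ) (M : List (List (List ℤ))) (K : List (List ℤ)) : Prop :=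
  (∃ s, s < K.length ∧ LatMem B.1 B.2.1 (ent₂ K s)) ∧
  ∃ G, GenKer 1 [] B.1 (r * r) (fun e u _ => ent₃ M u (e / r) (e % r)) G ∧
    ∀ s < K.length, ∀ i < G.length,
      (∃ s', s' < K.length ∧ LatMem B.1 B.2.1 fun c => ent₂ K s c + ent₂ G i c - ent₂ K s' c) ∧
      ∃ s', s' < K.length ∧ LatMem B.1 B.2.1 fun c => ent₂ K s c - ent₂ G i c - ent₂ K s' c

/-- The vectors in `E` represent a complete system of non-zero orthogonal idempotents; completeness
is expressed by the action of their sum on the generators. -/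
def IsOrthSystem (B : AlgCode) (E : List (List ℤ)) : Prop :=
  (∀ i < E.length, LatNotMem B.1 B.2.1 (ent₂ E i) ∧ ∀ j < E.length,
    LatMem B.1 B.2.1 fun c => B.vmul (ent₂ E i) (ent₂ E j) c - delta i j * ent₂ E i c) ∧
  ∀ k < B.1, LatMem B.1 B.2.1 fun c =>
    ∑ i ∈ range E.length, 1 * B.vmul (ent₂ E i) (delta k) c - delta k c

/-- A certificate that the vectors in `E` represent the primitive idempotents of the commutative
ring presented by `B`. -/
def IsPrimSystem (B : AlgCode) (E : List (List ℤ)) : Prop :=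
  IsOrthSystem B E ∧ ∃ (r : ℕ) (M : List (List (List ℤ))) (b : ℕ) (K : List (List ℤ)),
    IsMatRep B r M ∧ IsTraceBound B.1 r M b ∧ IsKerList B r M K ∧ IsUnsplitBox B r M E K b

section Semi

variable {α : Type*} [Primcodable α]

@[fun_prop]
theorem primrec_gram {r k l : α → ℕ} {M : α → List (List (List ℤ))} (hr : Primrec r)
    (hM : Primrec M) (hk : Primrec k) (hl : Primrec l) :
    Primrec fun a => gram (r a) (M a) (k a) (l a) := by
  unfold gram; fun_prop

@[fun_prop]
theorem primrec_gramRows {t r : α → ℕ} {M : α → List (List (List ℤ))} (ht : Primrec t)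
    (hr : Primrec r) (hM : Primrec M) : Primrec fun a => gramRows (t a) (r a) (M a) := by
  unfold gramRows; fun_prop

@[fun_prop]
theorem primrec_traceVec {t r l : α → ℕ} {M : α → List (List (List ℤ))} {x : α → ℕ → ℤ}
    (ht : Primrec t) (hr : Primrec r) (hM : Primrec M)
    (hx : Primrec fun p : α × ℕ => x p.1 p.2) (hl : Primrec l) :
    Primrec fun a => traceVec (t a) (r a) (M a) (x a) (l a) := by
  unfold traceVec; fun_prop

@[fun_prop]
theorem primrec_boxVec {b N k : α → ℕ} (hb : Primrec b) (hN : Primrec N) (hk : Primrec k) :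
    Primrec fun a => boxVec (b a) (N a) (k a) := by
  unfold boxVec; fun_prop

theorem semi_isMatRep {B : α → AlgCode} {r : α → ℕ} {M : α → List (List (List ℤ))}
    (hB : Primrec B) (hr : Primrec r) (hM : Primrec M) :
    Semi fun a => IsMatRep (B a) (r a) (M a) := by
  refine Semi.and
    (Semi.forall_lt ?_ (Semi.forall_lt ?_ (Semi.forall_lt ?_ (Semi.eq ?_ ?_))))
    (Semi.forall_lt ?_ (Semi.forall_lt ?_ (Semi.forall_lt ?_ (Semi.forall_lt ?_ (Semi.eq ?_ ?_)))))
  all_goals fun_prop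

theorem semi_isTraceBound {t r b : α → ℕ} {M : α → List (List (List ℤ))}
    (ht : Primrec t) (hr : Primrec r) (hM : Primrec M) (hb : Primrec b) :
    Semi fun a => IsTraceBound (t a) (r a) (M a) (b a) := by
  refine Semi.forall_lt ?_ (Semi.lt ?_ ?_)
  all_goals fun_prop

theorem semi_isUnsplit {B : α → AlgCode} {E : α → List (List ℤ)} {x : α → ℕ → ℤ}
    (hB : Primrec B) (hE : Primrec E) (hx : Primrec fun p : α × ℕ => x p.1 p.2) :
    Semi fun a => IsUnsplit (B a) (E a) (x a) := by
  refine Semi.forall_lt ?_ (Semi.or (semi_latMem ?_ ?_ ?_) (semi_latMem ?_ ?_ ?_))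
  all_goals fun_prop

theorem semi_isUnsplitCoset {B : α → AlgCode} {E K : α → List (List ℤ)} {x : α → ℕ → ℤ}
    (hB : Primrec B) (hE : Primrec E) (hK : Primrec K) (hx : Primrec fun p : α × ℕ => x p.1 p.2) :
    Semi fun a => IsUnsplitCoset (B a) (E a) (K a) (x a) := by
  refine Semi.and (semi_latMem ?_ ?_ ?_) (Semi.forall_lt ?_ (Semi.or (semi_latNotMem ?_ ?_ ?_)
    (semi_isUnsplit ?_ ?_ ?_)))
  all_goals fun_prop

theorem semi_isUnsplitBox {B : α → AlgCode} {r b : α → ℕ} {M : α → List (List (List ℤ))}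
    {E K : α → List (List ℤ)} (hB : Primrec B) (hr : Primrec r) (hM : Primrec M) (hE : Primrec E)
    (hK : Primrec K) (hb : Primrec b) :
    Semi fun a => IsUnsplitBox (B a) (r a) (M a) (E a) (K a) (b a) := by
  refine Semi.forall_lt ?_ (Semi.or (semi_latNotMem ?_ ?_ ?_) (Semi.ex (Semi.and
    (Semi.forall_lt ?_ (Semi.eq ?_ ?_)) (Semi.or (Semi.ex (Semi.and (Semi.lt ?_ ?_)
    (Semi.ne ?_ ?_))) (semi_isUnsplitCoset ?_ ?_ ?_ ?_)))))
  all_goals fun_prop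

theorem semi_isKerList {B : α → AlgCode} {r : α → ℕ} {M : α → List (List (List ℤ))}
    {K : α → List (List ℤ)} (hB : Primrec B) (hr : Primrec r) (hM : Primrec M) (hK : Primrec K) :
    Semi fun a => IsKerList (B a) (r a) (M a) (K a) := by
  refine Semi.and (Semi.ex (Semi.and (Semi.lt ?_ ?_) (semi_latMem ?_ ?_ ?_)))
    (Semi.ex (Semi.and (semi_genKer ?_ ?_ ?_ ?_ ?_ ?_) (Semi.forall_lt ?_ (Semi.forall_lt ?_
    (Semi.and (Semi.ex (Semi.and (Semi.lt ?_ ?_) (semi_latMem ?_ ?_ ?_)))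
    (Semi.ex (Semi.and (Semi.lt ?_ ?_) (semi_latMem ?_ ?_ ?_))))))))
  all_goals fun_prop

theorem semi_isOrthSystem {B : α → AlgCode} {E : α → List (List ℤ)} (hB : Primrec B)
    (hE : Primrec E) : Semi fun a => IsOrthSystem (B a) (E a) := by
  refine Semi.and (Semi.forall_lt ?_ (Semi.and (semi_latNotMem ?_ ?_ ?_) (Semi.forall_lt ?_
    (semi_latMem ?_ ?_ ?_)))) (Semi.forall_lt ?_ (semi_latMem ?_ ?_ ?_))
  all_goals fun_prop

theorem semi_isPrimSystem {B : α → AlgCode} {E : α → List (List ℤ)} (hB : Primrec B)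
    (hE : Primrec E) : Semi fun a => IsPrimSystem (B a) (E a) := by
  refine Semi.and (semi_isOrthSystem ?_ ?_) (Semi.ex (Semi.ex (Semi.ex (Semi.ex (Semi.and
    (semi_isMatRep ?_ ?_ ?_) (Semi.and (semi_isTraceBound ?_ ?_ ?_ ?_) (Semi.and
    (semi_isKerList ?_ ?_ ?_ ?_) (semi_isUnsplitBox ?_ ?_ ?_ ?_ ?_ ?_))))))))
  all_goals fun_prop

end Semi

end ZAlg

/-! ### Correctness of the certificates for primitive idempotents -/

namespace ZAlg

open Finset

theorem exists_digits (m t : ℕ) (w : ℕ → ℕ) (hw : ∀ k < t, w k < m) :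
    ∃ N < m ^ t, ∀ k < t, N / m ^ k % m = w k := by
  induction t with
  | zero => exact ⟨0, by simp, by simp⟩
  | succ t ih =>
    obtain ⟨N, hN, h⟩ := ih fun k hk => hw k (hk.trans (Nat.lt_succ_self t))
    have ht := hw t (Nat.lt_succ_self t)
    have hm : 0 < m := by omega
    refine ⟨N + m ^ t * w t, ?_, fun k hk => ?_⟩
    · calc N + m ^ t * w t < m ^ t + m ^ t * w t := by omega
        _ = m ^ t * (w t + 1) := by ring
        _ ≤ m ^ t * m := Nat.mul_le_mul_left _ ht
        _ = m ^ (t + 1) := (pow_succ m t).symm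
    · rcases Nat.lt_succ_iff_lt_or_eq.1 hk with hk | rfl
      · rw [← h k hk]
        obtain ⟨p, rfl⟩ := Nat.exists_eq_add_of_lt hk
        have e : m ^ (k + p + 1) * w (k + p + 1) = m ^ k * (m * (m ^ p * w (k + p + 1))) := by ring
        rw [e, Nat.add_mul_div_left _ _ (pow_pos hm k), Nat.add_mul_mod_self_left]
      · rw [Nat.add_mul_div_left _ _ (pow_pos hm k), Nat.div_eq_of_lt hN, zero_add,
          Nat.mod_eq_of_lt ht]

theorem exists_boxVec {b t : ℕ} {v : ℕ → ℤ} (hv : ∀ k < t, |v k| ≤ b) :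
    ∃ N < (2 * b + 1) ^ t, ∀ k < t, boxVec b N k = v k := by
  obtain ⟨N, hN, h⟩ := exists_digits (2 * b + 1) t (fun k => (v k + b).toNat) fun k hk => by
    have := abs_le.1 (hv k hk)
    omega
  refine ⟨N, hN, fun k hk => ?_⟩
  have := abs_le.1 (hv k hk)
  rw [boxVec, h k hk]
  omega

section

variable {S : Type u} [CommRing S] {B : AlgCode} {φ : Fin B.1 → S} {r : ℕ}
  {M : List (List (List ℤ))} {E K : List (List ℤ)} {b : ℕ}

/-- The matrices in `M` are the values of `ρ` at the generators. -/
def IsMatOf (φ : Fin B.1 → S) (ρ : S →ₙ+* Matrix (Fin r) (Fin r) ℤ)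
    (M : List (List (List ℤ))) : Prop :=
  ∀ k < B.1, ∀ i j : Fin r, ρ (val B φ (delta k)) i j = ent₃ M k i j

variable {ρ : S →ₙ+* Matrix (Fin r) (Fin r) ℤ}

theorem IsMatOf.apply_val (hρ : IsMatOf φ ρ M) (x : ℕ → ℤ) (i j : Fin r) :
    ρ (val B φ x) i j = ∑ k ∈ range B.1, x k * ent₃ M k i j := by
  rw [val_eq_sum_delta, map_sum, Matrix.sum_apply]
  refine Finset.sum_congr rfl fun k hk => ?_
  rw [map_zsmul, Matrix.smul_apply, hρ k (Finset.mem_range.1 hk), smul_eq_mul]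

theorem IsMatOf.gram_eq (hρ : IsMatOf φ ρ M) {k l : ℕ} (hk : k < B.1) (hl : l < B.1) :
    gram r M k l = (ρ (val B φ (delta k) * val B φ (delta l))).trace := by
  rw [map_mul, Matrix.trace, gram, Finset.sum_range]
  refine Finset.sum_congr rfl fun i _ => ?_
  rw [Matrix.diag_apply, Matrix.mul_apply, Finset.sum_range]
  exact Finset.sum_congr rfl fun j _ => by rw [hρ k hk, hρ l hl]

theorem IsMatOf.traceVec_eq (hρ : IsMatOf φ ρ M) (x : ℕ → ℤ) {l : ℕ} (hl : l < B.1) :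
    traceVec B.1 r M x l = (ρ (val B φ x * val B φ (delta l))).trace := by
  rw [val_eq_sum_delta x, Finset.sum_mul, map_sum, Matrix.trace_sum]
  refine Finset.sum_congr rfl fun k hk => ?_
  rw [smul_mul_assoc, map_zsmul, Matrix.trace_smul, ← hρ.gram_eq (Finset.mem_range.1 hk) hl,
    smul_eq_mul]

variable (h : B.Presents S φ)
include h

theorem IsMatRep.exists_isMatOf (hM : IsMatRep B r M) :
    ∃ ρ : S →ₙ+* Matrix (Fin r) (Fin r) ℤ, IsMatOf φ ρ M := by
  let m : ℕ → Matrix (Fin r) (Fin r) ℤ := fun k => Matrix.of fun i j => ent₃ M k i j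
  let g : (ℕ → ℤ) →+ Matrix (Fin r) (Fin r) ℤ :=
    AddMonoidHom.mk' (fun x => ∑ k ∈ range B.1, x k • m k) fun x y => by
      simp only [Pi.add_apply, add_smul, Finset.sum_add_distrib]
  have hg' : ∀ x, g x = ∑ k ∈ range B.1, x k • m k := fun _ => rfl
  have hg : ∀ x i j, g x i j = ∑ k ∈ range B.1, x k * ent₃ M k i j := fun x i j => by
    rw [hg', Matrix.sum_apply]
    rfl
  have hm : ∀ k < B.1, ∀ l < B.1, m k * m l = ∑ u ∈ range B.1, ent₃ B.2.2 k l u • m u := by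
    intro k hk l hl
    ext i j
    rw [Matrix.mul_apply, Matrix.sum_apply]
    have := hM.2 k hk l hl i i.2 j j.2
    rw [Finset.sum_range] at this
    exact this
  have hker : (val B φ).ker ≤ g.ker := by
    intro x hx
    obtain ⟨y, hy⟩ := (latMem_iff_val h).2 hx
    refine Matrix.ext fun i j => ?_
    rw [hg, Finset.sum_congr rfl fun k hk => by rw [hy k (Finset.mem_range.1 hk), Finset.sum_mul],
      Finset.sum_comm]
    refine Finset.sum_eq_zero fun s hs => ?_
    have := hM.1 s (Finset.mem_range.1 hs) i i.2 j j.2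
    simp only [mul_assoc, ← Finset.mul_sum, this, mul_zero]
  let ρ := AddMonoidHom.liftOfSurjective (val B φ) (val_surjective h) ⟨g, hker⟩
  have hρ : ∀ x, ρ (val B φ x) = g x := fun x =>
    AddMonoidHom.liftOfRightInverse_comp_apply _ _ _ ⟨g, hker⟩ x
  have hmul : ∀ a c, ρ (a * c) = ρ a * ρ c := by
    intro a c
    obtain ⟨x, rfl⟩ := val_surjective h a
    obtain ⟨y, rfl⟩ := val_surjective h c
    rw [← val_vmul h, hρ, hρ, hρ]
    rw [hg', hg', hg', Finset.sum_mul_sum]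
    simp only [AlgCode.vmul, Finset.sum_smul]
    rw [Finset.sum_comm]
    refine Finset.sum_congr rfl fun k hk => ?_
    rw [Finset.sum_comm]
    refine Finset.sum_congr rfl fun l hl => ?_
    rw [smul_mul_smul_comm, hm k (Finset.mem_range.1 hk) l (Finset.mem_range.1 hl),
      Finset.smul_sum]
    simp only [mul_smul]
  exact ⟨{ ρ with map_mul' := hmul, map_zero' := ρ.map_zero, map_add' := ρ.map_add },
    fun k hk i j => by
      change ρ (val B φ (delta k)) i j = _
      rw [hρ, hg, Finset.sum_eq_single k (fun l _ hl => by simp [delta, hl.symm])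
        (fun h => absurd (Finset.mem_range.2 hk) h)]
      simp [delta]⟩

theorem IsMatOf.isMatRep (hρ : IsMatOf φ ρ M) : IsMatRep B r M := by
  refine ⟨fun s hs i hi j hj => ?_, fun k hk l hl i hi j hj => ?_⟩
  · rw [← hρ.apply_val (ent₂ B.2.1 s) ⟨i, hi⟩ ⟨j, hj⟩, (latMem_iff_val h).1, map_zero]
    · rfl
    · obtain ⟨y, -, hy⟩ := List.exists_getD_eq (0 : ℤ) B.2.1.length (delta s)
      exact ⟨y, fun c _ => (sum_delta_rows _ s c).trans (Finset.sum_congr rfl fun u hu => by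
        rw [← hy u (Finset.mem_range.1 hu)])⟩
  · have h1 : val B φ (delta k) * val B φ (delta l) = val B φ fun u => ent₃ B.2.2 k l u := by
      rw [← val_vmul h]
      congr 1
      funext u
      rw [AlgCode.vmul, Finset.sum_eq_single k (fun i _ hi => by simp [delta, hi.symm])
        (fun h => absurd (Finset.mem_range.2 hk) h),
        Finset.sum_eq_single l (fun i _ hi => by simp [delta, hi.symm])
        (fun h => absurd (Finset.mem_range.2 hl) h)]
      simp [delta]
    rw [← hρ.apply_val (fun u => ent₃ B.2.2 k l u) ⟨i, hi⟩ ⟨j, hj⟩, ← h1, map_mul,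
      Matrix.mul_apply, Finset.sum_range]
    exact Finset.sum_congr rfl fun m _ => by rw [hρ k hk, hρ l hl]

theorem IsMatOf.trace_congr (hρ : IsMatOf φ ρ M) {x y : ℕ → ℤ}
    (hxy : ∀ l < B.1, traceVec B.1 r M x l = traceVec B.1 r M y l) (s : S) :
    (ρ (val B φ x * s)).trace = (ρ (val B φ y * s)).trace := by
  obtain ⟨z, rfl⟩ := val_surjective h s
  rw [val_eq_sum_delta z, Finset.mul_sum, Finset.mul_sum, map_sum, map_sum, Matrix.trace_sum,
    Matrix.trace_sum]
  refine Finset.sum_congr rfl fun l hl => ?_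
  have := hxy l (Finset.mem_range.1 hl)
  rw [hρ.traceVec_eq _ (Finset.mem_range.1 hl), hρ.traceVec_eq _ (Finset.mem_range.1 hl)] at this
  rw [mul_smul_comm, mul_smul_comm, map_zsmul, map_zsmul, Matrix.trace_smul, Matrix.trace_smul,
    this]

omit h in
theorem latMem_one_nil {x : ℕ → ℤ} : LatMem 1 [] x ↔ x 0 = 0 := by
  simp [LatMem]

omit h in
theorem forall_entry_iff {p : ℕ → ℕ → Prop} :
    (∀ e < r * r, p (e / r) (e % r)) ↔ ∀ i j : Fin r, p i j := by
  constructor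
  · intro H i j
    have hij : (r * i + j : ℕ) < r * r := by have := i.2; have := j.2; nlinarith
    have hr : 0 < r := by have := j.2; omega
    have := H _ hij
    rwa [Nat.mul_add_div hr, Nat.div_eq_of_lt j.2, add_zero, Nat.mul_add_mod,
      Nat.mod_eq_of_lt j.2] at this
  · intro H e he
    have hr : 0 < r := Nat.pos_of_ne_zero (by rintro rfl; simp at he)
    exact H ⟨e / r, Nat.div_lt_of_lt_mul he⟩ ⟨e % r, Nat.mod_lt _ hr⟩

omit h in
theorem IsMatOf.genKer_iff (hρ : IsMatOf φ ρ M) (x : ℕ → ℤ) :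
    (∀ e < r * r, LatMem 1 [] fun _ => ∑ u ∈ range B.1, x u * ent₃ M u (e / r) (e % r)) ↔
      ρ (val B φ x) = 0 := by
  simp only [latMem_one_nil]
  rw [forall_entry_iff (p := fun i j => ∑ u ∈ range B.1, x u * ent₃ M u i j = 0), ← Matrix.ext_iff]
  exact forall₂_congr fun i j => by rw [hρ.apply_val]; rfl

theorem latMem_sub_iff {x y : ℕ → ℤ} :
    (LatMem B.1 B.2.1 fun c => x c - y c) ↔ val B φ x = val B φ y := by
  rw [latMem_iff_val h, val_sub, sub_eq_zero]

theorem IsKerList.exists_val_eq (hρ : IsMatOf φ ρ M) (hK : IsKerList B r M K) {s : S}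
    (hs : ρ s = 0) : ∃ i < K.length, val B φ (ent₂ K i) = s := by
  obtain ⟨⟨i₀, hi₀, h0⟩, G, hG, hcl⟩ := hK
  obtain ⟨x, rfl⟩ := val_surjective h s
  obtain ⟨y, hy⟩ := (hG.mem_iff x).1 ((hρ.genKer_iff x).2 hs)
  have hx : val B φ x = ∑ i ∈ range G.length, y i • val B φ (ent₂ G i) := by
    rw [← val_sum]
    exact val_congr hy
  have key : ∀ a ∈ AddSubgroup.closure {a | ∃ i < G.length, val B φ (ent₂ G i) = a},
      ∀ i < K.length, (∃ j < K.length, val B φ (ent₂ K j) = val B φ (ent₂ K i) + a) ∧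
        ∃ j < K.length, val B φ (ent₂ K j) = val B φ (ent₂ K i) - a := by
    intro a ha
    induction ha using AddSubgroup.closure_induction with
    | mem a ha =>
      obtain ⟨k, hk, rfl⟩ := ha
      intro i hi
      obtain ⟨⟨j, hj, h1⟩, l, hl, h2⟩ := hcl i hi k hk
      refine ⟨⟨j, hj, ?_⟩, l, hl, ?_⟩
      · rw [← (latMem_sub_iff h).1 h1]
        exact map_add (val B φ) _ _
      · rw [← (latMem_sub_iff h).1 h2, val_sub]
    | zero => exact fun i hi => ⟨⟨i, hi, (add_zero _).symm⟩, i, hi, (sub_zero _).symm⟩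
    | add a c _ _ ha hc =>
      intro i hi
      obtain ⟨⟨j, hj, h1⟩, l, hl, h2⟩ := ha i hi
      obtain ⟨j', hj', h1'⟩ := (hc j hj).1
      obtain ⟨l', hl', h2'⟩ := (hc l hl).2
      exact ⟨⟨j', hj', by rw [h1', h1, add_assoc]⟩, l', hl', by rw [h2', h2, sub_sub]⟩
    | neg a _ ha =>
      intro i hi
      rw [← sub_eq_add_neg, sub_neg_eq_add]
      exact (ha i hi).symm
  obtain ⟨j, hj, h1⟩ := (key (val B φ x) (by
    rw [hx]
    refine sum_mem fun i hi => zsmul_mem (AddSubgroup.subset_closure ?_) _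
    exact ⟨i, Finset.mem_range.1 hi, rfl⟩) i₀ hi₀).1
  exact ⟨j, hj, by rw [h1, (latMem_iff_val h).1 h0, zero_add]⟩

theorem exists_isKerList (hρ : IsMatOf φ ρ M) (hfin : {s | ρ s = 0}.Finite) :
    ∃ K, IsKerList B r M K := by
  obtain ⟨G, hG⟩ := exists_genKer 1 [] B.1 (r * r) (fun e u _ => ent₃ M u (e / r) (e % r))
  choose w hw using val_surjective h
  have hlist : ∀ s, ∃ l : List ℤ, val B φ (ent l) = s := fun s => by
    obtain ⟨l, -, hl⟩ := List.exists_getD_eq (0 : ℤ) B.1 (w s)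
    exact ⟨l, (val_congr hl).trans (hw s)⟩
  choose l hl using hlist
  let K := hfin.toFinset.toList.map l
  have hK : ∀ s, ρ s = 0 → ∃ i, i < K.length ∧ val B φ (ent₂ K i) = s := by
    intro s hs
    have hmem : l s ∈ K := List.mem_map.2 ⟨s, by simpa using hs, rfl⟩
    obtain ⟨i, hi⟩ := List.mem_iff_get.1 hmem
    refine ⟨i, i.2, ?_⟩
    have : K.getD i [] = l s := by rw [← hi]; simp [List.getD_eq_getElem?_getD]
    change val B φ (ent (K.getD i [])) = s
    rw [this, hl]
  have hK' : ∀ i < K.length, ρ (val B φ (ent₂ K i)) = 0 := by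
    intro i hi
    have : K.getD i [] ∈ K := by
      rw [List.getD_eq_getElem _ _ hi]; exact List.getElem_mem hi
    obtain ⟨s, hs, hs'⟩ := List.mem_map.1 this
    change ρ (val B φ (ent (K.getD i []))) = 0
    rw [← hs', hl]
    simpa using hs
  have hG' : ∀ i < G.length, ρ (val B φ (ent₂ G i)) = 0 := fun i hi =>
    (hρ.genKer_iff _).1 fun e he => hG.1 i hi e he
  refine ⟨K, ?_, G, hG, fun i hi j hj => ⟨?_, ?_⟩⟩
  · obtain ⟨i, hi, h0⟩ := hK 0 (map_zero ρ)
    exact ⟨i, hi, (latMem_iff_val h).2 h0⟩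
  · obtain ⟨m, hm, h1⟩ := hK (val B φ (ent₂ K i) + val B φ (ent₂ G j))
      (by rw [map_add, hK' i hi, hG' j hj, add_zero])
    exact ⟨m, hm, (latMem_sub_iff h).2 (h1.trans (map_add (val B φ) _ _).symm).symm⟩
  · obtain ⟨m, hm, h1⟩ := hK (val B φ (ent₂ K i) - val B φ (ent₂ G j))
      (by rw [map_sub, hK' i hi, hG' j hj, sub_zero])
    exact ⟨m, hm, (latMem_sub_iff h).2 (h1.trans (map_sub (val B φ) _ _).symm).symm⟩

theorem isUnsplit_iff {x : ℕ → ℤ} : IsUnsplit B E x ↔ ∀ i < E.length,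
    val B φ x * val B φ (ent₂ E i) = 0 ∨ val B φ x * val B φ (ent₂ E i) = val B φ (ent₂ E i) := by
  refine forall₂_congr fun i _ => ?_
  rw [latMem_iff_val h, latMem_sub_iff h, val_vmul h]

theorem isIdempotent_iff {x : ℕ → ℤ} : (LatMem B.1 B.2.1 fun c => B.vmul x x c - x c) ↔
    IsIdempotentElem (val B φ x) := by
  rw [latMem_sub_iff h, val_vmul h]
  rfl

theorem isUnsplitCoset_iff {x : ℕ → ℤ} : IsUnsplitCoset B E K x ↔
    IsIdempotentElem (val B φ x) ∧ ∀ s < K.length,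
      IsIdempotentElem (val B φ x + val B φ (ent₂ K s)) → ∀ i < E.length,
        (val B φ x + val B φ (ent₂ K s)) * val B φ (ent₂ E i) = 0 ∨
        (val B φ x + val B φ (ent₂ K s)) * val B φ (ent₂ E i) = val B φ (ent₂ E i) := by
  refine and_congr (isIdempotent_iff h) (forall₂_congr fun s _ => ?_)
  rw [latNotMem_iff, isIdempotent_iff h (x := fun c => x c + ent₂ K s c), isUnsplit_iff h,
    ← imp_iff_not_or, show val B φ (fun c => x c + ent₂ K s c) =
      val B φ x + val B φ (ent₂ K s) from map_add (val B φ) _ _]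

/-- The vectors that pass the checks are the possible vectors of traces of idempotents, so that no
idempotent splits `E`. -/
theorem IsUnsplitBox.unsplit (hρ : IsMatOf φ ρ M) (hb : IsTraceBound B.1 r M b)
    (hK : IsKerList B r M K) (hbox : IsUnsplitBox B r M E K b) {f : S} (hf : IsIdempotentElem f)
    {i : ℕ} (hi : i < E.length) :
    f * val B φ (ent₂ E i) = 0 ∨ f * val B φ (ent₂ E i) = val B φ (ent₂ E i) := by
  obtain ⟨x, rfl⟩ := val_surjective h f
  obtain ⟨N, hN, hv⟩ : ∃ N < (2 * b + 1) ^ B.1, ∀ l < B.1, boxVec b N l = traceVec B.1 r M x l := by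
    refine exists_boxVec fun l hl => ?_
    rw [hρ.traceVec_eq x hl, map_mul]
    refine (abs_trace_mul_le (hf.map ρ) (by rw [← map_mul, mul_comm, map_mul])).trans ?_
    have h1 := hb l hl
    have h2 : (r : ℤ) * ∑ i : Fin r, ∑ j : Fin r, |ρ (val B φ (delta l)) i j| =
        r * ∑ i ∈ range r, ∑ j ∈ range r, ((ent₃ M l i j).natAbs : ℤ) := by
      rw [Finset.sum_range]
      congr 1
      refine Finset.sum_congr rfl fun i _ => ?_
      rw [Finset.sum_range]
      exact Finset.sum_congr rfl fun j _ => by rw [hρ l hl, Int.natCast_natAbs]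
    rw [h2]
    omega
  rcases hbox N hN with hnot | ⟨z, hz, hcase⟩
  · refine absurd ?_ (latNotMem_iff.1 hnot)
    obtain ⟨y, -, hy⟩ := List.exists_getD_eq (0 : ℤ) B.1 x
    refine ⟨y, fun l hl => ?_⟩
    rw [hv l hl, traceVec, gramRows, List.length_map, List.length_range]
    refine Finset.sum_congr rfl fun k hk => ?_
    have hk' := Finset.mem_range.1 hk
    rw [← hy k hk']
    simp [hk', hl]
  · have htr := hρ.trace_congr h fun l hl => (hz l hl).trans (hv l hl)
    rcases hcase with ⟨l, hl, hne⟩ | hcoset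
    · refine absurd ?_ hne
      rw [hρ.traceVec_eq _ hl, val_sub, val_vmul h]
      exact trace_mul_sub_eq_zero ρ hf htr _
    · obtain ⟨hq, hall⟩ := (isUnsplitCoset_iff h).1 hcoset
      obtain ⟨s, hs, hse⟩ := hK.exists_val_eq h hρ (map_sub_eq_zero_of_trace ρ hf hq htr)
      have := hall s hs
      rw [hse, add_sub_cancel] at this
      exact this hf i hi

theorem isOrthSystem_iff : IsOrthSystem B E ↔
    (CompleteOrthogonalIdempotents fun i : Fin E.length => val B φ (ent₂ E i)) ∧
      ∀ i : Fin E.length, val B φ (ent₂ E i) ≠ 0 := by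
  have h1 : ∀ i j, val B φ (fun c => delta i j * ent₂ E i c) =
      if i = j then val B φ (ent₂ E i) else 0 := by
    intro i j
    split_ifs with hij
    · congr 1; funext c; simp [delta, hij]
    · rw [← map_zero (val B φ)]; congr 1; funext c; simp [delta, hij]
  have h2 : ∀ k, val B φ (fun c => ∑ i ∈ range E.length, 1 * B.vmul (ent₂ E i) (delta k) c) =
      (∑ i : Fin E.length, val B φ (ent₂ E i)) * val B φ (delta k) := by
    intro k
    rw [val_sum (fun _ => 1) fun i => B.vmul (ent₂ E i) (delta k), Finset.sum_range, Finset.sum_mul]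
    exact Finset.sum_congr rfl fun i _ => by rw [one_smul, val_vmul h]
  unfold IsOrthSystem
  simp only [latNotMem_iff, latMem_sub_iff h, latMem_iff_val h, h1, h2, val_vmul h]
  constructor
  · rintro ⟨hE, hone⟩
    refine ⟨⟨⟨fun i => ?_, fun i j hij => ?_⟩, ?_⟩, fun i => (hE i i.2).1⟩
    · have := (hE i i.2).2 i i.2
      rwa [if_pos rfl] at this
    · have := (hE i i.2).2 j j.2
      rwa [if_neg (Fin.val_ne_of_ne hij)] at this
    · obtain ⟨x, hx⟩ := val_surjective h 1
      rw [← mul_one (∑ i : Fin E.length, _), ← hx, val_eq_sum_delta, Finset.mul_sum]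
      exact Finset.sum_congr rfl fun k hk => by
        rw [mul_smul_comm, hone k (Finset.mem_range.1 hk)]
  · rintro ⟨hE, h0⟩
    refine ⟨fun i hi => ⟨h0 ⟨i, hi⟩, fun j hj => ?_⟩, fun k _ => ?_⟩
    · split_ifs with hij
      · subst hij
        exact hE.idem ⟨i, hi⟩
      · exact hE.ortho (i := ⟨i, hi⟩) (j := ⟨j, hj⟩) fun h => hij (Fin.mk.inj_iff.1 h)
    · rw [hE.complete, one_mul]

theorem IsPrimSystem.primitive (hE : IsPrimSystem B E) :
    Function.Injective (fun i : Fin E.length => val B φ (ent₂ E i)) ∧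
    Set.range (fun i : Fin E.length => val B φ (ent₂ E i)) = {f | IsPrimitiveIdempotent f} := by
  obtain ⟨ho, r, M, b, K, hM, hb, hK, hbox⟩ := hE
  obtain ⟨ρ, hρ⟩ := hM.exists_isMatOf h
  obtain ⟨ho, h0⟩ := (isOrthSystem_iff h).1 ho
  exact range_eq_primitive ho h0 fun f hf i => hbox.unsplit h hρ hb hK hf i.2

theorem finite_of_presents : Module.Finite ℤ S := by
  refine ⟨⟨(Set.finite_range φ).toFinset, ?_⟩⟩
  rw [eq_top_iff]
  intro s _
  have hs : s ∈ AddSubgroup.closure (Set.range φ) := by rw [h.generates]; trivial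
  rw [← Submodule.span_int_eq_addSubgroupClosure] at hs
  simpa using hs

/-- The primitive idempotents have a certificate: every vector of traces in the box falls under one
of the three cases. -/
theorem exists_isPrimSystem : ∃ E, IsPrimSystem B E := by
  have := finite_of_presents h
  have : IsNoetherianRing S := IsNoetherianRing.of_finite ℤ S
  have hvec : ∀ s, ∃ l : List ℤ, val B φ (ent l) = s := fun s => by
    obtain ⟨w, hw⟩ := val_surjective h s
    obtain ⟨l, -, hl⟩ := List.exists_getD_eq (0 : ℤ) B.1 w
    exact ⟨l, (val_congr hl).trans hw⟩
  obtain ⟨l, e, he, hprim⟩ := exists_completeOrthogonal_primitive S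
  obtain ⟨E, rfl, hE⟩ := List.exists_getD_forall [] l
    (fun i v => ∀ hi : i < l, val B φ (ent v) = e ⟨i, hi⟩) fun i hi => by
      obtain ⟨v, hv⟩ := hvec (e ⟨i, hi⟩)
      exact ⟨v, fun _ => hv⟩
  have hEe : (fun i : Fin E.length => val B φ (ent₂ E i)) = e := funext fun i => hE i i.2 i.2
  obtain ⟨r, ρ, hfin, hlift⟩ := exists_faithful_representation S
  obtain ⟨M, -, hM⟩ := List.exists_getD_forall [] B.1
    (fun k m => ∀ i j : Fin r, ent₂ m i j = ρ (val B φ (delta k)) i j) fun k _ =>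
      ⟨List.ofFn fun i : Fin r => List.ofFn fun j : Fin r => ρ (val B φ (delta k)) i j,
        fun i j => by simp [List.getD_eq_getElem?_getD]⟩
  have hρ : IsMatOf φ ρ M := fun k hk i j => (hM k hk i j).symm
  obtain ⟨K, hK⟩ := exists_isKerList h hρ hfin
  have hunsplit : ∀ f, IsIdempotentElem f → ∀ i < E.length,
      f * val B φ (ent₂ E i) = 0 ∨ f * val B φ (ent₂ E i) = val B φ (ent₂ E i) := by
    intro f hf i hi
    have h1 : val B φ (ent₂ E i) = e ⟨i, hi⟩ := hE i hi hi
    rw [h1]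
    exact (hprim _).mul_eq hf
  -- the sum of the bounds at the generators, plus one, exceeds each of them
  let bd : ℕ → ℕ := fun k =>
    (r * ∑ i ∈ range r, ∑ j ∈ range r, ((ent₃ M k i j).natAbs : ℤ)).toNat
  refine ⟨E, (isOrthSystem_iff h).2 ⟨hEe ▸ he, fun i => ?_⟩, r, M,
    ∑ k ∈ range B.1, bd k + 1, K, hρ.isMatRep h, fun k hk => ?_, hK, fun N _ => ?_⟩
  · rw [congrFun hEe i]
    exact (hprim i).2.1
  · exact Nat.lt_succ_of_le (Finset.single_le_sum (f := bd) (fun _ _ => Nat.zero_le _)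
      (Finset.mem_range.2 hk))
  · rw [latNotMem_iff, ← imp_iff_not_or]
    rintro ⟨x, hx⟩
    have hx' : ∀ l < B.1, traceVec B.1 r M (ent x) l =
        boxVec (∑ k ∈ range B.1, bd k + 1) N l := by
      intro l hl
      rw [hx l hl, traceVec, gramRows, List.length_map, List.length_range]
      refine Finset.sum_congr rfl fun k hk => ?_
      simp [Finset.mem_range.1 hk, hl]
    by_cases hne : ∃ l, l < B.1 ∧
        traceVec B.1 r M (fun c => B.vmul (ent x) (ent x) c - ent x c) l ≠ 0
    · exact ⟨x, hx', Or.inl hne⟩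
    · push Not at hne
      obtain ⟨q, hq, htr⟩ := hlift (val B φ (ent x)) fun s => by
        have := hρ.trace_congr h (x := fun c => B.vmul (ent x) (ent x) c - ent x c) (y := 0)
          (fun l hl => by rw [hne l hl]; simp [traceVec]) s
        rw [val_sub, val_vmul h] at this
        rw [this, map_zero, zero_mul, map_zero, Matrix.trace_zero]
      obtain ⟨y, rfl⟩ := hvec q
      refine ⟨y, fun l hl => ?_, Or.inr ((isUnsplitCoset_iff h).2
        ⟨hq, fun s _ hs i hi => hunsplit _ hs i hi⟩)⟩
      rw [← hx' l hl, hρ.traceVec_eq _ hl, hρ.traceVec_eq _ hl, htr]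

end

end ZAlg

/-! ### The second step -/

namespace ZAlg

open Finset

/-- The polynomials in `E` are linear forms for a certified system of primitive idempotents of the
ring that is given by a multiplication table of the tuples in `D`. -/
def IsIdemForms (C : AlgCode) (D : List (List (List ℤ))) (E : IdemCode) : Prop :=
  ∃ Λ c V, IsTable C D Λ c ∧ IsPrimSystem (D.length, Λ, c) V ∧
    E = V.map fun v => linCode D.length (ent v)

theorem semi_step2 : Semi fun x : (AlgCode × ScalarsCode) × IdemCode =>
    IsIdemForms x.1.1 x.1.2.1 x.2 := by
  refine Semi.ex (Semi.ex (Semi.ex (Semi.and (semi_isTable ?_ ?_ ?_ ?_) (Semi.and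
    (semi_isPrimSystem ?_ ?_) (Semi.eq ?_ ?_)))))
  all_goals fun_prop

theorem aeval_toPoly {S : Type*} [CommRing S] {t : ℕ} (f : Fin t → S) (p : PolyCode) :
    MvPolynomial.aeval f (p.toPoly t) = p.evalAt f := by
  rw [PolyCode.toPoly, PolyCode.evalAt, map_list_sum, List.map_map]
  congr 1
  refine List.map_congr_left fun c _ => ?_
  rw [Function.comp_apply, map_mul, map_list_prod, List.map_ofFn, zsmul_eq_mul]
  congr 2
  · simp
  · congr 1
    funext k
    simp

theorem aeval_toPoly_linCode {S : Type*} [CommRing S] {t : ℕ} (f : Fin t → S) (v : ℕ → ℤ) :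
    MvPolynomial.aeval f ((linCode t v).toPoly t) = ∑ k : Fin t, v k • f k := by
  simp only [toPoly_linCode, map_sum, map_zsmul, MvPolynomial.aeval_X]

/-- `ℤ[x_1, …, x_t]/I` is isomorphic to a ring with additive generators `f_k` if `I` is the ideal of
relations between them. -/
theorem exists_quotient_equiv {S : Type*} [CommRing S] {t : ℕ} {f : Fin t → S}
    {J : Ideal (MvPolynomial (Fin t) ℤ)} (hgen : AddSubgroup.closure (Set.range f) = ⊤)
    (hker : RingHom.ker (MvPolynomial.aeval f : MvPolynomial (Fin t) ℤ →ₐ[ℤ] S) = J) :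
    ∃ Ψ : (MvPolynomial (Fin t) ℤ ⧸ J) ≃+* S,
      ∀ p, Ψ (Ideal.Quotient.mk J p) = MvPolynomial.aeval f p := by
  let A : MvPolynomial (Fin t) ℤ →ₐ[ℤ] S := MvPolynomial.aeval f
  have hsurj : Function.Surjective A := by
    intro s
    have hs : s ∈ AddSubgroup.closure (Set.range f) := by rw [hgen]; trivial
    have hle : AddSubgroup.closure (Set.range f) ≤ A.toRingHom.toAddMonoidHom.range := by
      rw [AddSubgroup.closure_le]
      rintro _ ⟨k, rfl⟩
      exact ⟨MvPolynomial.X k, MvPolynomial.aeval_X f k⟩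
    exact hle hs
  subst hker
  exact ⟨RingHom.quotientKerEquivOfSurjective (f := A.toRingHom) hsurj, fun p => rfl⟩

section

variable {R : Type u} [NonUnitalNonAssocRing R] {C : AlgCode} {a : Fin C.1 → R}
  (h : C.Presents R a) {D : ScalarsCode} (hD : IsStep1 C R a D)
include h hD

theorem IsIdemForms.isStep2 {E : IdemCode} (hE : IsIdemForms C D.1 E) : IsStep2 D E := by
  obtain ⟨f, hf, hgen, hker⟩ := isStep1_iff.1 hD
  obtain ⟨Λ, c, V, hT, hV, hEV⟩ := hE
  obtain ⟨Ψ, hΨ⟩ := exists_quotient_equiv hgen hker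
  obtain ⟨hinj, hrange⟩ := hV.primitive (hT.presents h hf hgen)
  have hlen : E.length = V.length := by rw [hEV, List.length_map]
  have hval : ∀ i : Fin E.length, Ψ (Ideal.Quotient.mk D.ideal ((E.get i).toPoly D.t)) =
      val (D.1.length, Λ, c) (fun k => f k) (ent₂ V i) := by
    intro i
    have hi : (i : ℕ) < V.length := hlen ▸ i.2
    have hget : E.get i = linCode D.1.length (ent (V.getD i [])) := by
      subst hEV
      simp [List.getD_eq_getElem?_getD, hi]
    rw [hΨ, hget, aeval_toPoly_linCode]
    rfl
  constructor
  · intro i j hij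
    have h1 : Ψ (Ideal.Quotient.mk D.ideal ((E.get i).toPoly D.t)) =
      Ψ (Ideal.Quotient.mk D.ideal ((E.get j).toPoly D.t)) := congrArg Ψ hij
    rw [hval, hval] at h1
    have h2 := @hinj ⟨i, hlen ▸ i.2⟩ ⟨j, hlen ▸ j.2⟩ h1
    exact Fin.ext (Fin.mk.inj_iff.1 h2)
  · ext e
    constructor
    · rintro ⟨i, rfl⟩
      have h1 : IsPrimitiveIdempotent
          (Ψ (Ideal.Quotient.mk D.ideal ((E.get i).toPoly D.t))) := by
        rw [hval]
        exact hrange.subset ⟨⟨i, hlen ▸ i.2⟩, rfl⟩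
      simpa using h1.map Ψ.symm
    · intro he
      obtain ⟨i, hi⟩ := hrange.superset (IsPrimitiveIdempotent.map Ψ he)
      refine ⟨⟨i, by rw [hlen]; exact i.2⟩, Ψ.injective ?_⟩
      beta_reduce
      rw [hval, ← hi]

theorem exists_isIdemForms : ∃ E, IsIdemForms C D.1 E := by
  obtain ⟨f, hf, hgen, hker⟩ := isStep1_iff.1 hD
  obtain ⟨Λ, c, hT⟩ := exists_isTable h hf hgen
  obtain ⟨V, hV⟩ := exists_isPrimSystem (hT.presents h hf hgen)
  exact ⟨_, Λ, c, V, hT, hV, rfl⟩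

end

end ZAlg

/-! ### The third step -/

namespace ZAlg

open Finset

/-- The product of the row vector `v` with the matrix number `q` of the `k`-th tuple in `D`. -/
def rowMul (n q : ℕ) (D : List (List (List ℤ))) (k : ℕ) (v : List ℤ) : List ℤ :=
  (List.range n).map (app n q (tupleStore n D k) (ent v))

/-- The product of the row vector `v` with the powers, with exponents in `α`, of the matrices of
the tuples with numbers in `l`. -/
def monoRow (n q : ℕ) (D : List (List (List ℤ))) (l α : List ℕ) (v : List ℤ) : List ℤ :=
  l.foldl (fun v k => (rowMul n q D k)^[α.getD k 0] v) v

/-- Row number `j` of the value of the polynomial `p` at the matrices of the tuples in `D`. -/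
def evalRow (n q : ℕ) (D : List (List (List ℤ))) (p : PolyCode) (j c : ℕ) : ℤ :=
  ∑ i ∈ range p.length, (p.getD i (0, [])).1 *
    ent (monoRow n q D (List.range D.length) (p.getD i (0, [])).2
      ((List.range n).map (delta j))) c

/-- The condition for the vectors in `P` to represent the elements `r_{ij}`. -/
def IsParts (C : AlgCode) (D : List (List (List ℤ))) (E : IdemCode) (P : PartsCode) : Prop :=
  ∀ i < E.length, ∀ j < C.1, ∀ k < C.1,
    LatMem C.1 C.2.1 (C.vmul
      (fun c => ent₃ P i j c - evalRow C.1 0 D (E.getD i []) j c) (delta k)) ∧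
    LatMem C.1 C.2.1 (C.vmul (delta k)
      fun c => ent₃ P i j c - evalRow C.1 1 D (E.getD i []) j c)

section Semi

variable {α : Type*} [Primcodable α]

@[fun_prop]
theorem primrec_rowMul {n q k : α → ℕ} {D : α → List (List (List ℤ))} {v : α → List ℤ}
    (hn : Primrec n) (hq : Primrec q) (hD : Primrec D) (hk : Primrec k) (hv : Primrec v) :
    Primrec fun a => rowMul (n a) (q a) (D a) (k a) (v a) := by
  unfold rowMul; fun_prop

@[fun_prop]
theorem primrec_monoRow {n q : α → ℕ} {D : α → List (List (List ℤ))} {l e : α → List ℕ}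
    {v : α → List ℤ} (hn : Primrec n) (hq : Primrec q) (hD : Primrec D) (hl : Primrec l)
    (he : Primrec e) (hv : Primrec v) :
    Primrec fun a => monoRow (n a) (q a) (D a) (l a) (e a) (v a) := by
  unfold monoRow; fun_prop

@[fun_prop]
theorem primrec_evalRow {n q j c : α → ℕ} {D : α → List (List (List ℤ))} {p : α → PolyCode}
    (hn : Primrec n) (hq : Primrec q) (hD : Primrec D) (hp : Primrec p) (hj : Primrec j)
    (hc : Primrec c) : Primrec fun a => evalRow (n a) (q a) (D a) (p a) (j a) (c a) := by
  unfold evalRow; fun_prop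

theorem semi_step3 : Semi fun x : (AlgCode × ScalarsCode × IdemCode) × PartsCode =>
    IsParts x.1.1 x.1.2.1.1 x.1.2.2 x.2 := by
  refine Semi.forall_lt ?_ (Semi.forall_lt ?_ (Semi.forall_lt ?_ (Semi.and
    (semi_latMem ?_ ?_ ?_) (semi_latMem ?_ ?_ ?_))))
  all_goals fun_prop

end Semi

theorem List.sum_map_eq_sum_range {β γ : Type*} [AddCommMonoid γ] (l : List β) (F : β → γ) (d : β) :
    (l.map F).sum = ∑ i ∈ range l.length, F (l.getD i d) := by
  induction l with
  | nil => simp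
  | cons x l ih =>
    rw [List.map_cons, List.sum_cons, List.length_cons, Finset.sum_range_succ', ih, add_comm]
    simp

theorem ent_map_range {n i : ℕ} (hi : i < n) (x : ℕ → ℤ) : ent ((List.range n).map x) i = x i := by
  simp [hi]

theorem ofFn_eq_map_range {β : Type*} (t : ℕ) (g : ℕ → β) :
    (List.ofFn fun k : Fin t => g k) = (List.range t).map g :=
  List.ext_getElem (by simp) (by simp)

/-- The matrix number `q` of the `k`-th tuple. -/
def tupleMat (n q : ℕ) (D : List (List (List ℤ))) (k : ℕ) : Matrix (Fin n) (Fin n) ℤ :=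
  Matrix.of fun i j => tupleStore n D k (Nat.pair q (Nat.pair i j))

section Eval

variable {n q : ℕ} {D : List (List (List ℤ))}

theorem rowMul_eq (k : ℕ) (v : List ℤ) : (fun c : Fin n => ent (rowMul n q D k v) c) =
    Matrix.vecMul (fun c : Fin n => ent v c) (tupleMat n q D k) := by
  funext c
  rw [rowMul, ent_map_range c.2, app, Finset.sum_range]
  rfl

theorem iterate_rowMul_eq (k m : ℕ) (v : List ℤ) :
    (fun c : Fin n => ent ((rowMul n q D k)^[m] v) c) =
      Matrix.vecMul (fun c : Fin n => ent v c) (tupleMat n q D k ^ m) := by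
  induction m generalizing v with
  | zero => simp
  | succ m ih => rw [Function.iterate_succ_apply, ih, rowMul_eq, Matrix.vecMul_vecMul, pow_succ']

theorem monoRow_eq (l α : List ℕ) (v : List ℤ) :
    (fun c : Fin n => ent (monoRow n q D l α v) c) =
      Matrix.vecMul (fun c : Fin n => ent v c)
        (l.map fun k => tupleMat n q D k ^ α.getD k 0).prod := by
  induction l generalizing v with
  | nil => simp [monoRow]
  | cons k l ih =>
    have : monoRow n q D (k :: l) α v = monoRow n q D l α ((rowMul n q D k)^[α.getD k 0] v) := rfl
    rw [this, ih, iterate_rowMul_eq, Matrix.vecMul_vecMul, List.map_cons, List.prod_cons]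

theorem evalRow_eq (p : PolyCode) (j c : Fin n) : evalRow n q D p j c =
    p.evalAt (fun k : Fin D.length => tupleMat n q D k) j c := by
  rw [PolyCode.evalAt, List.sum_map_eq_sum_range _ _ (0, []), Matrix.sum_apply]
  refine Finset.sum_congr rfl fun i _ => ?_
  rw [ofFn_eq_map_range _ fun k => tupleMat n q D k ^ (p.getD i (0, [])).2.getD k 0,
    Matrix.smul_apply, smul_eq_mul]
  congr 1
  refine (congrFun (monoRow_eq _ _ _) c).trans ?_
  have : (fun c : Fin n => ent ((List.range n).map (delta j)) c) = Pi.single j 1 := by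
    funext c
    rw [ent_map_range c.2]
    simp [delta, Pi.single_apply, Fin.ext_iff, eq_comm]
  rw [this, Matrix.single_one_vecMul]
  rfl

/-- If the tuples represent commuting endomorphisms, then the rows of a value of a polynomial at the
matrices represent the values of the corresponding endomorphism. -/
theorem apply_evalAt {S N : Type*} [CommRing S] [AddCommGroup N] (θ : S →+* AddMonoid.End N)
    (π : (ℕ → ℤ) →+ N) {f : ℕ → S} (hπ : ∀ x y : ℕ → ℤ, (∀ i < n, x i = y i) → π x = π y)
    (hf : ∀ k < D.length, ∀ w, θ (f k) (π w) = π (app n q (tupleStore n D k) w))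
    (p : PolyCode) (j : ℕ) :
    θ (p.evalAt fun k : Fin D.length => f k) (π (delta j)) = π (evalRow n q D p j) := by
  have h1 : ∀ k < D.length, ∀ v, π (ent (rowMul n q D k v)) = θ (f k) (π (ent v)) := by
    intro k hk v
    rw [hf k hk]
    exact hπ _ _ fun i hi => ent_map_range hi _
  have h2 : ∀ k < D.length, ∀ m v,
      π (ent ((rowMul n q D k)^[m] v)) = θ (f k ^ m) (π (ent v)) := by
    intro k hk m
    induction m with
    | zero => intro v; rw [pow_zero, map_one]; rfl
    | succ m ih =>
      intro v
      rw [Function.iterate_succ_apply, ih, h1 k hk, pow_succ, map_mul]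
      rfl
  have h3 : ∀ (α l : List ℕ), (∀ k ∈ l, k < D.length) → ∀ v, π (ent (monoRow n q D l α v)) =
      θ (l.map fun k => f k ^ α.getD k 0).prod (π (ent v)) := by
    intro α l
    induction l with
    | nil => intro _ v; rw [List.map_nil, List.prod_nil, map_one]; rfl
    | cons k l ih =>
      intro hl v
      have : monoRow n q D (k :: l) α v =
        monoRow n q D l α ((rowMul n q D k)^[α.getD k 0] v) := rfl
      rw [this, ih fun k hk => hl k (List.mem_cons_of_mem _ hk), h2 k (hl k List.mem_cons_self),
        List.map_cons, List.prod_cons, mul_comm, map_mul]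
      rfl
  have h4 : evalRow n q D p j = ∑ i ∈ range p.length, (p.getD i (0, [])).1 •
      ent (monoRow n q D (List.range D.length) (p.getD i (0, [])).2
        ((List.range n).map (delta j))) := by
    funext c
    simp [evalRow, Finset.sum_apply]
  rw [h4, map_sum, PolyCode.evalAt, List.sum_map_eq_sum_range _ _ (0, []), map_sum]
  refine (AddMonoidHom.finsetSum_apply _ _ _).trans (Finset.sum_congr rfl fun i _ => ?_)
  rw [map_zsmul, map_zsmul, ofFn_eq_map_range _ fun k => f k ^ (p.getD i (0, [])).2.getD k 0,
    h3 _ _ (fun k hk => List.mem_range.1 hk), hπ (ent ((List.range n).map (delta j))) (delta j)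
      fun i hi => ent_map_range hi _]
  rfl

end Eval

section

variable {R : Type u} [NonUnitalNonAssocRing R] {C : AlgCode} {a : Fin C.1 → R}

theorem mkL_evalRow {D : ScalarsCode} (p : PolyCode) (j : Fin C.1) :
    mkL R (val C a (evalRow C.1 0 D.1 p j)) =
      ∑ k, (p.evalAt (D.matL C.1)) j k • (a k : R ⧸ annL R) := by
  have : (fun k : Fin D.1.length => tupleMat C.1 0 D.1 k) = D.matL C.1 := by
    funext k i j
    simp [tupleMat, tupleStore, ScalarsCode.matL, List.getD_eq_getElem?_getD]
  rw [val_apply, map_sum]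
  refine Finset.sum_congr rfl fun k _ => ?_
  rw [map_zsmul, evalRow_eq, this]
  rfl

theorem mkR_evalRow {D : ScalarsCode} (p : PolyCode) (j : Fin C.1) :
    mkR R (val C a (evalRow C.1 1 D.1 p j)) =
      ∑ k, (p.evalAt (D.matR C.1)) j k • (a k : R ⧸ annR R) := by
  have : (fun k : Fin D.1.length => tupleMat C.1 1 D.1 k) = D.matR C.1 := by
    funext k i j
    simp [tupleMat, tupleStore, ScalarsCode.matR, List.getD_eq_getElem?_getD]
  rw [val_apply, map_sum]
  refine Finset.sum_congr rfl fun k _ => ?_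
  rw [map_zsmul, evalRow_eq, this]
  rfl

/-- The third step in terms of the elements `e_i(φ_1, …, φ_t)` of `𝔖(R)`. -/
theorem isStep3_iff {D : ScalarsCode} {E : IdemCode} {P : PartsCode} {f : ℕ → algScalars R}
    (hf : ∀ k < D.1.length, Rep C a (f k).1 (tupleStore C.1 D.1 k)) :
    IsStep3 C R a D E P ↔ ∀ (i : Fin E.length) (j : Fin C.1), eta R (part C R a P i j) =
      (((E.get i).evalAt fun k : Fin D.1.length => f k).1.1 (mkL R (a j)),
        ((E.get i).evalAt fun k : Fin D.1.length => f k).1.2 (mkR R (a j))) := by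
  refine forall₂_congr fun i j => ?_
  have h1 := apply_evalAt (((RingHom.fst _ _).comp (algScalars R).subtype))
    ((mkL R).comp (val C a)) (f := f) (n := C.1) (q := 0) (D := D.1)
    (fun x y hxy => congrArg (mkL R) (val_congr hxy)) (fun k hk w => (hf k hk).fst_apply w)
    (E.get i) j
  have h2 := apply_evalAt (((RingHom.snd _ _).comp (algScalars R).subtype))
    ((mkR R).comp (val C a)) (f := f) (n := C.1) (q := 1) (D := D.1)
    (fun x y hxy => congrArg (mkR R) (val_congr hxy)) (fun k hk w => (hf k hk).snd_apply w)
    (E.get i) j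
  rw [← mkL_evalRow, ← mkR_evalRow]
  rw [AddMonoidHom.comp_apply, AddMonoidHom.comp_apply, val_delta] at h1 h2
  rw [← h1, ← h2]
  rfl

theorem eta_eq_iff {r s s' : R} : eta R r = (mkL R s, mkR R s') ↔ mkL R r = mkL R s ∧
    mkR R r = mkR R s' := Prod.ext_iff

variable (h : C.Presents R a)
include h

theorem isParts_iff {D : ScalarsCode} {E : IdemCode} {P : PartsCode} :
    IsParts C D.1 E P ↔ IsStep3 C R a D E P := by
  have key : ∀ i j, part C R a P i j = val C a (ent₃ P i j) := fun _ _ => rfl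
  have hget : ∀ i : Fin E.length, E.getD i [] = E.get i := fun i => by
    simp [List.getD_eq_getElem?_getD]
  constructor
  · intro H i j
    rw [← mkL_evalRow, ← mkR_evalRow, eta_eq_iff, mkL_val_eq_iff h, mkR_val_eq_iff h, ← hget, key]
    refine ⟨fun k hk => ?_, fun k hk => ?_⟩
    · rw [← (latMem_iff_val h).1 (H i i.2 j j.2 k hk).1, val_vmul h, val_sub]
    · rw [← (latMem_iff_val h).1 (H i i.2 j j.2 k hk).2, val_vmul h, val_sub]
  · intro H i hi j hj k hk
    have := H ⟨i, hi⟩ ⟨j, hj⟩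
    rw [← mkL_evalRow, ← mkR_evalRow, eta_eq_iff, mkL_val_eq_iff h, mkR_val_eq_iff h, ← hget,
      key] at this
    rw [latMem_iff_val h, latMem_iff_val h, val_vmul h, val_vmul h, val_sub, val_sub]
    exact ⟨this.1 k hk, this.2 k hk⟩

/-- The elements `r_{ij}` exist because `η(R)` is stable under `𝔖(R)`. -/
theorem exists_isParts {D : ScalarsCode} (hD : IsStep1 C R a D) (E : IdemCode) :
    ∃ P, IsParts C D.1 E P := by
  obtain ⟨f, hf, -, -⟩ := isStep1_iff.1 hD
  simp only [isParts_iff h, isStep3_iff hf]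
  have hex : ∀ (i : Fin E.length) (j : Fin C.1), ∃ l : List ℤ, eta R (val C a (ent l)) =
      (((E.get i).evalAt fun k : Fin D.1.length => f k).1.1 (mkL R (a j)),
        ((E.get i).evalAt fun k : Fin D.1.length => f k).1.2 (mkR R (a j))) := by
    intro i j
    obtain ⟨r, hr⟩ := ((E.get i).evalAt fun k : Fin D.1.length => f k).2.2.2.2 (a j)
    obtain ⟨w, rfl⟩ := val_surjective h r
    obtain ⟨l, -, hl⟩ := List.exists_getD_eq (0 : ℤ) C.1 w
    exact ⟨l, (congrArg _ (val_congr hl)).trans hr.symm⟩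
  choose l hl using hex
  refine ⟨List.ofFn fun i => List.ofFn fun j => l i j, fun i j => ?_⟩
  rw [← hl i j]
  have : ent₃ (List.ofFn fun i => List.ofFn fun j => l i j) i j = ent (l i j) := by
    funext c
    simp [List.getD_eq_getElem?_getD]
  rw [← this]
  rfl

end

end ZAlg

/-! ### Maximality of the ring of scalars -/

namespace ZAlg

open Finset

/-- A ring acts on a group if each of its elements corresponds, by a condition that respects sums
and products, to a unique endomorphism. -/
theorem exists_module {S N : Type*} [CommRing S] [AddCommGroup N]
    (P : S → AddMonoid.End N → Prop) (hex : ∀ s, ∃ T, P s T)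
    (huniq : ∀ s T T', P s T → P s T' → T = T') (hone : P 1 1)
    (hmul : ∀ s s' T T', P s T → P s' T' → P (s * s') (T * T'))
    (hadd : ∀ s s' T T', P s T → P s' T' → P (s + s') (T + T')) :
    ∃ _ : Module S N, ∀ s T, P s T → ∀ x : N, s • x = T x := by
  choose T hT using hex
  have hA : ∀ s s', T (s + s') = T s + T s' := fun s s' =>
    huniq _ _ _ (hT _) (hadd _ _ _ _ (hT s) (hT s'))
  let θ : S →+* AddMonoid.End N :=
    { toFun := T
      map_one' := huniq _ _ _ (hT 1) hone
      map_mul' := fun s s' => huniq _ _ _ (hT _) (hmul _ _ _ _ (hT s) (hT s'))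
      map_zero' := by have := hA 0 0; rwa [add_zero, left_eq_add] at this
      map_add' := hA }
  exact ⟨Module.compHom N θ, fun s U hU x =>
    congrArg (fun f : AddMonoid.End N => f x) (huniq _ _ _ (hT s) hU)⟩

section

variable {R : Type u} [NonUnitalNonAssocRing R]

theorem annMk_surjective : Function.Surjective (annMk R) := fun x => by
  induction x using Quotient.inductionOn with
  | h r => exact ⟨r, rfl⟩

theorem toL_surjective : Function.Surjective (toL R) := fun α => by
  obtain ⟨r, rfl⟩ := mkL_surjective α
  exact ⟨annMk R r, rfl⟩

theorem toR_surjective : Function.Surjective (toR R) := fun α => by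
  obtain ⟨r, rfl⟩ := mkR_surjective α
  exact ⟨annMk R r, rfl⟩

/-- The map `R/Ann(R) → R⁺/Ann_λ(R) × R⁺/Ann_ρ(R)` induced by `η` is injective. -/
theorem annQuot_ext {x y : AnnQuot R} (hL : toL R x = toL R y) (hR : toR R x = toR R y) :
    x = y := by
  obtain ⟨r, rfl⟩ := annMk_surjective x
  obtain ⟨s, rfl⟩ := annMk_surjective y
  refine Quotient.sound (((ann R).rel_iff r s).2 ((mem_ann R).2 ⟨?_, ?_⟩))
  · rw [← mkL_eq_zero, map_sub, sub_eq_zero]; exact hL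
  · rw [← mkR_eq_zero, map_sub, sub_eq_zero]; exact hR

/-- An element of `𝔖(R)` is determined by its action on `R/Ann(R)`. -/
theorem algScalars_ext {φ ψ : algScalars R} (hL : ∀ x, φ.1.1 (toL R x) = ψ.1.1 (toL R x))
    (hR : ∀ x, φ.1.2 (toR R x) = ψ.1.2 (toR R x)) : φ = ψ := by
  refine Subtype.ext (Prod.ext (AddMonoidHom.ext fun α => ?_) (AddMonoidHom.ext fun β => ?_))
  · obtain ⟨x, rfl⟩ := toL_surjective α; exact hL x
  · obtain ⟨x, rfl⟩ := toR_surjective β; exact hR x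

/-- The values of `f_R` generate `R²`. -/
theorem sq_hom_ext {A : Type*} [AddCommGroup A] {T T' : sq R →+ A}
    (h : ∀ α β, T (fR R α β) = T' (fR R α β)) : T = T' := by
  refine AddMonoidHom.ext fun m => ?_
  obtain ⟨m, hm⟩ := m
  induction hm using AddSubgroup.closure_induction with
  | mem m hm =>
    obtain ⟨r, s, rfl⟩ := hm
    exact h (mkL R r) (mkR R s)
  | zero => exact (map_zero T).trans (map_zero T').symm
  | add x y hx hy h1 h2 =>
    have := congrArg₂ (· + ·) h1 h2
    simp only [← map_add] at this
    exact this
  | neg x hx h1 =>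
    have := congrArg (- ·) h1
    simp only [← map_neg] at this
    exact this

theorem exists_list_sum (m : sq R) : ∃ l : List ((R ⧸ annL R) × (R ⧸ annR R)),
    (l.map fun p => fR R p.1 p.2).sum = m := by
  let H : AddSubgroup (sq R) :=
    { carrier := {m | ∃ l : List ((R ⧸ annL R) × (R ⧸ annR R)),
        (l.map fun p => fR R p.1 p.2).sum = m}
      add_mem' := by
        rintro _ _ ⟨l, rfl⟩ ⟨l', rfl⟩
        exact ⟨l ++ l', by rw [List.map_append, List.sum_append]⟩
      zero_mem' := ⟨[], rfl⟩
      neg_mem' := by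
        rintro _ ⟨l, rfl⟩
        refine ⟨l.map fun p => (-p.1, p.2), ?_⟩
        induction l with
        | nil => simp
        | cons p l ih =>
          rw [List.map_cons, List.map_cons, List.sum_cons, ih, List.map_cons, List.sum_cons,
            map_neg, AddMonoidHom.neg_apply, neg_add] }
  have : (QuotientAddGroup.mk' H) = 0 := sq_hom_ext fun α β =>
    (QuotientAddGroup.eq_zero_iff _).2 ⟨[(α, β)], by simp⟩
  exact (QuotientAddGroup.eq_zero_iff m).1 (DFunLike.congr_fun this m)

theorem exists_sq_end {φ : AddMonoid.End (R ⧸ annL R) × AddMonoid.End (R ⧸ annR R)}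
    (hφ : ActsOnTarget (fR R) φ) :
    ∃ T : AddMonoid.End (sq R), ∀ α β, T (fR R α β) = fR R (φ.1 α) β := by
  choose l hl using exists_list_sum (R := R)
  let T : sq R →+ sq R := AddMonoidHom.mk' (fun m => ((l m).map fun p => fR R (φ.1 p.1) p.2).sum)
    fun m m' => by
      rw [← List.sum_append, ← List.map_append]
      exact hφ _ _ (by rw [hl, List.map_append, List.sum_append, hl, hl])
  refine ⟨T, fun α β => ?_⟩
  refine (hφ _ [(α, β)] (by rw [hl]; simp)).trans (by simp)

theorem exists_annQuot_end (φ : algScalars R) : ∃ T : AddMonoid.End (AnnQuot R), ∀ x,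
    toL R (T x) = φ.1.1 (toL R x) ∧ toR R (T x) = φ.1.2 (toR R x) := by
  have hex : ∀ x : AnnQuot R, ∃ y, toL R y = φ.1.1 (toL R x) ∧ toR R y = φ.1.2 (toR R x) := by
    intro x
    obtain ⟨r, rfl⟩ := annMk_surjective x
    obtain ⟨r', hr'⟩ := φ.2.2.2.2 r
    exact ⟨annMk R r', (congrArg Prod.fst hr').symm, (congrArg Prod.snd hr').symm⟩
  choose T hT using hex
  exact ⟨AddMonoidHom.mk' T fun x y => annQuot_ext
    (by rw [(hT _).1, map_add, map_add, map_add, (hT _).1, (hT _).1])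
    (by rw [(hT _).2, map_add, map_add, map_add, (hT _).2, (hT _).2]), hT⟩

variable (R)

theorem exists_annQuot_module : ∃ _ : Module (algScalars R) (AnnQuot R),
    ∀ (φ : algScalars R) (x : AnnQuot R),
      toL R (φ • x) = φ.1.1 (toL R x) ∧ toR R (φ • x) = φ.1.2 (toR R x) := by
  obtain ⟨inst, hinst⟩ := exists_module
    (fun (φ : algScalars R) (T : AddMonoid.End (AnnQuot R)) => ∀ x,
      toL R (T x) = φ.1.1 (toL R x) ∧ toR R (T x) = φ.1.2 (toR R x))
    exists_annQuot_end
    (fun φ T T' h h' => AddMonoidHom.ext fun x => annQuot_ext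
      ((h x).1.trans (h' x).1.symm) ((h x).2.trans (h' x).2.symm))
    (fun x => ⟨rfl, rfl⟩)
    (fun φ ψ T U h h' x => ⟨((h (U x)).1.trans (congrArg φ.1.1 (h' x).1)),
      (h (U x)).2.trans (congrArg φ.1.2 (h' x).2)⟩)
    (fun φ ψ T U h h' x => ⟨(map_add (toL R) (T x) (U x)).trans (congrArg₂ _ (h x).1 (h' x).1),
      (map_add (toR R) (T x) (U x)).trans (congrArg₂ _ (h x).2 (h' x).2)⟩)
  refine ⟨inst, fun φ x => ?_⟩
  obtain ⟨T, hT⟩ := exists_annQuot_end φ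
  rw [hinst φ T hT]
  exact hT x

theorem exists_sq_module : ∃ _ : Module (algScalars R) (sq R),
    ∀ (φ : algScalars R) (α : R ⧸ annL R) (β : R ⧸ annR R),
      φ • fR R α β = fR R (φ.1.1 α) β := by
  obtain ⟨inst, hinst⟩ := exists_module
    (fun (φ : algScalars R) (T : AddMonoid.End (sq R)) => ∀ α β, T (fR R α β) = fR R (φ.1.1 α) β)
    (fun φ => exists_sq_end φ.2.1.2)
    (fun φ T T' h h' => sq_hom_ext fun α β => (h α β).trans (h' α β).symm)
    (fun α β => rfl)
    (fun φ ψ T U h h' α β => (congrArg T (h' α β)).trans (h _ β))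
    (fun φ ψ T U h h' α β => by
      change T _ + U _ = fR R (φ.1.1 α + ψ.1.1 α) β
      rw [h, h', map_add, AddMonoidHom.add_apply])
  refine ⟨inst, fun φ α β => ?_⟩
  obtain ⟨T, hT⟩ := exists_sq_end φ.2.1.2
  rw [hinst φ T hT]
  exact hT α β

variable {R}

/-- Every element of a ring of scalars acts as an element of `𝔖(R)`. -/
theorem IsAlgRingOfScalars.exists_algScalars {S : Type u} [CommRing S] [Module S (AnnQuot R)]
    [Module S (sq R)] (hS : IsAlgRingOfScalars R S) (s : S) : ∃ φ : algScalars R,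
    (∀ x, φ.1.1 (toL R x) = toL R (s • x)) ∧ ∀ x, φ.1.2 (toR R x) = toR R (s • x) := by
  have e1 : ∀ x y, fR R (toL R (s • x)) (toR R y) = s • fR R (toL R x) (toR R y) :=
    hS.scalars.map_smul_fst s
  have e2 : ∀ x y, fR R (toL R x) (toR R (s • y)) = s • fR R (toL R x) (toR R y) :=
    hS.scalars.map_smul_snd s
  let g₁ : AnnQuot R →+ R ⧸ annL R := (toL R).comp (DistribSMul.toAddMonoidHom _ s)
  let g₂ : AnnQuot R →+ R ⧸ annR R := (toR R).comp (DistribSMul.toAddMonoidHom _ s)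
  -- multiplication by `s` respects `Ann_λ(R)` and `Ann_ρ(R)`, as `f_R` is non-degenerate
  have k₁ : (toL R).ker ≤ g₁.ker := by
    intro x hx
    refine fR_left_ext fun β => ?_
    obtain ⟨y, rfl⟩ := toR_surjective β
    refine (e1 x y).trans ?_
    rw [show toL R x = 0 from hx, map_zero, AddMonoidHom.zero_apply, smul_zero]
  have k₂ : (toR R).ker ≤ g₂.ker := by
    intro x hx
    refine fR_right_ext fun α => ?_
    obtain ⟨y, rfl⟩ := toL_surjective α
    refine (e2 y x).trans ?_
    rw [show toR R x = 0 from hx, map_zero, smul_zero]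
  let φ : AddMonoid.End (R ⧸ annL R) × AddMonoid.End (R ⧸ annR R) :=
    (AddMonoidHom.liftOfSurjective _ toL_surjective ⟨g₁, k₁⟩,
      AddMonoidHom.liftOfSurjective _ toR_surjective ⟨g₂, k₂⟩)
  have hL : ∀ x, φ.1 (toL R x) = toL R (s • x) := fun x =>
    AddMonoidHom.liftOfRightInverse_comp_apply _ _ _ ⟨g₁, k₁⟩ x
  have hR : ∀ x, φ.2 (toR R x) = toR R (s • x) := fun x =>
    AddMonoidHom.liftOfRightInverse_comp_apply _ _ _ ⟨g₂, k₂⟩ x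
  have f1 : ∀ α β, fR R (φ.1 α) β = s • fR R α β := by
    intro α β
    obtain ⟨x, rfl⟩ := toL_surjective α
    obtain ⟨y, rfl⟩ := toR_surjective β
    rw [hL, e1]
  have f2 : ∀ α β, fR R α (φ.2 β) = s • fR R α β := by
    intro α β
    obtain ⟨x, rfl⟩ := toL_surjective α
    obtain ⟨y, rfl⟩ := toR_surjective β
    rw [hR, e2]
  have hsym : φ ∈ Sym (fR R) := fun α β => by rw [f1, f2]
  have hcoe : ∀ m : sq R, annMk R ((s • m : sq R) : R) = s • annMk R (m : R) := hS.map_smul s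
  refine ⟨⟨φ, ⟨⟨hsym, fun ψ hψ => commute_of_fst hsym hψ (AddMonoidHom.ext fun α =>
    fR_left_ext fun β => ?_)⟩, fun l l' hl => ?_⟩, fun α β => ?_, fun α β => ?_, fun r => ?_⟩,
    hL, hR⟩
  · change fR R (φ.1 (ψ.1 α)) β = fR R (ψ.1 (φ.1 α)) β
    rw [f1, hψ, hψ, f1]
  · have key : ∀ l : List ((R ⧸ annL R) × (R ⧸ annR R)),
        (l.map fun p => fR R (φ.1 p.1) p.2).sum = s • (l.map fun p => fR R p.1 p.2).sum := by
      intro l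
      simp only [f1, List.smul_sum, List.map_map, Function.comp_def]
    rw [key, key, hl]
  · rw [f1]
    exact (congrArg (toL R) (hcoe _)).trans (hL _).symm
  · rw [f1]
    exact (congrArg (toR R) (hcoe _)).trans (hR _).symm
  · obtain ⟨r', hr'⟩ := annMk_surjective (s • annMk R r)
    refine ⟨r', Prod.ext ((hL (annMk R r)).trans ?_) ((hR (annMk R r)).trans ?_)⟩
    · rw [← hr']; rfl
    · rw [← hr']; rfl

variable (R)

theorem algScalarsIsMaximal : AlgScalarsIsMaximal R := by
  obtain ⟨inst₁, h₁⟩ := exists_annQuot_module R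
  obtain ⟨inst₂, h₂⟩ := exists_sq_module R
  refine ⟨inst₁, inst₂, h₁, ⟨⟨⟨fun {φ ψ} H => ?_⟩, ⟨fun {φ ψ} H => ?_⟩, ⟨fun {φ ψ} H => ?_⟩,
    fun φ x y => ?_, fun φ x y => ?_⟩, fun φ m => ?_⟩, fun S _ _ _ hS => ?_⟩
  · exact algScalars_ext (fun x => by rw [← (h₁ φ x).1, H, (h₁ ψ x).1])
      fun x => by rw [← (h₁ φ x).2, H, (h₁ ψ x).2]
  · exact algScalars_ext (fun x => by rw [← (h₁ φ x).1, H, (h₁ ψ x).1])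
      fun x => by rw [← (h₁ φ x).2, H, (h₁ ψ x).2]
  · have hf : ∀ α β, fR R (φ.1.1 α) β = fR R (ψ.1.1 α) β := fun α β => by rw [← h₂, H, h₂]
    refine algScalars_ext (fun x => fR_left_ext fun β => hf _ β) fun x => fR_right_ext fun α => ?_
    rw [← φ.2.1.1.1, ← ψ.2.1.1.1, hf]
  · change fR R (toL R (φ • x)) (toR R y) = φ • fR R (toL R x) (toR R y)
    rw [(h₁ φ x).1, h₂]
  · change fR R (toL R x) (toR R (φ • y)) = φ • fR R (toL R x) (toR R y)
    rw [(h₁ φ y).2, h₂, φ.2.1.1.1]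
  · have : ((annMk R).comp (sq R).subtype).comp (DistribSMul.toAddMonoidHom (sq R) φ) =
        (DistribSMul.toAddMonoidHom (AnnQuot R) φ).comp ((annMk R).comp (sq R).subtype) := by
      refine sq_hom_ext fun α β => ?_
      change annMk R ((φ • fR R α β : sq R) : R) = φ • annMk R (fR R α β : R)
      rw [h₂]
      refine annQuot_ext ?_ ?_
      · rw [(h₁ _ _).1]
        exact φ.2.2.1 α β
      · rw [(h₁ _ _).2]
        exact φ.2.2.2.1 α β
    exact DFunLike.congr_fun this m
  · choose ι hL hR using hS.exists_algScalars
    have hsmul : ∀ (s : S) (x : AnnQuot R), ι s • x = s • x := fun s x =>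
      annQuot_ext (by rw [(h₁ _ _).1, hL]) (by rw [(h₁ _ _).2, hR])
    refine ⟨{ toFun := ι, map_one' := ?_, map_mul' := fun s t => ?_, map_zero' := ?_,
              map_add' := fun s t => ?_ }, fun s t hst => ?_, hsmul, fun s m => ?_⟩
    · exact algScalars_ext (fun x => by rw [hL, one_smul]; rfl) fun x => by rw [hR, one_smul]; rfl
    · exact algScalars_ext
        (fun x => by rw [hL, mul_smul, ← hL, ← hL]; rfl)
        fun x => by rw [hR, mul_smul, ← hR, ← hR]; rfl
    · exact algScalars_ext (fun x => by rw [hL, zero_smul, map_zero]; rfl)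
        fun x => by rw [hR, zero_smul, map_zero]; rfl
    · exact algScalars_ext (fun x => by rw [hL, add_smul, map_add, ← hL, ← hL]; rfl)
        fun x => by rw [hR, add_smul, map_add, ← hR, ← hR]; rfl
    · have := hS.scalars.faithful_fst
      refine eq_of_smul_eq_smul (α := AnnQuot R) fun x => ?_
      rw [← hsmul, ← hsmul]
      exact congrArg (· • x) hst
    · have : DistribSMul.toAddMonoidHom (sq R) (ι s) =
          DistribSMul.toAddMonoidHom (sq R) s := by
        refine sq_hom_ext fun α β => ?_
        obtain ⟨x, rfl⟩ := toL_surjective α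
        obtain ⟨y, rfl⟩ := toR_surjective β
        change ι s • fR R (toL R x) (toR R y) = s • fR R (toL R x) (toR R y)
        rw [h₂, hL]
        exact hS.scalars.map_smul_fst s x y
      exact DFunLike.congr_fun this m

end

end ZAlg

/-! ### The direct decomposition -/

namespace ZAlg

open Finset

/-- A complete system of orthogonal idempotent scalars decomposes an algebra into a direct
product. -/
theorem isDirectProduct_of_idempotents {A S : Type*} [NonUnitalNonAssocRing A] [CommRing S]
    [Module S A] (hl : ∀ (s : S) (x y : A), (s • x) * y = s • (x * y))
    (hr : ∀ (s : S) (x y : A), x * (s • y) = s • (x * y)) {l : ℕ} {e : Fin l → S}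
    (he : CompleteOrthogonalIdempotents e) {B : Fin l → NonUnitalSubring A}
    (hB : ∀ i x, x ∈ B i ↔ e i • x = x) : IsDirectProduct A B := by
  have hmem : ∀ i x, e i • x ∈ B i := fun i x => (hB i _).2 (by rw [smul_smul, (he.idem i).eq])
  have hfix : ∀ i (x : B i), e i • (x : A) = x := fun i x => (hB i x).1 x.2
  have hort : ∀ i j, i ≠ j → ∀ x : B j, e i • (x : A) = 0 := fun i j hij x => by
    rw [← hfix j x, smul_smul, he.ortho hij, zero_smul]
  have hproj : ∀ (x : ∀ i, B i) i, e i • (∑ j, (x j : A)) = x i := fun x i => by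
    rw [Finset.smul_sum, Finset.sum_eq_single i (fun j _ hj => hort i j hj.symm _) (by simp), hfix]
  have hsum : ∀ x : A, ∑ i, e i • x = x := fun x => by
    rw [← Finset.sum_smul, he.complete, one_smul]
  refine ⟨{ toFun := fun x => ∑ i, (x i : A)
            invFun := fun x i => ⟨e i • x, hmem i x⟩
            left_inv := fun x => funext fun i => Subtype.ext (hproj x i)
            right_inv := fun x => hsum x
            map_mul' := fun x y => ?_
            map_add' := fun x y => ?_ }, fun x => rfl⟩
  · rw [← hsum ((∑ i, (x i : A)) * ∑ i, (y i : A))]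
    refine Finset.sum_congr rfl fun i _ => ?_
    -- multiplication by `e i` on a product can be moved to both factors
    rw [← (he.idem i).eq, mul_smul, ← hl, ← hr, hproj, hproj]
    rfl
  · rw [← Finset.sum_add_distrib]
    rfl

/-- The primitive idempotents are orthogonal, and `1` is a sum of primitive idempotents, so that
`1 - ∑ e_i` is annihilated by `1`. -/
theorem completeOrthogonal_of_range_eq_primitive {S : Type*} [CommRing S] [IsNoetherianRing S]
    {ι : Type*} [Fintype ι] {e : ι → S} (hinj : Function.Injective e)
    (hrange : Set.range e = {f | IsPrimitiveIdempotent f}) : CompleteOrthogonalIdempotents e := by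
  have hprim : ∀ i, IsPrimitiveIdempotent (e i) := fun i => hrange.subset ⟨i, rfl⟩
  have hort : OrthogonalIdempotents e := ⟨fun i => (hprim i).1, fun i j hij =>
    (hprim i).mul_eq_zero (hprim j) (hinj.ne hij)⟩
  refine ⟨hort, ?_⟩
  obtain ⟨l, g, hg, hgp⟩ := exists_completeOrthogonal_primitive S
  have h0 : (1 - ∑ i, e i) * ∑ j, g j = 0 := by
    rw [Finset.mul_sum]
    refine Finset.sum_eq_zero fun j _ => ?_
    obtain ⟨i, hi⟩ := hrange.superset (hgp j)
    rw [← hi, sub_mul, one_mul, Finset.sum_mul,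
      Finset.sum_eq_single i (fun k _ hk => hort.ortho hk) (by simp), (hort.idem i).eq, sub_self]
  rw [hg.complete, mul_one, sub_eq_zero] at h0
  exact h0.symm

section

variable {R : Type u} [NonUnitalNonAssocRing R] {C : AlgCode} {a : Fin C.1 → R}

theorem mul_eq_annMk_fStar (x y : AnnQuot R) : x * y = annMk R (fStar R x y : R) := by
  obtain ⟨r, rfl⟩ := annMk_surjective x
  obtain ⟨s, rfl⟩ := annMk_surjective y
  rw [fStar_mk]
  rfl

theorem IsAlgRingOfScalars.smul_mul {S : Type u} [CommRing S] [Module S (AnnQuot R)]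
    [Module S (sq R)] (hS : IsAlgRingOfScalars R S) (s : S) (x y : AnnQuot R) :
    (s • x) * y = s • (x * y) := by
  rw [mul_eq_annMk_fStar, hS.scalars.map_smul_fst, hS.map_smul, ← mul_eq_annMk_fStar]

theorem IsAlgRingOfScalars.mul_smul {S : Type u} [CommRing S] [Module S (AnnQuot R)]
    [Module S (sq R)] (hS : IsAlgRingOfScalars R S) (s : S) (x y : AnnQuot R) :
    x * (s • y) = s • (x * y) := by
  rw [mul_eq_annMk_fStar, hS.scalars.map_smul_snd, hS.map_smul, ← mul_eq_annMk_fStar]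

variable (h : C.Presents R a) {D : ScalarsCode} {E : IdemCode} {P : PartsCode}
include h

/-- The residue class of `r_{ij}` is `e_i a_j`, and therefore `R_i = e_i (R/Ann(R))`. -/
theorem isDirectProduct_factor (hD : IsStep1 C R a D) (hE : IsStep2 D E)
    (hP : IsStep3 C R a D E P) :
    IsDirectProduct (AnnQuot R) fun i : Fin E.length => factor C R a P i := by
  obtain ⟨inst₁, inst₂, hact, hS, -⟩ := algScalarsIsMaximal R
  obtain ⟨f, hf, hgen, hker⟩ := isStep1_iff.1 hD
  obtain ⟨Ψ, hΨ⟩ := exists_quotient_equiv hgen hker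
  obtain ⟨Λ, c, hT⟩ := exists_isTable h hf hgen
  have hfin := finite_of_presents (hT.presents h hf hgen)
  have hnoeth : IsNoetherianRing (algScalars R) := IsNoetherianRing.of_finite ℤ _
  let e : Fin E.length → algScalars R := fun i =>
    (E.get i).evalAt fun k : Fin D.1.length => f k
  have he : ∀ i, Ψ (Ideal.Quotient.mk D.ideal ((E.get i).toPoly D.t)) = e i := fun i => by
    rw [hΨ, aeval_toPoly]
  have hinj : Function.Injective e := fun i j hij => hE.1 (Ψ.injective (by
    beta_reduce
    rw [he, he, hij]))
  have hrange : Set.range e = {g | IsPrimitiveIdempotent g} := by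
    ext g
    constructor
    · rintro ⟨i, rfl⟩
      rw [← he]
      exact IsPrimitiveIdempotent.map Ψ (hE.2.subset ⟨i, rfl⟩)
    · intro hg
      obtain ⟨i, hi⟩ := hE.2.superset (IsPrimitiveIdempotent.map Ψ.symm hg)
      exact ⟨i, by rw [← he]; exact (congrArg Ψ hi).trans (Ψ.apply_symm_apply g)⟩
  have hcomp := completeOrthogonal_of_range_eq_primitive hinj hrange
  have hpart : ∀ (i : Fin E.length) j, annMk R (part C R a P i j) = e i • annMk R (a j) := by
    intro i j
    have := (isStep3_iff hf).1 hP i j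
    exact annQuot_ext ((congrArg Prod.fst this).trans (hact (e i) (annMk R (a j))).1.symm)
      ((congrArg Prod.snd this).trans (hact (e i) (annMk R (a j))).2.symm)
  refine isDirectProduct_of_idempotents hS.smul_mul hS.mul_smul hcomp fun i x => ⟨fun hx => ?_,
    fun hx => ?_⟩
  · induction hx using NonUnitalSubring.closure_induction with
    | mem x hx =>
      obtain ⟨j, rfl⟩ := hx
      beta_reduce
      rw [hpart, smul_smul, (hcomp.idem i).eq]
    | zero => exact smul_zero _
    | add x y _ _ hx hy => rw [smul_add, hx, hy]
    | neg x _ hx => rw [smul_neg, hx]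
    | mul x y _ _ hx _ => rw [← hS.smul_mul, hx]
  · obtain ⟨r, rfl⟩ := annMk_surjective x
    obtain ⟨w, rfl⟩ := val_surjective h r
    rw [← hx, val_apply, map_sum, Finset.smul_sum]
    refine sum_mem fun j _ => ?_
    rw [map_zsmul, smul_comm, ← hpart]
    refine zsmul_mem (NonUnitalSubring.subset_closure ?_) _
    exact ⟨j, rfl⟩

end

end ZAlg

theorem mainTheorem6 :
    ∃ (step1 : ZAlg.AlgCode →. ZAlg.ScalarsCode)
      (step2 : ZAlg.AlgCode × ZAlg.ScalarsCode →. ZAlg.IdemCode)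
      (step3 : ZAlg.AlgCode × ZAlg.ScalarsCode × ZAlg.IdemCode →. ZAlg.PartsCode),
      Partrec step1 ∧ Partrec step2 ∧ Partrec step3 ∧
      ∀ (C : ZAlg.AlgCode) (R : Type u) [NonUnitalNonAssocRing R] (a : Fin C.1 → R),
        C.Presents R a →
        ZAlg.AlgScalarsIsMaximal R ∧
        (∃ D ∈ step1 C, ZAlg.IsStep1 C R a D) ∧
        (∀ D, ZAlg.IsStep1 C R a D → ∃ E ∈ step2 (C, D), ZAlg.IsStep2 D E) ∧
        (∀ D E, ZAlg.IsStep1 C R a D → ZAlg.IsStep2 D E →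
          ∃ P ∈ step3 (C, D, E), ZAlg.IsStep3 C R a D E P) ∧
        ∀ D E P, ZAlg.IsStep1 C R a D → ZAlg.IsStep2 D E → ZAlg.IsStep3 C R a D E P →
          ZAlg.IsDirectProduct (ZAlg.AnnQuot R)
            (fun i : Fin E.length => ZAlg.factor C R a P i) := by
  obtain ⟨step1, p1, h1⟩ := Semi.exists_partrec
    (p := fun (C : ZAlg.AlgCode) (D : ZAlg.ScalarsCode) =>
    ZAlg.IsScalTuples C D.1 ∧ ZAlg.IsTableIdeal C D.1 D.2) ZAlg.semi_step1
  obtain ⟨step2, p2, h2⟩ := Semi.exists_partrec (p := fun (x : ZAlg.AlgCode × ZAlg.ScalarsCode)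
    (E : ZAlg.IdemCode) => ZAlg.IsIdemForms x.1 x.2.1 E) ZAlg.semi_step2
  obtain ⟨step3, p3, h3⟩ := Semi.exists_partrec
    (p := fun (x : ZAlg.AlgCode × ZAlg.ScalarsCode × ZAlg.IdemCode)
    (P : ZAlg.PartsCode) => ZAlg.IsParts x.1 x.2.1.1 x.2.2 P) ZAlg.semi_step3
  refine ⟨step1, step2, step3, p1, p2, p3, fun C R _ a h => ⟨ZAlg.algScalarsIsMaximal R, ?_, ?_, ?_,
    fun D E P => ZAlg.isDirectProduct_factor h⟩⟩
  · obtain ⟨D, hD, hc⟩ := h1 C (ZAlg.exists_isScalTuples h)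
    exact ⟨D, hD, ZAlg.isStep1_of_isScalTuples h hc.1 hc.2⟩
  · intro D hD
    obtain ⟨E, hE, hc⟩ := h2 (C, D) (ZAlg.exists_isIdemForms h hD)
    exact ⟨E, hE, hc.isStep2 h hD⟩
  · intro D E hD _
    obtain ⟨P, hP, hc⟩ := h3 (C, D, E) (ZAlg.exists_isParts h hD E)
    exact ⟨P, hP, (ZAlg.isParts_iff h).1 hc⟩
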